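/- **Theorem (Hamilton–Pontryagin principle).** Let $G$ be a (real, smooth, possibly infinite-dimensional Banach) Lie group with Lie algebra $\mathfrak g=T_{\mathrm{id}}G$, acting smoothly from the left on a smooth (Banach) manifold $N$ without boundary, and let $\ell:\mathfrak g\times TN\to\mathbb R$, $(u,n,\nu)\mapsto \ell(u,n,\nu)$ with $\nu\in T_nN$, be smooth. Write $un\in T_nN$ for the infinitesimal action of $u\in\mathfrak g$ at $n\in N$; $\mathrm{ad}_uv=[u,v]$, where $[\cdot,\cdot]$ is the bracket of left-invariant vector fields (the commutator for matrix groups); $\langle \mathrm{ad}^*_u m,v\rangle=\langle m,\mathrm{ad}_uv\rangle$ for $m\in\mathfrak g^*$; and $\langle\sigma\diamond n,u\rangle=-\langle\sigma,un\rangle$ for $\sigma\in T_n^*N$. In a local chart of $N$, $u\omega$ denotes the derivative of the vector field $n\mapsto un$ in the direction $\omega$, and $\langle u\star\sigma,\omega\rangle=\langle\sigma,u\omega\rangle$; the derivatives $\frac{\delta \ell}{\delta u}\in\mathfrak g^*$ and $\frac{\delta \ell}{\delta \nu}\in T_n^*N$ are the partial derivatives of $\ell$ in $u$ and along the fibre $T_nN$,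 and $\frac{\delta \ell}{\delta n}$ is the partial derivative of $\ell$ in the base variable in the induced chart on $TN$. All curves are smooth functions of time. For a curve $(u,n,\nu)$ in $\mathfrak g\times TN$ consider the Euler–Poincaré (coadjoint motion) system on $[0,1]$ $$ \frac{\partial}{\partial t}\Big(\frac{\delta \ell}{\delta u}+\frac{\delta \ell}{\delta \nu}\diamond n\Big)+\mathrm{ad}^*_u\Big(\frac{\delta \ell}{\delta u}+\frac{\delta \ell}{\delta \nu}\diamond n\Big)=0,\qquad \frac{\partial}{\partial t}\frac{\delta \ell}{\delta \nu}+u\star\frac{\delta \ell}{\delta \nu}-\frac{\delta \ell}{\delta n}=0,\qquad \dot n=\nu+un, \tag{EP} $$ where the second equation is required in every local chart of $N$. For a curve $(u,n,\nu,g,M,\sigma)$ with $g(t)\in G$, $M(t)\in\mathfrak g^*$, $\sigma(t)\in T^*_{n(t)}N$, consider the constrained action $$ S=\int_0^1\Big[\ell(u,n,\nu)+\langle M,\dot gg^{-1}-u\rangle+\langle\sigma,\dot n-\nu-un\rangle\Big]dt , $$ and say that $\delta S=0$ at the curve if $\frac{d}{d\varepsilon}\big|_{\varepsilon=0}S=0$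 along every smooth one-parameter family of curves $(u_\varepsilon,n_\varepsilon,\nu_\varepsilon,g_\varepsilon,M_\varepsilon,\sigma_\varepsilon)$ that passes through it at $\varepsilon=0$ and keeps the endpoints $g_\varepsilon(0),g_\varepsilon(1),n_\varepsilon(0),n_\varepsilon(1)$ fixed. Then: 1. $\delta S=0$ at $(u,n,\nu,g,M,\sigma)$ if and only if, on $[0,1]$, $$M=\frac{\delta \ell}{\delta u}+\sigma\diamond n,\qquad \sigma=\frac{\delta \ell}{\delta \nu},\qquad \dot gg^{-1}=u,$$ and $(u,n,\nu)$ satisfies (EP). 2. A curve $(u,n,\nu)$ satisfies (EP) if and only if there are curves $g,M,\sigma$ with $g(0)=\mathrm{id}$ such that $\delta S=0$ at $(u,n,\nu,g,M,\sigma)$. -/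

import Mathlib

open Set MeasureTheory
open scoped Manifold ContDiff Topology

noncomputable section

namespace Metamorphosis

variable {E : Type*} [NormedAddCommGroup E] [NormedSpace ℝ E]
  {F : Type*} [NormedAddCommGroup F] [NormedSpace ℝ F]
  {G : Type*} [TopologicalSpace G] [ChartedSpace E G] [Group G]
  {N : Type*} [TopologicalSpace N] [ChartedSpace F N]

/-! Throughout, `G` is a Lie group modelled on the Banach space `E`, so that the Lie algebra
`𝔤 = T₁G` is by definition the Banach space `E`, and `N` is a manifold modelled on `F` on which
`G` acts from the left. -/

/-- The adjoint operator `ad_u v = [u, v]` on the Lie algebra `𝔤 = T₁G`. The bracket is that of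
left invariant vector fields, i.e. minus that of right invariant ones. -/
def ad (G : Type*) [TopologicalSpace G] [ChartedSpace E G] [Group G]
    (u v : GroupLieAlgebra 𝓘(ℝ, E) G) : GroupLieAlgebra 𝓘(ℝ, E) G :=
  ⁅u, v⁆

/-- The infinitesimal action `u ↦ u n ∈ TₙN` of the Lie algebra at the point `n` of `N`. -/
def infAct (G : Type*) [TopologicalSpace G] [ChartedSpace E G] [Group G] [MulAction G N]
    (n : N) : E →L[ℝ] TangentSpace 𝓘(ℝ, F) n :=
  mfderiv 𝓘(ℝ, E) 𝓘(ℝ, F) (fun h : G => h • n) 1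

/-- The diamond operation `⟨σ ⋄ n, u⟩ = - ⟨σ, u n⟩` for `σ ∈ Tₙ*N`. -/
def diamond (G : Type*) [TopologicalSpace G] [ChartedSpace E G] [Group G] [MulAction G N]
    {n : N} (σ : TangentSpace 𝓘(ℝ, F) n →L[ℝ] ℝ) : E →L[ℝ] ℝ :=
  -(σ ∘L (infAct G n : E →L[ℝ] TangentSpace 𝓘(ℝ, F) n))

/-- The velocity `ṅ(t)` of a curve in a manifold. -/
def velocity (n : ℝ → N) (t : ℝ) : TangentSpace 𝓘(ℝ, F) (n t) :=
  mfderiv 𝓘(ℝ, ℝ) 𝓘(ℝ, F) n t (1 : ℝ)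

/-- The right-trivialised velocity `ġ(t) g(t)⁻¹ ∈ 𝔤` of a curve in `G`. -/
def rightVelocity (g : ℝ → G) (t : ℝ) : E :=
  mfderiv 𝓘(ℝ, E) 𝓘(ℝ, E) (fun h : G => h * (g t)⁻¹) (g t) (velocity (F := E) g t)

/-- Curves `(u, n, ν)` in `𝔤 × TN`, with `ν(t)` a tangent vector at `n(t)`. -/
structure ReducedCurve (E F N : Type*) [NormedAddCommGroup E] [NormedSpace ℝ E]
    [NormedAddCommGroup F] [NormedSpace ℝ F] [TopologicalSpace N] [ChartedSpace F N] where
  u : ℝ → E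
  n : ℝ → N
  ν : ∀ t, TangentSpace 𝓘(ℝ, F) (n t)

/-- Curves `(u, n, ν, g, M, σ)`, with `g(t) ∈ G`, `M(t) ∈ 𝔤*` and `σ(t)` a cotangent vector
at `n(t)`. -/
structure PontryaginCurve (E F G N : Type*) [NormedAddCommGroup E] [NormedSpace ℝ E]
    [NormedAddCommGroup F] [NormedSpace ℝ F] [TopologicalSpace N] [ChartedSpace F N]
    extends ReducedCurve E F N where
  g : ℝ → G
  M : ℝ → (E →L[ℝ] ℝ)
  σ : ∀ t, TangentSpace 𝓘(ℝ, F) (n t) →L[ℝ] ℝ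

/-- Smoothness of `(u, n, ν)`. -/
structure ReducedCurve.IsSmooth [IsManifold 𝓘(ℝ, F) ∞ N] (r : ReducedCurve E F N) : Prop where
  u : ContDiff ℝ ∞ r.u
  ν : ContMDiff 𝓘(ℝ, ℝ) 𝓘(ℝ, F).tangent ∞
    (fun t => (⟨r.n t, r.ν t⟩ : TangentBundle 𝓘(ℝ, F) N))

/-- Joint smoothness, in the parameter and in time, of a one-parameter family of curves
`(u, n, ν, g, M, σ)`. Smoothness of `(n, ν)` is that of a map into `TN`, and smoothness of
`(n, σ)` that of a map into `T*N`. -/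
structure IsSmoothFamily [IsManifold 𝓘(ℝ, F) ∞ N] (c : ℝ → PontryaginCurve E F G N) :
    Prop where
  u : ContDiff ℝ ∞ (fun p : ℝ × ℝ => (c p.1).u p.2)
  ν : ContMDiff 𝓘(ℝ, ℝ × ℝ) 𝓘(ℝ, F).tangent ∞
    (fun p : ℝ × ℝ => (⟨(c p.1).n p.2, (c p.1).ν p.2⟩ : TangentBundle 𝓘(ℝ, F) N))
  g : ContMDiff 𝓘(ℝ, ℝ × ℝ) 𝓘(ℝ, E) ∞ (fun p : ℝ × ℝ => (c p.1).g p.2)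
  M : ContDiff ℝ ∞ (fun p : ℝ × ℝ => (c p.1).M p.2)
  σ : ContMDiff 𝓘(ℝ, ℝ × ℝ) (𝓘(ℝ, F).prod 𝓘(ℝ, F →L[ℝ] ℝ)) ∞
    (fun p : ℝ × ℝ => Bundle.TotalSpace.mk' (F →L[ℝ] ℝ)
      (E := fun x : N => TangentSpace 𝓘(ℝ, F) x →L[ℝ] ℝ) ((c p.1).n p.2) ((c p.1).σ p.2))

/-- Smoothness of a single curve `(u, n, ν, g, M, σ)`. -/
structure PontryaginCurve.IsSmooth [IsManifold 𝓘(ℝ, F) ∞ N] (γ : PontryaginCurve E F G N) :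
    Prop where
  reduced : γ.toReducedCurve.IsSmooth
  g : ContMDiff 𝓘(ℝ, ℝ) 𝓘(ℝ, E) ∞ γ.g
  M : ContDiff ℝ ∞ γ.M
  σ : ContMDiff 𝓘(ℝ, ℝ) (𝓘(ℝ, F).prod 𝓘(ℝ, F →L[ℝ] ℝ)) ∞
    (fun t => Bundle.TotalSpace.mk' (F →L[ℝ] ℝ)
      (E := fun x : N => TangentSpace 𝓘(ℝ, F) x →L[ℝ] ℝ) (γ.n t) (γ.σ t))

section Action

variable [MulAction G N] (ℓ : E → TangentBundle 𝓘(ℝ, F) N → ℝ)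

/-- The constrained action
`S = ∫₀¹ [ℓ(u, n, ν) + ⟨M, ġ g⁻¹ - u⟩ + ⟨σ, ṅ - ν - u n⟩] dt`. -/
def action (γ : PontryaginCurve E F G N) : ℝ :=
  ∫ t in (0 : ℝ)..1,
    (ℓ (γ.u t) ⟨γ.n t, γ.ν t⟩
      + γ.M t (rightVelocity γ.g t - γ.u t)
      + γ.σ t (velocity γ.n t - γ.ν t - infAct G (γ.n t) (γ.u t)))

/-- A variation of `γ`: a smooth one-parameter family of curves `(u, n, ν, g, M, σ)` through `γ`
along which the endpoints of `g` and of `n` are fixed. -/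
structure IsVariation [IsManifold 𝓘(ℝ, F) ∞ N] (γ : PontryaginCurve E F G N)
    (c : ℝ → PontryaginCurve E F G N) : Prop where
  smooth : IsSmoothFamily c
  base : c 0 = γ
  g_zero : ∀ ε, (c ε).g 0 = γ.g 0
  g_one : ∀ ε, (c ε).g 1 = γ.g 1
  n_zero : ∀ ε, (c ε).n 0 = γ.n 0
  n_one : ∀ ε, (c ε).n 1 = γ.n 1

/-- `δS = 0` at `γ`. -/
def IsStationary [IsManifold 𝓘(ℝ, F) ∞ N] (γ : PontryaginCurve E F G N) : Prop :=
  ∀ c : ℝ → PontryaginCurve E F G N, IsVariation γ c →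
    HasDerivAt (fun ε => action ℓ (c ε)) 0 0

end Action

section Derivatives

variable (ℓ : E → TangentBundle 𝓘(ℝ, F) N → ℝ)

/-- `δℓ/δu ∈ 𝔤*`. -/
def dU (u : E) (n : N) (ν : TangentSpace 𝓘(ℝ, F) n) : E →L[ℝ] ℝ :=
  fderiv ℝ (fun w : E => ℓ w ⟨n, ν⟩) u

/-- `δℓ/δν ∈ Tₙ*N`, the derivative of `ℓ` along the fibre `TₙN`. -/
def dNu (u : E) (n : N) (ν : TangentSpace 𝓘(ℝ, F) n) : TangentSpace 𝓘(ℝ, F) n →L[ℝ] ℝ :=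
  fderiv ℝ (fun w : F => ℓ u ⟨n, w⟩) ν

/-- The Lagrangian in the local chart `φ`, as a function of `u`, `x` and `v`, where `(x, v)` are
the induced coordinates on `TN`. -/
def localLagrangian (φ : OpenPartialHomeomorph N F) (u : E) (x v : F) : ℝ :=
  ℓ u (tangentMap 𝓘(ℝ, F) 𝓘(ℝ, F) φ.symm ⟨x, v⟩)

/-- The coordinate expression in the chart `φ` of the vector field `n ↦ u n` on `N`. -/
def localInfAct (G : Type*) [TopologicalSpace G] [ChartedSpace E G] [Group G] [MulAction G N]
    (φ : OpenPartialHomeomorph N F) (u : E) (x : F) : F :=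
  mfderiv 𝓘(ℝ, F) 𝓘(ℝ, F) φ (φ.symm x) (infAct G (φ.symm x) u)

/-- The star operation in a chart, `⟨u ⋆ p, ω⟩ = ⟨p, u ω⟩`, where `u ω` is the derivative of the
vector field `x ↦ u x` in the direction `ω`. -/
def localStar (G : Type*) [TopologicalSpace G] [ChartedSpace E G] [Group G] [MulAction G N]
    (φ : OpenPartialHomeomorph N F) (u : E) (x : F) (p : F →L[ℝ] ℝ) : F →L[ℝ] ℝ :=
  p ∘L fderiv ℝ (localInfAct G φ u) x

namespace ReducedCurve

variable (r : ReducedCurve E F N)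

/-- The coordinate expression of the curve `n` in the chart `φ`. -/
def localN (φ : OpenPartialHomeomorph N F) (t : ℝ) : F := φ (r.n t)

/-- The coordinate expression of `ν` in the chart `φ`. -/
def localNu (φ : OpenPartialHomeomorph N F) (t : ℝ) : F :=
  mfderiv 𝓘(ℝ, F) 𝓘(ℝ, F) φ (r.n t) (r.ν t)

/-- The coordinate expression of `δℓ/δν` along the curve. -/
def localDNu (φ : OpenPartialHomeomorph N F) (t : ℝ) : F →L[ℝ] ℝ :=
  fderiv ℝ (fun v => localLagrangian ℓ φ (r.u t) (r.localN φ t) v) (r.localNu φ t)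

/-- The coordinate expression of `δℓ/δn` along the curve. -/
def localDN (φ : OpenPartialHomeomorph N F) (t : ℝ) : F →L[ℝ] ℝ :=
  fderiv ℝ (fun x => localLagrangian ℓ φ (r.u t) x (r.localNu φ t)) (r.localN φ t)

/-- The total momentum `δℓ/δu + (δℓ/δν) ⋄ n` along the curve. -/
def momentum (G : Type*) [TopologicalSpace G] [ChartedSpace E G] [Group G] [MulAction G N]
    (t : ℝ) : E →L[ℝ] ℝ :=
  dU ℓ (r.u t) (r.n t) (r.ν t) + diamond G (dNu ℓ (r.u t) (r.n t) (r.ν t))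

/-- The Euler–Poincaré equations for coadjoint motion on `[0, 1]`:
`∂ₜ m + ad*_u m = 0` in `𝔤*` for `m = δℓ/δu + (δℓ/δν) ⋄ n`, where `⟨ad*_u m, v⟩ = ⟨m, ad_u v⟩`;
`∂ₜ (δℓ/δν) + u ⋆ (δℓ/δν) - δℓ/δn = 0` in every local chart of `N`; and `ṅ = ν + u n`. -/
structure EulerPoincare (G : Type*) [TopologicalSpace G] [ChartedSpace E G] [Group G]
    [MulAction G N] : Prop where
  differentiableAt : ∀ t ∈ Icc (0 : ℝ) 1, DifferentiableAt ℝ (r.momentum ℓ G) t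
  coadjoint : ∀ t ∈ Icc (0 : ℝ) 1, ∀ v : E,
    deriv (r.momentum ℓ G) t v + r.momentum ℓ G t (ad G (r.u t) v) = 0
  template : ∀ φ ∈ IsManifold.maximalAtlas 𝓘(ℝ, F) ∞ N, ∀ t ∈ Icc (0 : ℝ) 1,
    r.n t ∈ φ.source →
      DifferentiableAt ℝ (r.localDNu ℓ φ) t ∧
      deriv (r.localDNu ℓ φ) t
        + localStar G φ (r.u t) (r.localN φ t) (r.localDNu ℓ φ t)
        - r.localDN ℓ φ t = 0
  auxiliary : ∀ t ∈ Icc (0 : ℝ) 1, velocity r.n t = r.ν t + infAct G (r.n t) (r.u t)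

end ReducedCurve

end Derivatives

end Metamorphosis

end

/-! For a smooth family of curves put `ξ = ∂ₜg g⁻¹` and `η = ∂_εg g⁻¹`. The Maurer–Cartan equation
gives `δξ = ∂ₜη + [η, ξ]` (`maurerCartan`, `fderiv_famXi`). In a chart of `N` the integrand of the
action becomes `Λ(u, x, v) + M(ξ - u) + p(ẋ - v - A(x)u)`, with `A(x)` the infinitesimal action as
an operator on the Lie algebra. Together with `δẋ = ∂ₜδx` this yields the first variation pointwise
in time (`hasDerivAt_integrand_fam`), and the action is differentiated under the integral sign.

Sufficiency: under the momentum relations, the reconstruction equation and (EP), the coefficients of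
`δu`, `δν`, `δM`, `δσ` vanish and the rest of the first variation is exactly the time derivative of
`⟨M, η⟩ + ⟨σ, δn⟩` (`hasDerivAt_boundaryTerm_of_eulerPoincare`). This boundary term is defined
without charts, so a chart is needed only near one time at a time and no subdivision of the curve
occurs. It vanishes at `0` and `1` because the endpoints of `g` and `n` are fixed.

Necessity: fix a chart and a constant direction in all six variables, and scale it by a test
function `χ` supported in the times of `(0, 1)` at which `n` lies in the chart. The variation of the
action is then `∫ (χ · force + χ' · momentum)`, so the fundamental lemma gives `force = d/dt
momentum` (`variationForce_eq_deriv`), on `[0, 1]` by continuity. Switching on one variable at a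
time produces the six equations: `δM` and `δσ` give the constraints since continuous functionals
separate points, `δu` and `δν` give the momentum relations, `δn` and `η` give the two evolution
equations.

For the second claim, `M` and `σ` are defined by the momentum relations, and `g` solves `ġ g⁻¹ = u`,
`g(0) = 1` (`exists_reconstruction`). Locally this is an ordinary differential equation in the chart
at the identity. The equation is invariant under right translation, so local solutions can be
translated to match and glued until they cover `[0, 1]`. -/

noncomputable section

set_option linter.unusedSectionVars false

namespace Metamorphosis

/-! ### Tangent and cotangent coordinates in a chart of the maximal atlas. -/

section Charts

variable {F : Type*} [NormedAddCommGroup F] [NormedSpace ℝ F]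
  {N : Type*} [TopologicalSpace N] [ChartedSpace F N]
  {P : Type*} [NormedAddCommGroup P] [NormedSpace ℝ P]

/-- The derivative of a chart, as an operator on the model space. -/
def chartD (φ : OpenPartialHomeomorph N F) (n : N) : F →L[ℝ] F :=
  mfderiv 𝓘(ℝ, F) 𝓘(ℝ, F) φ n

/-- The derivative of the inverse of a chart, as an operator on the model space. -/
def chartDSymm (φ : OpenPartialHomeomorph N F) (x : F) : F →L[ℝ] F :=
  mfderiv 𝓘(ℝ, F) 𝓘(ℝ, F) φ.symm x

theorem tangent_mk_congr {x y : N} (h : x = y) {v w : F} (hv : v = w) :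
    (⟨x, v⟩ : TangentBundle 𝓘(ℝ, F) N) = ⟨y, w⟩ := by
  subst h hv
  rfl

theorem cotangent_mk_congr {x y : N} (h : x = y) {v w : F →L[ℝ] ℝ} (hv : v = w) :
    (Bundle.TotalSpace.mk' (F →L[ℝ] ℝ) (E := fun x : N => TangentSpace 𝓘(ℝ, F) x →L[ℝ] ℝ) x v) =
      Bundle.TotalSpace.mk' (F →L[ℝ] ℝ) y w := by
  subst h hv
  rfl

variable [IsManifold 𝓘(ℝ, F) ∞ N] {φ ψ : OpenPartialHomeomorph N F}

theorem mdifferentiable_of_mem_maximalAtlas (hφ : φ ∈ IsManifold.maximalAtlas 𝓘(ℝ, F) ∞ N) :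
    φ.MDifferentiable 𝓘(ℝ, F) 𝓘(ℝ, F) :=
  ⟨(contMDiffOn_of_mem_maximalAtlas hφ).mdifferentiableOn (by simp),
    (contMDiffOn_symm_of_mem_maximalAtlas hφ).mdifferentiableOn (by simp)⟩

theorem chartDSymm_comp_chartD (hφ : φ ∈ IsManifold.maximalAtlas 𝓘(ℝ, F) ∞ N) {n : N}
    (hn : n ∈ φ.source) : chartDSymm φ (φ n) ∘L chartD φ n = ContinuousLinearMap.id ℝ F :=
  (mdifferentiable_of_mem_maximalAtlas hφ).symm_comp_deriv hn

theorem chartD_comp_chartDSymm (hφ : φ ∈ IsManifold.maximalAtlas 𝓘(ℝ, F) ∞ N) {x : F}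
    (hx : x ∈ φ.target) : chartD φ (φ.symm x) ∘L chartDSymm φ x = ContinuousLinearMap.id ℝ F :=
  (mdifferentiable_of_mem_maximalAtlas hφ).comp_symm_deriv hx

theorem chartDSymm_chartD (hφ : φ ∈ IsManifold.maximalAtlas 𝓘(ℝ, F) ∞ N) {n : N}
    (hn : n ∈ φ.source) (w : F) : chartDSymm φ (φ n) (chartD φ n w) = w :=
  DFunLike.congr_fun (chartDSymm_comp_chartD hφ hn) w

theorem chartD_chartDSymm (hφ : φ ∈ IsManifold.maximalAtlas 𝓘(ℝ, F) ∞ N) {x : F}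
    (hx : x ∈ φ.target) (w : F) : chartD φ (φ.symm x) (chartDSymm φ x w) = w :=
  DFunLike.congr_fun (chartD_comp_chartDSymm hφ hx) w

theorem chartD_chartDSymm' (hφ : φ ∈ IsManifold.maximalAtlas 𝓘(ℝ, F) ∞ N) {n : N}
    (hn : n ∈ φ.source) (w : F) : chartD φ n (chartDSymm φ (φ n) w) = w := by
  have := chartD_chartDSymm hφ (φ.map_source hn) w
  rwa [φ.left_inv hn] at this

/-- The derivative of a coordinate expression is the coordinate expression of the derivative. -/
theorem hasFDerivAt_chart_comp (hφ : φ ∈ IsManifold.maximalAtlas 𝓘(ℝ, F) ∞ N) {f : P → N} {q : P}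
    (hf : MDifferentiableAt 𝓘(ℝ, P) 𝓘(ℝ, F) f q) (hq : f q ∈ φ.source) :
    HasFDerivAt (fun p => φ (f p))
      (chartD φ (f q) ∘L (mfderiv 𝓘(ℝ, P) 𝓘(ℝ, F) f q : P →L[ℝ] F)) q := by
  have h1 : HasMFDerivAt 𝓘(ℝ, F) 𝓘(ℝ, F) φ (f q) (mfderiv 𝓘(ℝ, F) 𝓘(ℝ, F) φ (f q)) :=
    ((mdifferentiable_of_mem_maximalAtlas hφ).mdifferentiableAt hq).hasMFDerivAt
  exact (h1.comp q hf.hasMFDerivAt).hasFDerivAt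

theorem contDiffAt_chart_comp {k : WithTop ℕ∞} (hk : k ≤ ∞)
    (hφ : φ ∈ IsManifold.maximalAtlas 𝓘(ℝ, F) ∞ N) {f : P → N} {q : P}
    (hf : ContMDiffAt 𝓘(ℝ, P) 𝓘(ℝ, F) k f q) (hq : f q ∈ φ.source) :
    ContDiffAt ℝ k (fun p => φ (f p)) q :=
  (((contMDiffAt_of_mem_maximalAtlas hφ hq).of_le hk).comp q hf).contDiffAt

theorem contMDiffAt_chart_symm_comp (hφ : φ ∈ IsManifold.maximalAtlas 𝓘(ℝ, F) ∞ N) {x : P → F}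
    {q : P} (hx : ContDiffAt ℝ ∞ x q) (hq : x q ∈ φ.target) :
    ContMDiffAt 𝓘(ℝ, P) 𝓘(ℝ, F) ∞ (fun p => φ.symm (x p)) q :=
  (contMDiffAt_symm_of_mem_maximalAtlas hφ hq).comp q hx.contMDiffAt

theorem contDiffAt_transition (hφ : φ ∈ IsManifold.maximalAtlas 𝓘(ℝ, F) ∞ N)
    (hψ : ψ ∈ IsManifold.maximalAtlas 𝓘(ℝ, F) ∞ N) {x : F} (hx : x ∈ φ.target)
    (hx' : φ.symm x ∈ ψ.source) : ContDiffAt ℝ ∞ (fun y => ψ (φ.symm y)) x :=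
  contDiffAt_chart_comp le_rfl hψ (contMDiffAt_symm_of_mem_maximalAtlas hφ hx) hx'

theorem chartDSymm_eq_comp (hφ : φ ∈ IsManifold.maximalAtlas 𝓘(ℝ, F) ∞ N)
    (hψ : ψ ∈ IsManifold.maximalAtlas 𝓘(ℝ, F) ∞ N) {x : F} (hx : x ∈ φ.target)
    (hx' : φ.symm x ∈ ψ.source) :
    chartDSymm φ x =
      chartDSymm ψ (ψ (φ.symm x)) ∘L fderiv ℝ (fun y => ψ (φ.symm y)) x := by
  have h : HasFDerivAt (fun y => ψ (φ.symm y)) (chartD ψ (φ.symm x) ∘L chartDSymm φ x) x :=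
    hasFDerivAt_chart_comp hψ
      ((mdifferentiable_of_mem_maximalAtlas hφ).mdifferentiableAt_symm hx) hx'
  rw [h.fderiv, ← ContinuousLinearMap.comp_assoc, chartDSymm_comp_chartD hψ hx',
    ContinuousLinearMap.id_comp]

/-- The tangent map of `φ` is smooth over `φ.source` and lands in the trivial bundle over the model
space, whose fibre projection is smooth. -/
theorem contDiffAt_tangent_coord {k : WithTop ℕ∞} (hk : k ≤ ∞)
    (hφ : φ ∈ IsManifold.maximalAtlas 𝓘(ℝ, F) ∞ N) {n : P → N} {v : P → F} {q : P}
    (h : ContMDiffAt 𝓘(ℝ, P) 𝓘(ℝ, F).tangent k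
      (fun p => (⟨n p, v p⟩ : TangentBundle 𝓘(ℝ, F) N)) q) (hq : n q ∈ φ.source) :
    ContDiffAt ℝ k (fun p => φ (n p)) q ∧ ContDiffAt ℝ k (fun p => chartD φ (n p) (v p)) q := by
  have hn : ContMDiffAt 𝓘(ℝ, P) 𝓘(ℝ, F) k n q := (Bundle.contMDiffAt_totalSpace.1 h).1
  refine ⟨contDiffAt_chart_comp hk hφ hn hq, ?_⟩
  have h1 := (contMDiffOn_of_mem_maximalAtlas hφ).contMDiffOn_tangentMapWithin (m := ∞)
    (by simp) φ.open_source.uniqueMDiffOn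
  have hopen : Bundle.TotalSpace.proj ⁻¹' φ.source ∈
      𝓝 (⟨n q, v q⟩ : TangentBundle 𝓘(ℝ, F) N) :=
    (φ.open_source.preimage (FiberBundle.continuous_proj F _)).mem_nhds hq
  have h2 := ((h1.contMDiffAt hopen).of_le hk).comp q h
  have h3 := (((contMDiff_snd_tangentBundle_modelSpace F 𝓘(ℝ, F)) _).comp q h2).contDiffAt
  refine h3.congr_of_eventuallyEq ?_
  filter_upwards [hn.continuousAt.preimage_mem_nhds (φ.open_source.mem_nhds hq)] with p hp
  have := tangentMapWithin_eq_tangentMap (I := 𝓘(ℝ, F)) (I' := 𝓘(ℝ, F)) (f := φ) (s := φ.source)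
    (p := (⟨n p, v p⟩ : TangentBundle 𝓘(ℝ, F) N)) (φ.open_source.uniqueMDiffOn _ hp)
    ((mdifferentiable_of_mem_maximalAtlas hφ).mdifferentiableAt hp)
  exact (congrArg (fun z : TangentBundle 𝓘(ℝ, F) F => (z.2 : F)) this).symm

theorem contMDiffAt_tangent_of_coord {H : Type*} [TopologicalSpace H]
    {Q : Type*} [NormedAddCommGroup Q] [NormedSpace ℝ Q] {I : ModelWithCorners ℝ Q H}
    {X : Type*} [TopologicalSpace X] [ChartedSpace H X]
    (hφ : φ ∈ IsManifold.maximalAtlas 𝓘(ℝ, F) ∞ N) {x v : X → F} {q : X}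
    (hx : ContMDiffAt I 𝓘(ℝ, F) ∞ x q) (hv : ContMDiffAt I 𝓘(ℝ, F) ∞ v q) (hq : x q ∈ φ.target) :
    ContMDiffAt I 𝓘(ℝ, F).tangent ∞
      (fun p => (⟨φ.symm (x p), chartDSymm φ (x p) (v p)⟩ : TangentBundle 𝓘(ℝ, F) N)) q := by
  have h1 := (contMDiffOn_symm_of_mem_maximalAtlas hφ).contMDiffOn_tangentMapWithin (m := ∞)
    (by simp) φ.open_target.uniqueMDiffOn
  have hopen : Bundle.TotalSpace.proj ⁻¹' φ.target ∈
      𝓝 (⟨x q, v q⟩ : TangentBundle 𝓘(ℝ, F) F) :=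
    (φ.open_target.preimage (FiberBundle.continuous_proj F _)).mem_nhds hq
  have h0 : ContMDiffAt I 𝓘(ℝ, F).tangent ∞
      (fun p => (⟨x p, v p⟩ : TangentBundle 𝓘(ℝ, F) F)) q := by
    rw [Bundle.contMDiffAt_totalSpace]
    refine ⟨hx, hv.congr_of_eventuallyEq (Filter.Eventually.of_forall fun p => ?_)⟩
    simp
  refine ((h1.contMDiffAt hopen).comp q h0).congr_of_eventuallyEq ?_
  filter_upwards [hx.continuousAt.preimage_mem_nhds (φ.open_target.mem_nhds hq)] with p hp
  have := tangentMapWithin_eq_tangentMap (I := 𝓘(ℝ, F)) (I' := 𝓘(ℝ, F)) (f := φ.symm)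
    (s := φ.target)
    (p := (⟨x p, v p⟩ : TangentBundle 𝓘(ℝ, F) F)) (φ.open_target.uniqueMDiffOn _ hp)
    ((mdifferentiable_of_mem_maximalAtlas hφ).mdifferentiableAt_symm hp)
  exact this.symm

/-- Smoothness of a covector field along a map, in terms of a chart. -/
theorem contMDiffAt_cotangent_iff_chartAt {n : P → N} {σ : P → F →L[ℝ] ℝ} {q : P} :
    ContMDiffAt 𝓘(ℝ, P) (𝓘(ℝ, F).prod 𝓘(ℝ, F →L[ℝ] ℝ)) ∞
      (fun p => Bundle.TotalSpace.mk' (F →L[ℝ] ℝ)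
        (E := fun x : N => TangentSpace 𝓘(ℝ, F) x →L[ℝ] ℝ) (n p) (σ p)) q ↔
    ContMDiffAt 𝓘(ℝ, P) 𝓘(ℝ, F) ∞ n q ∧
      ContDiffAt ℝ ∞ (fun p => σ p ∘L chartDSymm (chartAt F (n q)) (chartAt F (n q) (n p))) q := by
  -- The hom-bundle coordinates precompose `σ` with the inverse of the tangent trivialisation at `n
  -- q`, which is the derivative of the inverse chart, and postcompose with the identity of the
  -- trivial line bundle.
  rw [contMDiffAt_hom_bundle, ← contMDiffAt_iff_contDiffAt]
  refine and_congr_right fun hn => ?_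
  have hn : ContMDiffAt 𝓘(ℝ, P) 𝓘(ℝ, F) ∞ n q := hn
  refine Filter.EventuallyEq.contMDiffAt_iff ?_
  filter_upwards [hn.continuousAt.preimage_mem_nhds
    ((chartAt F (n q)).open_source.mem_nhds (mem_chart_source F (n q)))] with p hp
  have hp : n p ∈ (chartAt F (n q)).source := hp
  have := TangentBundle.symmL_trivializationAt (I := 𝓘(ℝ, F)) hp
  have h0 : (trivializationAt ℝ (fun _ : N => ℝ) (n q)).continuousLinearMapAt ℝ (n p) =
      ContinuousLinearMap.id ℝ ℝ := by
    simp
  refine ContinuousLinearMap.ext fun w => ?_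
  simp only [ContinuousLinearMap.inCoordinates]
  erw [this, h0]
  have h1 : (mfderiv[range 𝓘(ℝ, F)] (extChartAt 𝓘(ℝ, F) (n q)).symm
      (extChartAt 𝓘(ℝ, F) (n q) (n p)) : F →L[ℝ] F) =
      chartDSymm (chartAt F (n q)) (chartAt F (n q) (n p)) := by
    rw [modelWithCornersSelf_coe, range_id, mfderivWithin_univ]
    rfl
  exact congrArg (fun T : F →L[ℝ] F => σ p (T w)) h1

/-- Covector coordinates in two charts differ by composition with the derivative of the transition
map, which is smooth; this carries smoothness from the preferred chart to any other. -/
theorem contDiffAt_cotangent_coord (hφ : φ ∈ IsManifold.maximalAtlas 𝓘(ℝ, F) ∞ N) {n : P → N}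
    {σ : P → F →L[ℝ] ℝ} {q : P}
    (h : ContMDiffAt 𝓘(ℝ, P) (𝓘(ℝ, F).prod 𝓘(ℝ, F →L[ℝ] ℝ)) ∞
      (fun p => Bundle.TotalSpace.mk' (F →L[ℝ] ℝ)
        (E := fun x : N => TangentSpace 𝓘(ℝ, F) x →L[ℝ] ℝ) (n p) (σ p)) q)
    (hq : n q ∈ φ.source) :
    ContDiffAt ℝ ∞ (fun p => σ p ∘L chartDSymm φ (φ (n p))) q := by
  obtain ⟨hn, hσ⟩ := contMDiffAt_cotangent_iff_chartAt.1 h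
  have hψ := IsManifold.chart_mem_maximalAtlas (I := 𝓘(ℝ, F)) (n := ∞) (n q)
  have hx := contDiffAt_chart_comp le_rfl hφ hn hq
  have htr := (contDiffAt_transition hφ hψ (φ.map_source hq)
    (by rw [φ.left_inv hq]; exact mem_chart_source F (n q))).fderiv_right (m := ∞) (by simp)
  refine (hσ.clm_comp (htr.comp q hx)).congr_of_eventuallyEq ?_
  filter_upwards [hn.continuousAt.preimage_mem_nhds
    ((chartAt F (n q)).open_source.mem_nhds (mem_chart_source F (n q))),
    hn.continuousAt.preimage_mem_nhds (φ.open_source.mem_nhds hq)] with p hp hp'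
  have hp' : n p ∈ φ.source := hp'
  rw [chartDSymm_eq_comp hφ hψ (φ.map_source hp') (by rwa [φ.left_inv hp']), φ.left_inv hp',
    ContinuousLinearMap.comp_assoc]
  rfl

theorem comp_chartD_comp_chartDSymm (hφ : φ ∈ IsManifold.maximalAtlas 𝓘(ℝ, F) ∞ N)
    (hψ : ψ ∈ IsManifold.maximalAtlas 𝓘(ℝ, F) ∞ N) {y : N} (hy : y ∈ φ.source)
    (hy' : y ∈ ψ.source) (p : F →L[ℝ] ℝ) :
    (p ∘L chartD φ y) ∘L chartDSymm ψ (ψ y) =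
      p ∘L fderiv ℝ (fun z => φ (ψ.symm z)) (ψ y) := by
  rw [chartDSymm_eq_comp hψ hφ (ψ.map_source hy') (by rwa [ψ.left_inv hy']), ψ.left_inv hy',
    ContinuousLinearMap.comp_assoc]
  refine ContinuousLinearMap.ext fun w => congrArg p ?_
  exact chartD_chartDSymm' hφ hy _

theorem contMDiffAt_cotangent_of_coord (hφ : φ ∈ IsManifold.maximalAtlas 𝓘(ℝ, F) ∞ N)
    {x : P → F} {p : P → F →L[ℝ] ℝ} {q : P} (hx : ContDiffAt ℝ ∞ x q) (hp : ContDiffAt ℝ ∞ p q)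
    (hq : x q ∈ φ.target) :
    ContMDiffAt 𝓘(ℝ, P) (𝓘(ℝ, F).prod 𝓘(ℝ, F →L[ℝ] ℝ)) ∞
      (fun r => Bundle.TotalSpace.mk' (F →L[ℝ] ℝ)
        (E := fun x : N => TangentSpace 𝓘(ℝ, F) x →L[ℝ] ℝ) (φ.symm (x r))
          (p r ∘L chartD φ (φ.symm (x r)) : F →L[ℝ] ℝ)) q := by
  have hn := contMDiffAt_chart_symm_comp hφ hx hq
  refine contMDiffAt_cotangent_iff_chartAt.2 ⟨hn, ?_⟩
  set ψ := chartAt F (φ.symm (x q)) with hψdef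
  have hψ := IsManifold.chart_mem_maximalAtlas (I := 𝓘(ℝ, F)) (n := ∞) (φ.symm (x q))
  have hqψ : φ.symm (x q) ∈ ψ.source := mem_chart_source F _
  have hy := contDiffAt_chart_comp le_rfl hψ hn hqψ
  have htr := (contDiffAt_transition hψ hφ (ψ.map_source hqψ)
    (by rw [ψ.left_inv hqψ]; exact φ.map_target hq)).fderiv_right (m := ∞) (by simp)
  refine (hp.clm_comp (htr.comp q hy)).congr_of_eventuallyEq ?_
  filter_upwards [hn.continuousAt.preimage_mem_nhds (ψ.open_source.mem_nhds hqψ),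
    hx.continuousAt.preimage_mem_nhds (φ.open_target.mem_nhds hq)] with r hr hr'
  have hr : φ.symm (x r) ∈ ψ.source := hr
  have hr' : x r ∈ φ.target := hr'
  exact comp_chartD_comp_chartDSymm hφ hψ (φ.map_target hr') hr (p r)

end Charts

/-! ### The infinitesimal action and the Lagrangian in coordinates. -/

section Local

variable {E : Type*} [NormedAddCommGroup E] [NormedSpace ℝ E]
  {F : Type*} [NormedAddCommGroup F] [NormedSpace ℝ F]
  {G : Type*} [TopologicalSpace G] [ChartedSpace E G] [Group G]
  {N : Type*} [TopologicalSpace N] [ChartedSpace F N] [IsManifold 𝓘(ℝ, F) ∞ N]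
  {φ : OpenPartialHomeomorph N F}

theorem eq_fderiv_of_hasFDerivWithinAt_range {f : E → F} {f' : E →L[ℝ] F} {x : E}
    (h : HasFDerivWithinAt f f' (range 𝓘(ℝ, E)) x) : f' = fderiv ℝ f x := by
  rw [modelWithCornersSelf_coe, range_id, hasFDerivWithinAt_univ] at h
  exact h.fderiv.symm

theorem mfderiv_eq_fderiv_chart {M : Type*} [TopologicalSpace M] [ChartedSpace E M]
    {f : M → F} {m : M} (hf : MDifferentiableAt 𝓘(ℝ, E) 𝓘(ℝ, F) f m) :
    (mfderiv 𝓘(ℝ, E) 𝓘(ℝ, F) f m : E →L[ℝ] F) =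
      fderiv ℝ (fun y => f ((chartAt E m).symm y)) (chartAt E m m) :=
  eq_fderiv_of_hasFDerivWithinAt_range (E := E) (F := F)
    (f := fun y => f ((chartAt E m).symm y)) (x := chartAt E m m) hf.hasMFDerivAt.2

section Action

variable [MulAction G N]

/-- The coordinate expression of the infinitesimal action, as an operator on the Lie algebra. -/
def localAct (G : Type*) [TopologicalSpace G] [ChartedSpace E G] [Group G] [MulAction G N]
    (φ : OpenPartialHomeomorph N F) (x : F) : E →L[ℝ] F :=
  chartD φ (φ.symm x) ∘L infAct G (φ.symm x)

variable [LieGroup 𝓘(ℝ, E) ∞ G] [ContMDiffSMul 𝓘(ℝ, E) 𝓘(ℝ, F) ∞ G N]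

/-- With `κ` the chart of `G` at the identity, `localAct` is the partial derivative in `z` at `κ 1`
of the jointly smooth map `(y, z) ↦ φ (κ⁻¹ z • φ⁻¹ y)`. It is therefore smooth in `y` as a map into
the space of operators. -/
theorem contDiffAt_localAct (hφ : φ ∈ IsManifold.maximalAtlas 𝓘(ℝ, F) ∞ N) {x : F}
    (hx : x ∈ φ.target) : ContDiffAt ℝ ∞ (localAct (E := E) G φ) x := by
  set κ := chartAt E (1 : G) with hκdef
  have hκ := IsManifold.chart_mem_maximalAtlas (I := 𝓘(ℝ, E)) (n := ∞) (1 : G)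
  have h1 : (1 : G) ∈ κ.source := mem_chart_source E 1
  have hsmul : ContMDiff (𝓘(ℝ, E).prod 𝓘(ℝ, F)) 𝓘(ℝ, F) ∞ (fun p : G × N => p.1 • p.2) :=
    contMDiff_smul
  have hmem : ∀ y ∈ φ.target, (1 : G) • φ.symm y ∈ φ.source := fun y hy => by
    rw [one_smul]; exact φ.map_target hy
  have hjoint : ContDiffAt ℝ ∞ (fun p : F × E => φ (κ.symm p.2 • φ.symm p.1)) (x, κ 1) := by
    refine contDiffAt_chart_comp le_rfl hφ (hsmul.contMDiffAt.comp (x, κ 1)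
      ((contMDiffAt_chart_symm_comp hκ (x := Prod.snd) contDiffAt_snd (κ.map_source h1)).prodMk
        (contMDiffAt_chart_symm_comp hφ (x := Prod.fst) contDiffAt_fst hx))) ?_
    simpa [κ.left_inv h1] using φ.map_target hx
  have hpart : ContDiffAt ℝ ∞ (fun y : F => fderiv ℝ
      (fun z : E => φ (κ.symm z • φ.symm y)) (κ 1)) x :=
    ContDiffAt.fderiv (n := ∞) (f := fun y z => φ (κ.symm z • φ.symm y)) (g := fun _ => κ 1)
      hjoint contDiffAt_const (by simp)
  refine hpart.congr_of_eventuallyEq ?_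
  filter_upwards [φ.open_target.mem_nhds hx] with y hy
  have hd : MDifferentiableAt 𝓘(ℝ, E) 𝓘(ℝ, F) (fun h : G => h • φ.symm y) 1 :=
    (hsmul.comp (contMDiff_id.prodMk contMDiff_const)).mdifferentiableAt (by simp)
  have hφd : MDifferentiableAt 𝓘(ℝ, F) 𝓘(ℝ, F) φ ((1 : G) • φ.symm y) :=
    (mdifferentiable_of_mem_maximalAtlas hφ).mdifferentiableAt (hmem y hy)
  have := mfderiv_comp (1 : G) hφd hd
  rw [one_smul] at this
  exact this.symm.trans (mfderiv_eq_fderiv_chart (hφd.comp (1 : G) hd))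

end Action

section Lagrangian

variable (ℓ : E → TangentBundle 𝓘(ℝ, F) N → ℝ)

theorem localLagrangian_apply (u : E) (x v : F) :
    localLagrangian ℓ φ u x v = ℓ u ⟨φ.symm x, chartDSymm φ x v⟩ := rfl

theorem localLagrangian_chart (hφ : φ ∈ IsManifold.maximalAtlas 𝓘(ℝ, F) ∞ N) (u : E) {n : N}
    (hn : n ∈ φ.source) (ν : F) :
    localLagrangian ℓ φ u (φ n) (chartD φ n ν) = ℓ u ⟨n, ν⟩ := by
  rw [localLagrangian_apply]
  exact congrArg (ℓ u) (tangent_mk_congr (φ.left_inv hn) (chartDSymm_chartD hφ hn ν))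

variable {ℓ}
variable (hℓ : ContMDiff (𝓘(ℝ, E).prod 𝓘(ℝ, F).tangent) 𝓘(ℝ, ℝ) ∞
      (fun p : E × TangentBundle 𝓘(ℝ, F) N => ℓ p.1 p.2))
include hℓ

theorem contDiffAt_localLagrangian (hφ : φ ∈ IsManifold.maximalAtlas 𝓘(ℝ, F) ∞ N) {q : E × F × F}
    (hq : q.2.1 ∈ φ.target) :
    ContDiffAt ℝ ∞ (fun q : E × F × F => localLagrangian ℓ φ q.1 q.2.1 q.2.2) q := by
  have h1 : ContMDiffAt 𝓘(ℝ, E × F × F) 𝓘(ℝ, F).tangent ∞ (fun p : E × F × F =>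
      (⟨φ.symm p.2.1, chartDSymm φ p.2.1 p.2.2⟩ : TangentBundle 𝓘(ℝ, F) N)) q :=
    contMDiffAt_tangent_of_coord hφ contDiffAt_snd.fst.contMDiffAt contDiffAt_snd.snd.contMDiffAt hq
  have h2 : ContMDiffAt 𝓘(ℝ, E × F × F) 𝓘(ℝ, E) ∞ (fun p : E × F × F => p.1) q :=
    contDiffAt_fst.contMDiffAt
  exact ((hℓ.contMDiffAt).comp q (h2.prodMk h1)).contDiffAt

theorem dU_eq_local (hφ : φ ∈ IsManifold.maximalAtlas 𝓘(ℝ, F) ∞ N) (u : E) {n : N}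
    (hn : n ∈ φ.source) (ν : F) :
    dU ℓ u n ν = fderiv ℝ (fun w => localLagrangian ℓ φ w (φ n) (chartD φ n ν)) u :=
  congrArg (fun f => fderiv ℝ f u) (funext fun w => (localLagrangian_chart ℓ hφ w hn ν).symm)

theorem dNu_eq_local (hφ : φ ∈ IsManifold.maximalAtlas 𝓘(ℝ, F) ∞ N) (u : E) {n : N}
    (hn : n ∈ φ.source) (ν : F) :
    (dNu ℓ u n ν : F →L[ℝ] ℝ) =
      fderiv ℝ (fun v => localLagrangian ℓ φ u (φ n) v) (chartD φ n ν) ∘L chartD φ n := by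
  have h1 : DifferentiableAt ℝ (fun v => localLagrangian ℓ φ u (φ n) v) (chartD φ n ν) :=
    ((contDiffAt_localLagrangian hℓ hφ (q := (u, φ n, chartD φ n ν)) (φ.map_source hn)).comp
      (chartD φ n ν) (f := fun v : F => (u, φ n, v)) (by fun_prop)).differentiableAt (by simp)
  have h2 : (fun w : F => ℓ u ⟨n, w⟩) =
      (fun v => localLagrangian ℓ φ u (φ n) v) ∘ (chartD φ n) := by
    funext w
    exact (localLagrangian_chart ℓ hφ u hn w).symm
  have h3 := h1.hasFDerivAt.comp ν (chartD φ n).hasFDerivAt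
  rw [← h2] at h3
  exact h3.fderiv

end Lagrangian

end Local

/-! ### The multiplication and the Lie bracket in the chart at the identity. -/

section Group

variable {E : Type*} [NormedAddCommGroup E] [NormedSpace ℝ E]
  {G : Type*} [TopologicalSpace G] [ChartedSpace E G] [Group G]
  {P : Type*} [NormedAddCommGroup P] [NormedSpace ℝ P]

/-- The group multiplication in the preferred chart at the identity. -/
def localMul (G : Type*) [TopologicalSpace G] [ChartedSpace E G] [Group G] (x y : E) : E :=
  chartAt E (1 : G) ((chartAt E (1 : G)).symm x * (chartAt E (1 : G)).symm y)

/-- The coordinates of the identity in the preferred chart at the identity. -/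
def localOne (E G : Type*) [NormedAddCommGroup E] [TopologicalSpace G]
    [ChartedSpace E G] [Group G] : E :=
  chartAt E (1 : G) 1

/-- The map `(x, y) ↦ x y⁻¹` in the preferred chart at the identity. -/
def localDiv (G : Type*) [TopologicalSpace G] [ChartedSpace E G] [Group G] (x y : E) : E :=
  chartAt E (1 : G) ((chartAt E (1 : G)).symm x * ((chartAt E (1 : G)).symm y)⁻¹)

/-- The right logarithmic derivative of a map into a Lie group. -/
def rightLogDeriv (g : P → G) (q : P) : P →L[ℝ] E :=
  fderiv ℝ (fun p => chartAt E (1 : G) (g p * (g q)⁻¹)) q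

theorem localOne_mem : localOne E G ∈ (chartAt E (1 : G)).target :=
  mem_chart_target E 1

theorem symm_localOne : (chartAt E (1 : G)).symm (localOne E G) = 1 :=
  (chartAt E (1 : G)).left_inv (mem_chart_source E 1)

theorem eq_fderiv_of_hasFDerivWithinAt_range' {f : P → E} {f' : P →L[ℝ] E} {x : P}
    (h : HasFDerivWithinAt f f' (range 𝓘(ℝ, P)) x) : f' = fderiv ℝ f x := by
  rw [modelWithCornersSelf_coe, range_id, hasFDerivWithinAt_univ] at h
  exact h.fderiv.symm

theorem mfderiv_eq_fderiv_chartAt_comp {M : Type*} [TopologicalSpace M] [ChartedSpace E M]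
    {f : P → M} {q : P} (hf : MDifferentiableAt 𝓘(ℝ, P) 𝓘(ℝ, E) f q) :
    (mfderiv 𝓘(ℝ, P) 𝓘(ℝ, E) f q : P →L[ℝ] E) = fderiv ℝ (fun p => chartAt E (f q) (f p)) q :=
  eq_fderiv_of_hasFDerivWithinAt_range' (E := E) (P := P)
    (f := fun p => chartAt E (f q) (f p)) (x := q) hf.hasMFDerivAt.2

variable [LieGroup 𝓘(ℝ, E) ∞ G]

theorem mem_maximalAtlas_one :
    chartAt E (1 : G) ∈ IsManifold.maximalAtlas 𝓘(ℝ, E) ∞ G :=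
  IsManifold.chart_mem_maximalAtlas 1

theorem rightVelocity_eq_deriv {g : ℝ → G} {t : ℝ}
    (hg : MDifferentiableAt 𝓘(ℝ, ℝ) 𝓘(ℝ, E) g t) :
    rightVelocity g t = deriv (fun s => chartAt E (1 : G) (g s * (g t)⁻¹)) t := by
  have hm : MDifferentiableAt 𝓘(ℝ, E) 𝓘(ℝ, E) (fun h : G => h * (g t)⁻¹) (g t) :=
    (contMDiff_mul_right (I := 𝓘(ℝ, E)) (n := ∞) (a := (g t)⁻¹)).mdifferentiableAt (by simp)
  have h1 := mfderiv_comp t hm hg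
  have h2 := mfderiv_eq_fderiv_chartAt_comp (E := E) (hm.comp t hg)
  simp only [Function.comp_apply, mul_inv_cancel] at h2
  have h3 := DFunLike.congr_fun (h1.symm.trans h2) (1 : ℝ)
  exact h3

theorem rightVelocity_comp {g : P → G} (hg : ContMDiff 𝓘(ℝ, P) 𝓘(ℝ, E) ∞ g) {c : ℝ → P} {t : ℝ}
    {c' : P} (hc : HasDerivAt c c' t) :
    rightVelocity (E := E) (fun s => g (c s)) t = rightLogDeriv g (c t) c' := by
  have hgt : MDifferentiableAt 𝓘(ℝ, P) 𝓘(ℝ, E) g (c t) := hg.mdifferentiableAt (by simp)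
  have hgc : MDifferentiableAt 𝓘(ℝ, ℝ) 𝓘(ℝ, E) (fun s => g (c s)) t :=
    hgt.comp t hc.differentiableAt.mdifferentiableAt
  rw [rightVelocity_eq_deriv hgc]
  have hsm : ContMDiff 𝓘(ℝ, P) 𝓘(ℝ, E) ∞ (fun p => g p * (g (c t))⁻¹) :=
    hg.mul contMDiff_const
  have hd : DifferentiableAt ℝ (fun p => chartAt E (1 : G) (g p * (g (c t))⁻¹)) (c t) :=
    (contDiffAt_chart_comp le_rfl mem_maximalAtlas_one hsm.contMDiffAt
      (by simp)).differentiableAt (by simp)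
  exact (hd.hasFDerivAt.comp_hasDerivAt t hc).deriv

theorem contDiffAt_localMul {x y : E} (hx : x ∈ (chartAt E (1 : G)).target)
    (hy : y ∈ (chartAt E (1 : G)).target)
    (hxy : (chartAt E (1 : G)).symm x * (chartAt E (1 : G)).symm y ∈ (chartAt E (1 : G)).source) :
    ContDiffAt ℝ ∞ (fun p : E × E => localMul G p.1 p.2) (x, y) :=
  contDiffAt_chart_comp le_rfl mem_maximalAtlas_one
    ((contMDiffAt_chart_symm_comp mem_maximalAtlas_one (x := Prod.fst) contDiffAt_fst hx).mul
      (contMDiffAt_chart_symm_comp mem_maximalAtlas_one (x := Prod.snd) contDiffAt_snd hy)) hxy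

theorem contDiffAt_localDiv {x y : E} (hx : x ∈ (chartAt E (1 : G)).target)
    (hy : y ∈ (chartAt E (1 : G)).target)
    (hxy : (chartAt E (1 : G)).symm x * ((chartAt E (1 : G)).symm y)⁻¹ ∈
      (chartAt E (1 : G)).source) :
    ContDiffAt ℝ ∞ (fun p : E × E => localDiv G p.1 p.2) (x, y) :=
  contDiffAt_chart_comp le_rfl mem_maximalAtlas_one
    ((contMDiffAt_chart_symm_comp mem_maximalAtlas_one (x := Prod.fst) contDiffAt_fst hx).mul
      (contMDiffAt_chart_symm_comp mem_maximalAtlas_one (x := Prod.snd) contDiffAt_snd hy).inv) hxy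

theorem chart_inverse_eq {x : E} (hx : x ∈ (chartAt E (1 : G)).target) :
    ContinuousLinearMap.inverse (chartDSymm (chartAt E (1 : G)) x) =
      chartD (chartAt E (1 : G)) ((chartAt E (1 : G)).symm x) := by
  refine ContinuousLinearMap.inverse_eq ?_ (chartD_comp_chartDSymm mem_maximalAtlas_one hx)
  have := chartDSymm_comp_chartD (mem_maximalAtlas_one (G := G) (E := E))
    ((chartAt E (1 : G)).map_target hx)
  rwa [(chartAt E (1 : G)).right_inv hx] at this

/-- A left invariant field is the derivative of `h ↦ g h` at the identity, so in coordinates it is a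
partial derivative of `localMul` in the second variable. -/
theorem mpullback_mulInvariant_eq (a : E) {x : E} (hx : x ∈ (chartAt E (1 : G)).target) :
    (VectorField.mpullbackWithin 𝓘(ℝ, E) 𝓘(ℝ, E) (extChartAt 𝓘(ℝ, E) (1 : G)).symm
      (mulInvariantVectorField (I := 𝓘(ℝ, E)) (G := G) a) (range 𝓘(ℝ, E)) x : E) =
      fderiv ℝ (fun y => localMul G x y) (localOne E G) a := by
  have h1 : (mfderivWithin 𝓘(ℝ, E) 𝓘(ℝ, E) (extChartAt 𝓘(ℝ, E) (1 : G)).symm (range 𝓘(ℝ, E)) x :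
      E →L[ℝ] E) = chartDSymm (chartAt E (1 : G)) x := by
    rw [modelWithCornersSelf_coe, range_id, mfderivWithin_univ]
    rfl
  have h2 := chart_inverse_eq hx
  rw [← h1] at h2
  have hd : MDifferentiableAt 𝓘(ℝ, E) 𝓘(ℝ, E)
      (fun h : G => (chartAt E (1 : G)).symm x * h) 1 :=
    (contMDiff_mul_left (I := 𝓘(ℝ, E)) (n := ∞)).mdifferentiableAt (by simp)
  have hφd : MDifferentiableAt 𝓘(ℝ, E) 𝓘(ℝ, E) (chartAt E (1 : G))
      ((chartAt E (1 : G)).symm x * 1) := by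
    rw [mul_one]
    exact (mdifferentiable_of_mem_maximalAtlas mem_maximalAtlas_one).mdifferentiableAt
      ((chartAt E (1 : G)).map_target hx)
  have h3 := mfderiv_comp (1 : G) hφd hd
  rw [mul_one] at h3
  have h4 := h3.symm.trans (mfderiv_eq_fderiv_chart (hφd.comp (1 : G) hd))
  exact (DFunLike.congr_fun h2 _).trans (DFunLike.congr_fun h4 a)

/-- Used with `T` the derivative at the identity of the chart there, which is the identity operator.
This reduces the manifold bracket to a bracket of vector fields on `E`. -/
theorem inverse_lieBracketWithin_congr {T : E →L[ℝ] E} (hT : T = ContinuousLinearMap.id ℝ E)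
    {V W V' W' : E → E} {s : Set E} (hs : s = univ) {x : E} (hV : V =ᶠ[𝓝 x] V')
    (hW : W =ᶠ[𝓝 x] W') :
    T.inverse (VectorField.lieBracketWithin ℝ V W s x) =
      fderiv ℝ W' x (V' x) - fderiv ℝ V' x (W' x) := by
  rw [hT, hs, ContinuousLinearMap.inverse_id, VectorField.lieBracketWithin_univ,
    VectorField.lieBracket, hV.fderiv_eq, hW.fderiv_eq, hV.eq_of_nhds, hW.eq_of_nhds]
  rfl

/-- The bracket of the Lie algebra in the preferred chart at the identity. -/
theorem ad_eq_fderiv_localMul (a b : E) :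
    (ad G a b : E) =
      fderiv ℝ (fun x => fderiv ℝ (fun y => localMul G x y) (localOne E G) b) (localOne E G) a -
      fderiv ℝ (fun x => fderiv ℝ (fun y => localMul G x y) (localOne E G) a)
        (localOne E G) b := by
  have hev : ∀ c : E, (fun x => (VectorField.mpullbackWithin 𝓘(ℝ, E) 𝓘(ℝ, E)
      (extChartAt 𝓘(ℝ, E) (1 : G)).symm
      (mulInvariantVectorField (I := 𝓘(ℝ, E)) (G := G) c) (range 𝓘(ℝ, E)) x : E)) =ᶠ[𝓝
      (localOne E G)] (fun x => fderiv ℝ (fun y => localMul G x y) (localOne E G) c) := by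
    intro c
    filter_upwards [(chartAt E (1 : G)).open_target.mem_nhds localOne_mem] with x hx
    exact mpullback_mulInvariant_eq c hx
  have hone : ∀ c : E, fderiv ℝ (fun y => localMul G (localOne E G) y) (localOne E G) c = c := by
    intro c
    have : (fun y => localMul G (localOne E G) y) =ᶠ[𝓝 (localOne E G)] id := by
      filter_upwards [(chartAt E (1 : G)).open_target.mem_nhds localOne_mem] with x hx
      rw [localMul, symm_localOne, one_mul, (chartAt E (1 : G)).right_inv hx, id]
    rw [this.fderiv_eq, fderiv_id]
    rfl
  have h0 := VectorField.mlieBracketWithin_apply (I := 𝓘(ℝ, E)) (s := univ) (x₀ := (1 : G))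
    (V := mulInvariantVectorField (I := 𝓘(ℝ, E)) (G := G) a)
    (W := mulInvariantVectorField (I := 𝓘(ℝ, E)) (G := G) b)
  refine h0.trans ((inverse_lieBracketWithin_congr (E := E)
    (T := mfderiv 𝓘(ℝ, E) 𝓘(ℝ, E) (extChartAt 𝓘(ℝ, E) (1 : G)) 1) mfderiv_extChartAt_self
    (by simp) (hev a) (hev b)).trans ?_)
  rw [hone, hone]

end Group

theorem minSmoothness_two_le : minSmoothness ℝ 2 ≤ (∞ : WithTop ℕ∞) := by
  rw [minSmoothness_of_isRCLikeNormedField]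
  exact WithTop.coe_le_coe.2 (le_top (a := (2 : ℕ∞)))

/-! ### The right Maurer–Cartan form and its structure equation. -/

section MaurerCartan

variable {E : Type*} [NormedAddCommGroup E] [NormedSpace ℝ E]
  {G : Type*} [TopologicalSpace G] [ChartedSpace E G] [Group G]
  {P : Type*} [NormedAddCommGroup P] [NormedSpace ℝ P]

theorem fderiv_partial_fst {X Y Z : Type*} [NormedAddCommGroup X] [NormedSpace ℝ X]
    [NormedAddCommGroup Y] [NormedSpace ℝ Y] [NormedAddCommGroup Z] [NormedSpace ℝ Z]
    {f : X × Y → Z} {x : X} {y : Y} (hf : DifferentiableAt ℝ f (x, y)) :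
    fderiv ℝ (fun x' => f (x', y)) x =
      fderiv ℝ f (x, y) ∘L ContinuousLinearMap.inl ℝ X Y :=
  (hf.hasFDerivAt.comp x (hasFDerivAt_prodMk_left x y)).fderiv

theorem fderiv_partial_snd {X Y Z : Type*} [NormedAddCommGroup X] [NormedSpace ℝ X]
    [NormedAddCommGroup Y] [NormedSpace ℝ Y] [NormedAddCommGroup Z] [NormedSpace ℝ Z]
    {f : X × Y → Z} {x : X} {y : Y} (hf : DifferentiableAt ℝ f (x, y)) :
    fderiv ℝ (fun y' => f (x, y')) y =
      fderiv ℝ f (x, y) ∘L ContinuousLinearMap.inr ℝ X Y :=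
  (hf.hasFDerivAt.comp y (hasFDerivAt_prodMk_right x y)).fderiv

/-- The antisymmetric part of the derivative of an operator field inverse to the right
translations, in terms of the mixed second derivatives of the multiplication. -/
theorem fderiv_antisymm_of_comp_eq_id {f : E × E → E} {e : E} (hf : ContDiffAt ℝ ∞ f (e, e))
    (hfe : ∀ᶠ x in 𝓝 e, f (x, e) = x) {W : E → E →L[ℝ] E} (hW : DifferentiableAt ℝ W e)
    (hWf : ∀ᶠ z in 𝓝 e, W z ∘L fderiv ℝ (fun x => f (x, z)) e = ContinuousLinearMap.id ℝ E) :
    W e = ContinuousLinearMap.id ℝ E ∧ ∀ a b, fderiv ℝ W e a b - fderiv ℝ W e b a =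
      fderiv ℝ (fun x => fderiv ℝ (fun y => f (x, y)) e b) e a -
      fderiv ℝ (fun x => fderiv ℝ (fun y => f (x, y)) e a) e b := by
  have hdiff : ∀ᶠ p in 𝓝 (e, e), DifferentiableAt ℝ f p := by
    filter_upwards [(hf.of_le (m := 1) (by simp)).eventually (by simp)] with p hp
    exact hp.differentiableAt (by simp)
  have hd1 : ∀ᶠ z in 𝓝 e, DifferentiableAt ℝ f (e, z) :=
    (Continuous.tendsto' (f := fun z : E => (e, z)) (by fun_prop) e (e, e) rfl).eventually hdiff
  have hd2 : ∀ᶠ x in 𝓝 e, DifferentiableAt ℝ f (x, e) :=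
    (Continuous.tendsto' (f := fun z : E => (z, e)) (by fun_prop) e (e, e) rfl).eventually hdiff
  have hV : fderiv ℝ (fun x => f (x, e)) e = ContinuousLinearMap.id ℝ E := by
    have : (fun x => f (x, e)) =ᶠ[𝓝 e] id := hfe
    rw [this.fderiv_eq, fderiv_id]
  have hWe : W e = ContinuousLinearMap.id ℝ E := by
    have := hWf.self_of_nhds
    rwa [hV, ContinuousLinearMap.comp_id] at this
  have hD : DifferentiableAt ℝ (fderiv ℝ f) (e, e) :=
    (hf.fderiv_right (m := ∞) (by simp)).differentiableAt (by simp)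
  set D2 := fderiv ℝ (fderiv ℝ f) (e, e) with hD2
  have hsymm : ∀ v w, D2 v w = D2 w v :=
    hf.isSymmSndFDerivAt minSmoothness_two_le
  have hL : ∀ c a : E,
      fderiv ℝ (fun x => fderiv ℝ (fun y => f (x, y)) e c) e a = D2 (a, 0) (0, c) := by
    intro c a
    have h1 : (fun x => fderiv ℝ (fun y => f (x, y)) e c) =ᶠ[𝓝 e]
        fun x => fderiv ℝ f (x, e) (0, c) := by
      filter_upwards [hd2] with x hx
      rw [fderiv_partial_snd hx]
      rfl
    rw [h1.fderiv_eq]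
    have h2 : HasFDerivAt (fun x => fderiv ℝ f (x, e)) (D2 ∘L ContinuousLinearMap.inl ℝ E E) e :=
      HasFDerivAt.comp (f := fun x : E => (x, e)) e hD.hasFDerivAt (hasFDerivAt_prodMk_left e e)
    rw [(h2.clm_apply (hasFDerivAt_const _ _)).fderiv]
    simp
  -- Differentiate `W z ∘ ∂₁f(e, z) = id` in `z` at `e`, where both factors are the identity.
  have hWd : ∀ a b : E, fderiv ℝ W e a b = - D2 (0, a) (b, 0) := by
    intro a b
    have h1 : HasFDerivAt (fun z => fderiv ℝ f (e, z)) (D2 ∘L ContinuousLinearMap.inr ℝ E E) e :=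
      HasFDerivAt.comp (f := fun x : E => (e, x)) e hD.hasFDerivAt (hasFDerivAt_prodMk_right e e)
    have h2 := hW.hasFDerivAt.clm_apply (h1.clm_apply (hasFDerivAt_const ((b, 0) : E × E) e))
    have h3 : (fun z => W z (fderiv ℝ f (e, z) (b, 0))) =ᶠ[𝓝 e] fun _ => b := by
      filter_upwards [hd1, hWf] with z hz hz'
      rw [fderiv_partial_fst hz] at hz'
      exact DFunLike.congr_fun hz' b
    have h4 := h2.fderiv.symm.trans (h3.fderiv_eq.trans (fderiv_const_apply b))
    have h5 := DFunLike.congr_fun h4 a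
    have h6 : fderiv ℝ f (e, e) (b, 0) = b := by
      rw [fderiv_partial_fst hd1.self_of_nhds] at hV
      exact DFunLike.congr_fun hV b
    simp [hWe, h6] at h5
    rw [eq_neg_iff_add_eq_zero, add_comm]
    exact h5
  refine ⟨hWe, fun a b => ?_⟩
  -- Symmetry of the second derivative turns the mixed derivatives that come from right translations
  -- into those that come from left translations.
  rw [hL, hL, hWd, hWd, hsymm (0, a), hsymm (0, b)]
  abel

variable [LieGroup 𝓘(ℝ, E) ∞ G]

/-- The right Maurer–Cartan form in the preferred chart at the identity. -/
def localMC (G : Type*) [TopologicalSpace G] [ChartedSpace E G] [Group G] (z : E) : E →L[ℝ] E :=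
  fderiv ℝ (fun x => localDiv G x z) z

theorem contDiffAt_localMC_of_mem {z : E} (hz : z ∈ (chartAt E (1 : G)).target) :
    ContDiffAt ℝ ∞ (localMC (E := E) G) z := by
  have h := contDiffAt_localDiv (G := G) (x := z) (y := z) hz hz
    (by rw [mul_inv_cancel]; exact mem_chart_source E 1)
  have h' : ContDiffAt ℝ ∞ (fun p : E × E => localDiv G p.2 p.1) (z, z) :=
    h.comp (z, z) (f := fun p : E × E => (p.2, p.1)) (by fun_prop)
  exact ContDiffAt.fderiv (n := ∞) (f := fun z x => localDiv G x z) (g := fun z => z)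
      h' contDiffAt_id (by simp)

theorem contDiffAt_localMC : ContDiffAt ℝ ∞ (localMC (E := E) G) (localOne E G) :=
  contDiffAt_localMC_of_mem localOne_mem

/-- Since `(x z) z⁻¹ = x`, the operator `localMC G z` is a left inverse of the derivative at the
identity of right translation by `z`. `fderiv_antisymm_of_comp_eq_id` then expresses its exterior
derivative at the identity by the left invariant fields, that is, by the bracket. -/
theorem localMC_props : localMC G (localOne E G) = ContinuousLinearMap.id ℝ E ∧
    ∀ a b : E, fderiv ℝ (localMC G) (localOne E G) a b - fderiv ℝ (localMC G) (localOne E G) b a =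
      ad G a b := by
  set κ := chartAt E (1 : G) with hκ
  set e := localOne E G with he
  have he1 : κ.symm e = 1 := symm_localOne
  have hm := contDiffAt_localMul (G := G) (x := e) (y := e) localOne_mem
    localOne_mem (by rw [symm_localOne, mul_one]; exact mem_chart_source E 1)
  have hd := contDiffAt_localDiv (G := G) (x := e) (y := e) localOne_mem
    localOne_mem (by rw [symm_localOne, inv_one, mul_one]; exact mem_chart_source E 1)
  have htgt : ∀ᶠ x in 𝓝 e, x ∈ κ.target := κ.open_target.mem_nhds localOne_mem
  have hme : ∀ z ∈ κ.target, localMul G e z = z := fun z hz => by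
    rw [localMul, ← hκ, he1, one_mul, κ.right_inv hz]
  have hmul : ∀ᶠ p : E × E in 𝓝 (e, e), κ.symm p.1 * κ.symm p.2 ∈ κ.source := by
    have hc : ContMDiffAt 𝓘(ℝ, E × E) 𝓘(ℝ, E) ∞ (fun p : E × E => κ.symm p.1 * κ.symm p.2)
        (e, e) :=
      (contMDiffAt_chart_symm_comp mem_maximalAtlas_one (x := Prod.fst) contDiffAt_fst
        localOne_mem).mul
      (contMDiffAt_chart_symm_comp mem_maximalAtlas_one (x := Prod.snd) contDiffAt_snd
        localOne_mem)
    refine hc.continuousAt.preimage_mem_nhds (κ.open_source.mem_nhds ?_)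
    simp only [he1, mul_one]
    exact mem_chart_source E 1
  have key := fderiv_antisymm_of_comp_eq_id (f := fun p : E × E => localMul G p.1 p.2) hm
    (by
      filter_upwards [htgt] with x hx
      simp only [localMul, ← hκ, he1, mul_one, κ.right_inv hx])
    (W := localMC G) (contDiffAt_localMC.differentiableAt (by simp)) ?_
  · refine ⟨key.1, fun a b => ?_⟩
    rw [key.2 a b, ad_eq_fderiv_localMul]
  · have hz1 : ∀ᶠ z in 𝓝 e, ∀ᶠ x in 𝓝 e, κ.symm x * κ.symm z ∈ κ.source ∧ x ∈ κ.target := by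
      have : ∀ᶠ p : E × E in 𝓝 e ×ˢ 𝓝 e, κ.symm p.2 * κ.symm p.1 ∈ κ.source ∧ p.2 ∈ κ.target := by
        rw [← nhds_prod_eq]
        refine ((Continuous.tendsto' (f := fun p : E × E => (p.2, p.1)) (by fun_prop) (e, e)
          (e, e) rfl).eventually hmul).and ?_
        exact (Continuous.tendsto' (f := fun p : E × E => p.2) (by fun_prop) (e, e)
          e rfl).eventually htgt
      exact this.curry
    have hdd : ∀ᶠ z in 𝓝 e, DifferentiableAt ℝ (fun p : E × E => localDiv G p.1 p.2) (z, z) := by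
      refine (Continuous.tendsto' (f := fun z : E => (z, z)) (by fun_prop) e (e, e)
        rfl).eventually ?_
      filter_upwards [(hd.of_le (m := 1) (by simp)).eventually (by simp)] with p hp
      exact hp.differentiableAt (by simp)
    have hmd : ∀ᶠ z in 𝓝 e, DifferentiableAt ℝ (fun p : E × E => localMul G p.1 p.2) (e, z) := by
      refine (Continuous.tendsto' (f := fun z : E => (e, z)) (by fun_prop) e (e, e)
        rfl).eventually ?_
      filter_upwards [(hm.of_le (m := 1) (by simp)).eventually (by simp)] with p hp
      exact hp.differentiableAt (by simp)
    filter_upwards [hz1, htgt, hdd, hmd] with z hz hzt hz2 hz3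
    have h1 : (fun x => localDiv G (localMul G x z) z) =ᶠ[𝓝 e] id := by
      filter_upwards [hz] with x hx
      simp only [localDiv, localMul, ← hκ, κ.left_inv hx.1, mul_inv_cancel_right,
        κ.right_inv hx.2, id]
    have h2 : DifferentiableAt ℝ (fun x => localMul G x z) e :=
      hz3.comp e (f := fun x : E => (x, z)) (by fun_prop)
    have h3 : DifferentiableAt ℝ (fun x => localDiv G x z) (localMul G e z) := by
      rw [hme z hzt]
      exact hz2.comp z (f := fun x : E => (x, z)) (by fun_prop)
    have h4 := fderiv_comp (𝕜 := ℝ) e h3 h2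
    rw [hme z hzt] at h4
    exact h4.symm.trans (h1.fderiv_eq.trans fderiv_id)

/-- The bracket of the Lie algebra, as an operation on the model space. -/
def lieE (G : Type*) [TopologicalSpace G] [ChartedSpace E G] [Group G] (a b : E) : E :=
  ad G a b

/-- The right-hand side is an antisymmetrised continuous bilinear map, from which linearity,
antisymmetry and smoothness of the bracket are read off. -/
theorem lieE_eq (a b : E) : lieE G a b = fderiv ℝ (localMC G) (localOne E G) a b -
    fderiv ℝ (localMC G) (localOne E G) b a :=
  (localMC_props.2 a b).symm

theorem lieE_smul_left (r : ℝ) (a b : E) : lieE G (r • a) b = r • lieE G a b := by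
  simp [lieE_eq, smul_sub]

theorem lieE_zero_left (b : E) : lieE G 0 b = 0 := by
  simp [lieE_eq]

theorem lieE_swap (a b : E) : lieE G a b = -lieE G b a := by
  simp [lieE_eq]

theorem contDiff_lieE : ContDiff ℝ ∞ (fun p : E × E => lieE G p.1 p.2) := by
  simp only [lieE_eq]
  fun_prop

/-- From `g p' (g p)⁻¹ = (g p' (g q)⁻¹) (g p (g q)⁻¹)⁻¹`: near `q` the logarithmic derivative is the
pullback of the Maurer–Cartan form by the coordinates of one fixed right translate of `g`. -/
theorem rightLogDeriv_eventuallyEq {g : P → G} (hg : ContMDiff 𝓘(ℝ, P) 𝓘(ℝ, E) ∞ g) (q : P) :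
    rightLogDeriv g =ᶠ[𝓝 q] fun p =>
      localMC G (chartAt E (1 : G) (g p * (g q)⁻¹)) ∘L
        fderiv ℝ (fun p => chartAt E (1 : G) (g p * (g q)⁻¹)) p := by
  set κ := chartAt E (1 : G) with hκ
  have hsm : ContMDiff 𝓘(ℝ, P) 𝓘(ℝ, E) ∞ (fun p => g p * (g q)⁻¹) := hg.mul contMDiff_const
  have h1 : ∀ᶠ p in 𝓝 q, g p * (g q)⁻¹ ∈ κ.source := by
    refine hsm.continuous.continuousAt.preimage_mem_nhds (κ.open_source.mem_nhds ?_)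
    simp only [mul_inv_cancel]
    exact mem_chart_source E 1
  filter_upwards [h1.eventually_nhds] with p hp
  have hpp := hp.self_of_nhds
  set y := fun p => κ (g p * (g q)⁻¹) with hy
  have hyd : DifferentiableAt ℝ y p :=
    (contDiffAt_chart_comp le_rfl mem_maximalAtlas_one hsm.contMDiffAt hpp).differentiableAt
      (by simp)
  have h2 : (fun p' => κ (g p' * (g p)⁻¹)) =ᶠ[𝓝 p] (fun x => localDiv G x (y p)) ∘ y := by
    filter_upwards [hp] with p' hp'
    simp only [Function.comp_apply, localDiv, hy, ← hκ, κ.left_inv hp', κ.left_inv hpp]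
    congr 1
    group
  have h3 : DifferentiableAt ℝ (fun x => localDiv G x (y p)) (y p) := by
    refine ((contDiffAt_localDiv (G := G) (x := y p) (y := y p) (κ.map_source hpp)
      (κ.map_source hpp) ?_).differentiableAt (by simp)).comp (y p) (f := fun x : E => (x, y p))
      (by fun_prop)
    rw [mul_inv_cancel]
    exact mem_chart_source E 1
  rw [rightLogDeriv, ← hκ, h2.fderiv_eq, fderiv_comp p h3 hyd]
  rfl

theorem contDiffAt_mulRight_chart {g : P → G} (hg : ContMDiff 𝓘(ℝ, P) 𝓘(ℝ, E) ∞ g) (q : P) :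
    ContDiffAt ℝ ∞ (fun p => chartAt E (1 : G) (g p * (g q)⁻¹)) q := by
  have hsm : ContMDiff 𝓘(ℝ, P) 𝓘(ℝ, E) ∞ (fun p => g p * (g q)⁻¹) := hg.mul contMDiff_const
  exact contDiffAt_chart_comp le_rfl mem_maximalAtlas_one hsm.contMDiffAt (by simp)

theorem contDiff_rightLogDeriv {g : P → G} (hg : ContMDiff 𝓘(ℝ, P) 𝓘(ℝ, E) ∞ g) :
    ContDiff ℝ ∞ (rightLogDeriv (E := E) g) := by
  refine contDiff_iff_contDiffAt.2 fun q => ?_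
  refine ContDiffAt.congr_of_eventuallyEq ?_ (rightLogDeriv_eventuallyEq hg q)
  have hy := contDiffAt_mulRight_chart hg q
  have hyq : chartAt E (1 : G) (g q * (g q)⁻¹) = localOne E G := by rw [mul_inv_cancel]; rfl
  have hW : ContDiffAt ℝ ∞ (localMC (E := E) G) (chartAt E (1 : G) (g q * (g q)⁻¹)) :=
    hyq ▸ contDiffAt_localMC
  exact (hW.comp q hy).clm_comp (hy.fderiv_right (m := ∞) (by simp))

/-- The Maurer–Cartan equation for the right logarithmic derivative. -/
theorem maurerCartan {g : P → G} (hg : ContMDiff 𝓘(ℝ, P) 𝓘(ℝ, E) ∞ g) (q a b : P) :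
    fderiv ℝ (rightLogDeriv (E := E) g) q a b - fderiv ℝ (rightLogDeriv (E := E) g) q b a =
      lieE G (rightLogDeriv g q a) (rightLogDeriv g q b) := by
  have hy := contDiffAt_mulRight_chart hg q
  have hyq : chartAt E (1 : G) (g q * (g q)⁻¹) = localOne E G := by rw [mul_inv_cancel]; rfl
  have hW : DifferentiableAt ℝ (localMC (E := E) G) (chartAt E (1 : G) (g q * (g q)⁻¹)) :=
    hyq ▸ contDiffAt_localMC.differentiableAt (by simp)
  have hD : DifferentiableAt ℝ (fderiv ℝ fun p => chartAt E (1 : G) (g p * (g q)⁻¹)) q :=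
    (hy.fderiv_right (m := ∞) (by simp)).differentiableAt (by simp)
  -- After antisymmetrising, the terms with the second derivative of the coordinate map cancel, and
  -- the derivative of `localMC` at the identity gives the bracket.
  have hsymm := hy.isSymmSndFDerivAt minSmoothness_two_le
  have hder := (hW.hasFDerivAt.comp q (hy.differentiableAt (by simp)).hasFDerivAt).clm_comp
    hD.hasFDerivAt
  have hder' := (rightLogDeriv_eventuallyEq hg q).fderiv_eq.trans hder.fderiv
  rw [hder']
  rw [lieE_eq]
  simp [hsymm.eq a b, rightLogDeriv]
  rfl

end MaurerCartan

/-! ### The first variation of the action along a smooth family. -/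

section Family

variable {E : Type*} [NormedAddCommGroup E] [NormedSpace ℝ E]
  {F : Type*} [NormedAddCommGroup F] [NormedSpace ℝ F]
  {G : Type*} [TopologicalSpace G] [ChartedSpace E G] [Group G]
  {N : Type*} [TopologicalSpace N] [ChartedSpace F N]
  [MulAction G N]

/-- The integrand of the constrained action. -/
def integrand (ℓ : E → TangentBundle 𝓘(ℝ, F) N → ℝ) (γ : PontryaginCurve E F G N) (t : ℝ) : ℝ :=
  ℓ (γ.u t) ⟨γ.n t, γ.ν t⟩
      + γ.M t (rightVelocity γ.g t - γ.u t)
      + γ.σ t (velocity γ.n t - γ.ν t - infAct G (γ.n t) (γ.u t))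

/-- The integrand of the constrained action in coordinates. -/
def localIntegrand (Λ : E → F → F → ℝ) (A : F → E →L[ℝ] F) (u : E) (x v : F) (M : E →L[ℝ] ℝ)
    (ξ : E) (p : F →L[ℝ] ℝ) (x' : F) : ℝ :=
  Λ u x v + M (ξ - u) + p (x' - v - A x u)

/-- Chain and product rules, with `ξ` and `x'` treated as independent of the other arguments. Their
special variations, which carry the content, are inserted afterwards. -/
theorem hasDerivAt_localIntegrand {Λ : E → F → F → ℝ} {A : F → E →L[ℝ] F} {s : ℝ}
    {u ξ : ℝ → E} {x v x' : ℝ → F} {M : ℝ → E →L[ℝ] ℝ} {p : ℝ → F →L[ℝ] ℝ}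
    {du dξ : E} {dx dv dx' : F} {dM : E →L[ℝ] ℝ} {dp : F →L[ℝ] ℝ}
    (hΛ : DifferentiableAt ℝ (fun q : E × F × F => Λ q.1 q.2.1 q.2.2) (u s, x s, v s))
    (hA : DifferentiableAt ℝ A (x s)) (hu : HasDerivAt u du s) (hx : HasDerivAt x dx s)
    (hv : HasDerivAt v dv s) (hM : HasDerivAt M dM s) (hξ : HasDerivAt ξ dξ s)
    (hp : HasDerivAt p dp s) (hx' : HasDerivAt x' dx' s) :
    HasDerivAt (fun r => localIntegrand Λ A (u r) (x r) (v r) (M r) (ξ r) (p r) (x' r))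
      (fderiv ℝ (fun w => Λ w (x s) (v s)) (u s) du + fderiv ℝ (fun y => Λ (u s) y (v s)) (x s) dx
        + fderiv ℝ (fun w => Λ (u s) (x s) w) (v s) dv + dM (ξ s - u s) + M s (dξ - du)
        + dp (x' s - v s - A (x s) (u s))
        + p s (dx' - dv - fderiv ℝ A (x s) dx (u s) - A (x s) du)) s := by
  have h1 : HasDerivAt (fun r => Λ (u r) (x r) (v r))
      (fderiv ℝ (fun q : E × F × F => Λ q.1 q.2.1 q.2.2) (u s, x s, v s) (du, dx, dv)) s :=
    hΛ.hasFDerivAt.comp_hasDerivAt (f := fun r => (u r, x r, v r)) s (hu.prodMk (hx.prodMk hv))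
  have e1 : fderiv ℝ (fun w => Λ w (x s) (v s)) (u s) =
      fderiv ℝ (fun q : E × F × F => Λ q.1 q.2.1 q.2.2) (u s, x s, v s) ∘L
        ContinuousLinearMap.inl ℝ E (F × F) := fderiv_partial_fst hΛ
  have e2 : fderiv ℝ (fun y => Λ (u s) y (v s)) (x s) =
      fderiv ℝ (fun q : E × F × F => Λ q.1 q.2.1 q.2.2) (u s, x s, v s) ∘L
        ContinuousLinearMap.inr ℝ E (F × F) ∘L ContinuousLinearMap.inl ℝ F F :=
    (hΛ.hasFDerivAt.comp (x s) (f := fun y : F => (u s, y, v s))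
      ((hasFDerivAt_prodMk_right (u s) (x s, v s)).comp (x s) (f := fun y : F => (y, v s))
        (hasFDerivAt_prodMk_left (x s) (v s)))).fderiv
  have e3 : fderiv ℝ (fun w => Λ (u s) (x s) w) (v s) =
      fderiv ℝ (fun q : E × F × F => Λ q.1 q.2.1 q.2.2) (u s, x s, v s) ∘L
        ContinuousLinearMap.inr ℝ E (F × F) ∘L ContinuousLinearMap.inr ℝ F F :=
    (hΛ.hasFDerivAt.comp (v s) (f := fun y : F => (u s, x s, y))
      ((hasFDerivAt_prodMk_right (u s) (x s, v s)).comp (v s) (f := fun y : F => (x s, y))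
        (hasFDerivAt_prodMk_right (x s) (v s)))).fderiv
  have h2 := hM.clm_apply (hξ.sub hu)
  have hAx : HasDerivAt (fun r => A (x r)) (fderiv ℝ A (x s) dx) s :=
    hA.hasFDerivAt.comp_hasDerivAt s hx
  have h3 := hp.clm_apply ((hx'.sub hv).sub (hAx.clm_apply hu))
  refine ((h1.add h2).add h3).congr_deriv ?_
  have e4 : ((du, dx, dv) : E × F × F) = (du, 0, 0) + ((0, dx, 0) + (0, 0, dv)) := by simp
  rw [e4, map_add, map_add, e1, e2, e3]
  simp only [ContinuousLinearMap.comp_apply, ContinuousLinearMap.inl_apply,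
    ContinuousLinearMap.inr_apply, map_sub, map_add, Prod.mk_zero_zero]
  simp
  ring

theorem map_sub_sub (T : F →L[ℝ] F) (x y z : F) : T x - T y - T z = T (x - y - z) := by
  rw [map_sub, map_sub]

variable (c : ℝ → PontryaginCurve E F G N) (φ : OpenPartialHomeomorph N F)

/-- The coordinates of the base curves of a family. -/
def famX (q : ℝ × ℝ) : F := φ ((c q.1).n q.2)

/-- The coordinates of the tangent vectors of a family. -/
def famV (q : ℝ × ℝ) : F := chartD φ ((c q.1).n q.2) ((c q.1).ν q.2)

/-- The coordinates of the cotangent vectors of a family. -/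
def famP (q : ℝ × ℝ) : F →L[ℝ] ℝ :=
  ((c q.1).σ q.2 : F →L[ℝ] ℝ) ∘L chartDSymm φ (φ ((c q.1).n q.2))

/-- The time component of the right logarithmic derivative of a family. -/
def famXi (q : ℝ × ℝ) : E := rightLogDeriv (fun q : ℝ × ℝ => (c q.1).g q.2) q (0, 1)

/-- The parameter component of the right logarithmic derivative of a family. -/
def famEta (q : ℝ × ℝ) : E := rightLogDeriv (fun q : ℝ × ℝ => (c q.1).g q.2) q (1, 0)

variable [IsManifold 𝓘(ℝ, F) ∞ N] [LieGroup 𝓘(ℝ, E) ∞ G]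
variable {c} {φ}
variable (hc : IsSmoothFamily c) (hφ : φ ∈ IsManifold.maximalAtlas 𝓘(ℝ, F) ∞ N)

theorem hasDerivAt_mk_left (a b : ℝ) : HasDerivAt (fun s : ℝ => (s, b)) ((1, 0) : ℝ × ℝ) a :=
  (hasDerivAt_id a).prodMk (hasDerivAt_const a b)

theorem hasDerivAt_mk_right (a b : ℝ) : HasDerivAt (fun s : ℝ => (a, s)) ((0, 1) : ℝ × ℝ) b :=
  (hasDerivAt_const b a).prodMk (hasDerivAt_id b)

theorem hasDerivAt_line_left {Z : Type*} [NormedAddCommGroup Z] [NormedSpace ℝ Z] {f : ℝ × ℝ → Z}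
    {q : ℝ × ℝ} (hf : DifferentiableAt ℝ f q) :
    HasDerivAt (fun s => f (s, q.2)) (fderiv ℝ f q (1, 0)) q.1 :=
  hf.hasFDerivAt.comp_hasDerivAt (f := fun s : ℝ => (s, q.2)) q.1 (hasDerivAt_mk_left q.1 q.2)

theorem hasDerivAt_line_right {Z : Type*} [NormedAddCommGroup Z] [NormedSpace ℝ Z] {f : ℝ × ℝ → Z}
    {q : ℝ × ℝ} (hf : DifferentiableAt ℝ f q) :
    HasDerivAt (fun s => f (q.1, s)) (fderiv ℝ f q (0, 1)) q.2 :=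
  hf.hasFDerivAt.comp_hasDerivAt (f := fun s : ℝ => (q.1, s)) q.2 (hasDerivAt_mk_right q.1 q.2)

section
include hc

theorem contMDiff_fam_n : ContMDiff 𝓘(ℝ, ℝ × ℝ) 𝓘(ℝ, F) ∞ (fun q : ℝ × ℝ => (c q.1).n q.2) :=
  fun q => (Bundle.contMDiffAt_totalSpace.1 (hc.ν q)).1

theorem isOpen_fam_source : IsOpen {q : ℝ × ℝ | (c q.1).n q.2 ∈ φ.source} :=
  φ.open_source.preimage (contMDiff_fam_n hc).continuous

theorem contDiff_famXi : ContDiff ℝ ∞ (famXi c) :=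
  (contDiff_rightLogDeriv hc.g).clm_apply contDiff_const

theorem contDiff_famEta : ContDiff ℝ ∞ (famEta c) :=
  (contDiff_rightLogDeriv hc.g).clm_apply contDiff_const

theorem rightVelocity_fam (a t : ℝ) : rightVelocity (c a).g t = famXi c (a, t) :=
  rightVelocity_comp hc.g (hasDerivAt_mk_right a t)

theorem rightVelocity_fam_left (a t : ℝ) :
    rightVelocity (fun s => (c s).g t) a = famEta c (a, t) :=
  rightVelocity_comp hc.g (hasDerivAt_mk_left a t)

/-- The Maurer–Cartan equation on the two coordinate vectors: variations of `ġ g⁻¹` are not free but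
have the form `∂ₜη + [η, ξ]`. -/
theorem fderiv_famXi (q : ℝ × ℝ) :
    fderiv ℝ (famXi c) q (1, 0) =
      fderiv ℝ (famEta c) q (0, 1) + lieE G (famEta c q) (famXi c q) := by
  have hd : DifferentiableAt ℝ (rightLogDeriv (E := E) (fun q : ℝ × ℝ => (c q.1).g q.2)) q :=
    (contDiff_rightLogDeriv hc.g).differentiable (by simp) q
  have h1 : ∀ a b : ℝ × ℝ, fderiv ℝ (fun q => rightLogDeriv (E := E)
      (fun q : ℝ × ℝ => (c q.1).g q.2) q b) q a =
      fderiv ℝ (rightLogDeriv (E := E) (fun q : ℝ × ℝ => (c q.1).g q.2)) q a b := fun a b => by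
    rw [(hd.hasFDerivAt.clm_apply (hasFDerivAt_const b q)).fderiv]
    simp
  have h2 := maurerCartan (E := E) hc.g q (1, 0) (0, 1)
  exact (h1 _ _).trans ((sub_eq_iff_eq_add'.1 h2).trans
    (congrArg (fun e : E => e + lieE G (famEta c q) (famXi c q)) (h1 _ _).symm))

include hφ

theorem contDiffAt_famX {q : ℝ × ℝ} (hq : (c q.1).n q.2 ∈ φ.source) :
    ContDiffAt ℝ ∞ (famX c φ) q :=
  (contDiffAt_tangent_coord le_rfl hφ (hc.ν q) hq).1

theorem contDiffAt_famV {q : ℝ × ℝ} (hq : (c q.1).n q.2 ∈ φ.source) :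
    ContDiffAt ℝ ∞ (famV c φ) q :=
  (contDiffAt_tangent_coord le_rfl hφ (hc.ν q) hq).2

theorem contDiffAt_famP {q : ℝ × ℝ} (hq : (c q.1).n q.2 ∈ φ.source) :
    ContDiffAt ℝ ∞ (famP c φ) q :=
  contDiffAt_cotangent_coord hφ (hc.σ q) hq

theorem chartD_velocity {q : ℝ × ℝ} (hq : (c q.1).n q.2 ∈ φ.source) :
    chartD φ ((c q.1).n q.2) (velocity (c q.1).n q.2) = fderiv ℝ (famX c φ) q (0, 1) := by
  have h1 : ContMDiff 𝓘(ℝ, ℝ) 𝓘(ℝ, F) ∞ (c q.1).n :=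
    (contMDiff_fam_n hc).comp (f := fun s : ℝ => (q.1, s))
      (ContDiff.contMDiff (by fun_prop))
  have h2 := (hasFDerivAt_chart_comp hφ (h1.mdifferentiableAt (by simp)) hq).hasDerivAt
  have h3 := ((contDiffAt_famX hc hφ hq).differentiableAt (by simp)).hasFDerivAt.comp_hasDerivAt
    (f := fun s : ℝ => (q.1, s)) q.2 (hasDerivAt_mk_right q.1 q.2)
  exact h2.unique h3

variable [ContMDiffSMul 𝓘(ℝ, E) 𝓘(ℝ, F) ∞ G N]

/-- The pairing with `σ` does not depend on the chart: the derivative of `φ` on the vector cancels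
the derivative of its inverse in `famP`. -/
theorem integrand_eq_local (ℓ : E → TangentBundle 𝓘(ℝ, F) N → ℝ) {q : ℝ × ℝ}
    (hq : (c q.1).n q.2 ∈ φ.source) :
    integrand ℓ (c q.1) q.2 = localIntegrand (localLagrangian ℓ φ) (localAct G φ)
      ((c q.1).u q.2) (famX c φ q) (famV c φ q) ((c q.1).M q.2) (famXi c q) (famP c φ q)
      (fderiv ℝ (famX c φ) q (0, 1)) := by
  have h1 : localLagrangian ℓ φ ((c q.1).u q.2) (famX c φ q) (famV c φ q) =
    ℓ ((c q.1).u q.2) ⟨(c q.1).n q.2, (c q.1).ν q.2⟩ := localLagrangian_chart ℓ hφ _ hq _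
  have h2 : (localAct G φ (famX c φ q) : E →L[ℝ] F) =
      chartD φ ((c q.1).n q.2) ∘L infAct G ((c q.1).n q.2) := by
    rw [localAct, famX, φ.left_inv hq]
  have h3 : ∀ w : F, (c q.1).σ q.2 w = famP c φ q (chartD φ ((c q.1).n q.2) w) := fun w =>
    congrArg ((c q.1).σ q.2 : F →L[ℝ] ℝ) (chartDSymm_chartD hφ hq w).symm
  have h4 : famP c φ q (fderiv ℝ (famX c φ) q (0, 1) - famV c φ q -
      (localAct G φ (famX c φ q) : E →L[ℝ] F) ((c q.1).u q.2)) = (c q.1).σ q.2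
      (velocity (c q.1).n q.2 - (c q.1).ν q.2 - infAct G ((c q.1).n q.2) ((c q.1).u q.2)) := by
    refine Eq.trans ?_ (h3 _).symm
    rw [h2, ← chartD_velocity hc hφ hq]
    refine congrArg (famP c φ q) ?_
    exact map_sub_sub _ _ _ _
  rw [integrand, localIntegrand, h1, h4, rightVelocity_fam hc q.1 q.2]

end

section Lagrangian

variable [ContMDiffSMul 𝓘(ℝ, E) 𝓘(ℝ, F) ∞ G N]
variable {ℓ : E → TangentBundle 𝓘(ℝ, F) N → ℝ}
  (hℓ : ContMDiff (𝓘(ℝ, E).prod 𝓘(ℝ, F).tangent) 𝓘(ℝ, ℝ) ∞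
      (fun p : E × TangentBundle 𝓘(ℝ, F) N => ℓ p.1 p.2))
include hℓ hc

theorem contDiff_integrand_fam : ContDiff ℝ ∞ (fun q : ℝ × ℝ => integrand ℓ (c q.1) q.2) := by
  refine contDiff_iff_contDiffAt.2 fun q => ?_
  set φ := chartAt F ((c q.1).n q.2) with hφdef
  have hφ : φ ∈ IsManifold.maximalAtlas 𝓘(ℝ, F) ∞ N := IsManifold.chart_mem_maximalAtlas _
  have hq : (c q.1).n q.2 ∈ φ.source := mem_chart_source F _
  have hev : (fun q : ℝ × ℝ => integrand ℓ (c q.1) q.2) =ᶠ[𝓝 q] fun q =>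
      localIntegrand (localLagrangian ℓ φ) (localAct G φ)
      ((c q.1).u q.2) (famX c φ q) (famV c φ q) ((c q.1).M q.2) (famXi c q) (famP c φ q)
      (fderiv ℝ (famX c φ) q (0, 1)) := by
    filter_upwards [(isOpen_fam_source hc).mem_nhds hq] with r hr
    exact integrand_eq_local hc hφ ℓ hr
  refine ContDiffAt.congr_of_eventuallyEq ?_ hev
  have hx := contDiffAt_famX hc hφ hq
  have hv := contDiffAt_famV hc hφ hq
  have hp := contDiffAt_famP hc hφ hq
  have hu := hc.u.contDiffAt (x := q)
  have hM := hc.M.contDiffAt (x := q)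
  have hξ := (contDiff_famXi hc).contDiffAt (x := q)
  have hx' : ContDiffAt ℝ ∞ (fun q => fderiv ℝ (famX c φ) q (0, 1)) q :=
    (hx.fderiv_right (m := ∞) (by simp)).clm_apply contDiffAt_const
  have hxt : famX c φ q ∈ φ.target := φ.map_source hq
  have hΛ := (contDiffAt_localLagrangian hℓ hφ
    (q := ((c q.1).u q.2, famX c φ q, famV c φ q)) hxt).comp q
    (f := fun q : ℝ × ℝ => ((c q.1).u q.2, famX c φ q, famV c φ q)) (hu.prodMk (hx.prodMk hv))
  have hA : ContDiffAt ℝ ∞ (fun q => localAct (E := E) G φ (famX c φ q)) q :=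
    (contDiffAt_localAct hφ hxt).comp q hx
  exact (hΛ.add (hM.clm_apply (hξ.sub hu))).add (hp.clm_apply ((hx'.sub hv).sub (hA.clm_apply hu)))

include hφ

/-- The first variation formula in a chart. -/
theorem hasDerivAt_integrand_fam {q : ℝ × ℝ} (hq : (c q.1).n q.2 ∈ φ.source) {du : E}
    {dM : E →L[ℝ] ℝ} {dv : F} {dp : F →L[ℝ] ℝ} (hu : HasDerivAt (fun s => (c s).u q.2) du q.1)
    (hM : HasDerivAt (fun s => (c s).M q.2) dM q.1)
    (hv : HasDerivAt (fun s => famV c φ (s, q.2)) dv q.1)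
    (hp : HasDerivAt (fun s => famP c φ (s, q.2)) dp q.1) :
    HasDerivAt (fun s => integrand ℓ (c s) q.2)
      (fderiv ℝ (fun w => localLagrangian ℓ φ w (famX c φ q) (famV c φ q)) ((c q.1).u q.2) du
        + fderiv ℝ (fun y => localLagrangian ℓ φ ((c q.1).u q.2) y (famV c φ q)) (famX c φ q)
          (fderiv ℝ (famX c φ) q (1, 0))
        + fderiv ℝ (fun w => localLagrangian ℓ φ ((c q.1).u q.2) (famX c φ q) w) (famV c φ q) dv
        + dM (famXi c q - (c q.1).u q.2)
        + (c q.1).M q.2 (fderiv ℝ (famEta c) q (0, 1) + lieE G (famEta c q) (famXi c q) - du)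
        + dp (fderiv ℝ (famX c φ) q (0, 1) - famV c φ q
            - localAct G φ (famX c φ q) ((c q.1).u q.2))
        + famP c φ q (fderiv ℝ (fun r => fderiv ℝ (famX c φ) r (1, 0)) q (0, 1) - dv
            - fderiv ℝ (localAct G φ) (famX c φ q) (fderiv ℝ (famX c φ) q (1, 0)) ((c q.1).u q.2)
            - localAct G φ (famX c φ q) du)) q.1 := by
  have hxs := contDiffAt_famX hc hφ hq
  have hxt : famX c φ q ∈ φ.target := φ.map_source hq
  have hx := hasDerivAt_line_left (hxs.differentiableAt (by simp))
  have hξ := hasDerivAt_line_left ((contDiff_famXi hc).contDiffAt.differentiableAt (x := q) (by simp))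
  rw [fderiv_famXi hc] at hξ
  have hD : DifferentiableAt ℝ (fderiv ℝ (famX c φ)) q :=
    (hxs.fderiv_right (m := ∞) (by simp)).differentiableAt (by simp)
  have hpart : ∀ a b : ℝ × ℝ, fderiv ℝ (fun r => fderiv ℝ (famX c φ) r b) q a =
      fderiv ℝ (fderiv ℝ (famX c φ)) q a b := fun a b => by
    rw [(hD.hasFDerivAt.clm_apply (hasFDerivAt_const b q)).fderiv]
    simp
  have hsymm := hxs.isSymmSndFDerivAt minSmoothness_two_le
  have hx' := hasDerivAt_line_left (f := fun r => fderiv ℝ (famX c φ) r (0, 1))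
    (hD.clm_apply (differentiableAt_const _))
  -- Equality of mixed derivatives: the variation of the velocity is the time derivative of the
  -- variation.
  rw [hpart, hsymm.eq, ← hpart] at hx'
  have key := hasDerivAt_localIntegrand (s := q.1)
    ((contDiffAt_localLagrangian hℓ hφ (q := ((c q.1).u q.2, famX c φ q, famV c φ q))
      hxt).differentiableAt (by simp))
    ((contDiffAt_localAct (G := G) (E := E) hφ hxt).differentiableAt (by simp)) hu hx hv hM hξ hp
    hx'
  refine key.congr_of_eventuallyEq ?_
  have : ∀ᶠ s in 𝓝 q.1, (c s).n q.2 ∈ φ.source :=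
    (Continuous.tendsto' (f := fun s : ℝ => (s, q.2)) (by fun_prop) q.1 q rfl).eventually
      ((isOpen_fam_source hc).mem_nhds hq)
  filter_upwards [this] with s hs
  exact integrand_eq_local hc hφ ℓ (q := (s, q.2)) hs

omit hφ

/-- Differentiation under the integral sign; the parameter derivative of the integrand is jointly
continuous, hence bounded on the compact set `[-1, 1] × [0, 1]`. -/
theorem hasDerivAt_action_fam :
    HasDerivAt (fun s => action ℓ (c s))
      (∫ t in (0 : ℝ)..1, deriv (fun s => integrand ℓ (c s) t) 0) 0 := by
  set I : ℝ × ℝ → ℝ := fun q => integrand ℓ (c q.1) q.2 with hI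
  have hIs : ContDiff ℝ ∞ I := contDiff_integrand_fam hc hℓ
  have hd : ∀ a t : ℝ, HasDerivAt (fun s => I (s, t)) (fderiv ℝ I (a, t) (1, 0)) a := fun a t =>
    (hIs.differentiable (by simp) (a, t)).hasFDerivAt.comp_hasDerivAt (f := fun s : ℝ => (s, t)) a
      (hasDerivAt_mk_left a t)
  have hcont : Continuous fun q : ℝ × ℝ => fderiv ℝ I q (1, 0) :=
    (hIs.continuous_fderiv (by simp)).clm_apply continuous_const
  obtain ⟨C, hC⟩ := ((isCompact_Icc (a := (-1 : ℝ)) (b := 1)).prod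
    (isCompact_Icc (a := (0 : ℝ)) (b := 1))).exists_bound_of_continuousOn hcont.continuousOn
  have key := (intervalIntegral.hasDerivAt_integral_of_dominated_loc_of_deriv_le (μ := volume)
    (a := 0) (b := 1) (F := fun s t => I (s, t)) (F' := fun s t => fderiv ℝ I (s, t) (1, 0))
    (x₀ := (0 : ℝ)) (s := Icc (-1) 1) (bound := fun _ => C)
    (Icc_mem_nhds (by norm_num) (by norm_num))
    (Filter.Eventually.of_forall fun s => (Continuous.aestronglyMeasurable
      (hIs.continuous.comp (by fun_prop : Continuous fun t : ℝ => (s, t)))))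
    (Continuous.intervalIntegrable
      (hIs.continuous.comp (by fun_prop : Continuous fun t : ℝ => ((0 : ℝ), t))) _ _)
    (Continuous.aestronglyMeasurable
      (hcont.comp (by fun_prop : Continuous fun t : ℝ => ((0 : ℝ), t))))
    (Filter.Eventually.of_forall fun t ht s hs => hC (s, t) ⟨hs, by
      rw [uIoc_of_le zero_le_one] at ht; exact Ioc_subset_Icc_self ht⟩)
    intervalIntegrable_const
    (Filter.Eventually.of_forall fun t _ s _ => hd s t)).2
  refine key.congr_deriv (intervalIntegral.integral_congr fun t _ => ?_)
  exact (hd 0 t).deriv.symm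

end Lagrangian

end Family

/-! ### Intrinsic relations and their chart expressions. -/

section Equations

variable {E : Type*} [NormedAddCommGroup E] [NormedSpace ℝ E]
  {F : Type*} [NormedAddCommGroup F] [NormedSpace ℝ F]
  {G : Type*} [TopologicalSpace G] [ChartedSpace E G] [Group G]
  {N : Type*} [TopologicalSpace N] [ChartedSpace F N]
  [MulAction G N] [IsManifold 𝓘(ℝ, F) ∞ N] [LieGroup 𝓘(ℝ, E) ∞ G]
  [ContMDiffSMul 𝓘(ℝ, E) 𝓘(ℝ, F) ∞ G N]
  {φ : OpenPartialHomeomorph N F} (hφ : φ ∈ IsManifold.maximalAtlas 𝓘(ℝ, F) ∞ N)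
  {ℓ : E → TangentBundle 𝓘(ℝ, F) N → ℝ}
  (hℓ : ContMDiff (𝓘(ℝ, E).prod 𝓘(ℝ, F).tangent) 𝓘(ℝ, ℝ) ∞
      (fun p : E × TangentBundle 𝓘(ℝ, F) N => ℓ p.1 p.2))

variable (G) in
/-- The infinitesimal action, with values in the model space. -/
def infActModel (n : N) : E →L[ℝ] F := infAct G n

variable (ℓ) in
/-- The fibre derivative `δℓ/δν`, as a covector of the model space. -/
def dNuModel (u : E) (n : N) (ν : F) : F →L[ℝ] ℝ := dNu ℓ u n ν

section Pointwise

variable {n : N} (hn : n ∈ φ.source)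

include hφ hn

theorem comp_chartDSymm_comp_chartD (σ : F →L[ℝ] ℝ) :
    (σ ∘L chartDSymm φ (φ n)) ∘L chartD φ n = σ := by
  rw [ContinuousLinearMap.comp_assoc, chartDSymm_comp_chartD hφ hn, ContinuousLinearMap.comp_id]

theorem comp_chartD_comp_chartDSymm_self (σ : F →L[ℝ] ℝ) :
    (σ ∘L chartD φ n) ∘L chartDSymm φ (φ n) = σ :=
  ContinuousLinearMap.ext fun w => congrArg σ (chartD_chartDSymm' hφ hn w)

theorem localAct_chart :
    (localAct G φ (φ n) : E →L[ℝ] F) = chartD φ n ∘L infActModel G n := by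
  rw [localAct, φ.left_inv hn]
  rfl

theorem diamond_eq_local (σ : F →L[ℝ] ℝ) :
    -(σ ∘L (infActModel G n : E →L[ℝ] F)) =
      -((σ ∘L chartDSymm φ (φ n)) ∘L (localAct G φ (φ n) : E →L[ℝ] F)) := by
  rw [localAct_chart hφ hn, ← ContinuousLinearMap.comp_assoc, comp_chartDSymm_comp_chartD hφ hn]

theorem velocity_eq_iff_local (w ν : F) (u : E) :
    (w = ν + infActModel G n u) ↔
      chartD φ n w = chartD φ n ν + localAct G φ (φ n) u := by
  rw [localAct_chart hφ hn, ContinuousLinearMap.comp_apply, ← map_add]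
  refine ⟨fun hw => by rw [hw], fun hw => ?_⟩
  have h3 := congrArg (chartDSymm φ (φ n)) hw
  rwa [chartDSymm_chartD hφ hn, chartDSymm_chartD hφ hn] at h3

include hℓ

theorem dNuModel_comp_chartDSymm (u : E) (ν : F) :
    dNuModel ℓ u n ν ∘L chartDSymm φ (φ n) =
      fderiv ℝ (fun v => localLagrangian ℓ φ u (φ n) v) (chartD φ n ν) :=
  (congrArg (fun T : F →L[ℝ] ℝ => T ∘L chartDSymm φ (φ n)) (dNu_eq_local hℓ hφ u hn ν)).trans
    (comp_chartD_comp_chartDSymm_self hφ hn _)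

theorem eq_dNuModel_iff_local (u : E) (ν : F) (σ : F →L[ℝ] ℝ) :
    σ = dNuModel ℓ u n ν ↔ σ ∘L chartDSymm φ (φ n) =
      fderiv ℝ (fun v => localLagrangian ℓ φ u (φ n) v) (chartD φ n ν) := by
  rw [← dNuModel_comp_chartDSymm hφ hℓ hn]
  refine ⟨fun h => by rw [h], fun h => ?_⟩
  have : (σ ∘L chartDSymm φ (φ n)) ∘L chartD φ n =
    (dNuModel ℓ u n ν ∘L chartDSymm φ (φ n)) ∘L chartD φ n := by rw [h]
  rwa [comp_chartDSymm_comp_chartD hφ hn, comp_chartDSymm_comp_chartD hφ hn] at this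

theorem dU_add_diamond_eq_local (u : E) (ν : F) (σ : F →L[ℝ] ℝ) :
    dU ℓ u n ν + diamond G (n := n) σ =
      fderiv ℝ (fun w => localLagrangian ℓ φ w (φ n) (chartD φ n ν)) u -
        (σ ∘L chartDSymm φ (φ n)) ∘L localAct G φ (φ n) := by
  rw [sub_eq_add_neg, ← diamond_eq_local hφ hn]
  exact congrArg (fun T : E →L[ℝ] ℝ => T + -(σ ∘L (infActModel G n : E →L[ℝ] F)))
    (dU_eq_local hℓ hφ u hn ν)

end Pointwise

namespace ReducedCurve

variable {r : ReducedCurve E F N} (hr : r.IsSmooth)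

include hr

theorem contMDiff_n : ContMDiff 𝓘(ℝ, ℝ) 𝓘(ℝ, F) ∞ r.n := fun t =>
  (Bundle.contMDiffAt_totalSpace.1 (hr.ν t)).1

include hφ in
theorem contDiffAt_localN {t : ℝ} (ht : r.n t ∈ φ.source) : ContDiffAt ℝ ∞ (r.localN φ) t :=
  (contDiffAt_tangent_coord le_rfl hφ (hr.ν t) ht).1

include hφ in
theorem contDiffAt_localNu {t : ℝ} (ht : r.n t ∈ φ.source) : ContDiffAt ℝ ∞ (r.localNu φ) t :=
  (contDiffAt_tangent_coord le_rfl hφ (hr.ν t) ht).2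

include hφ hℓ in
theorem contDiffAt_local_partials {t : ℝ} (ht : r.n t ∈ φ.source) :
    ContDiffAt ℝ ∞ (fun s => fderiv ℝ (fun w => localLagrangian ℓ φ w (r.localN φ s)
      (r.localNu φ s)) (r.u s)) t ∧
    ContDiffAt ℝ ∞ (r.localDN ℓ φ) t ∧ ContDiffAt ℝ ∞ (r.localDNu ℓ φ) t := by
  have hx := contDiffAt_localN hφ hr ht
  have hv := contDiffAt_localNu hφ hr ht
  have hu := hr.u.contDiffAt (x := t)
  have hxt : r.localN φ t ∈ φ.target := φ.map_source ht
  have hΛ := contDiffAt_localLagrangian hℓ hφ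
    (q := (r.u t, r.localN φ t, r.localNu φ t)) hxt
  refine ⟨?_, ?_, ?_⟩
  · exact ContDiffAt.fderiv (n := ∞)
      (f := fun s w => localLagrangian ℓ φ w (r.localN φ s) (r.localNu φ s)) (g := r.u)
      (hΛ.comp (t, r.u t) (f := fun p : ℝ × E => (p.2, r.localN φ p.1, r.localNu φ p.1))
        (contDiffAt_snd.prodMk ((hx.comp (t, r.u t) contDiffAt_fst).prodMk
          (hv.comp (t, r.u t) contDiffAt_fst)))) hu (by simp)
  · exact ContDiffAt.fderiv (n := ∞)
      (f := fun s y => localLagrangian ℓ φ (r.u s) y (r.localNu φ s)) (g := r.localN φ)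
      (hΛ.comp (t, r.localN φ t) (f := fun p : ℝ × F => (r.u p.1, p.2, r.localNu φ p.1))
        ((hu.comp (t, r.localN φ t) contDiffAt_fst).prodMk (contDiffAt_snd.prodMk
          (hv.comp (t, r.localN φ t) contDiffAt_fst)))) hx (by simp)
  · exact ContDiffAt.fderiv (n := ∞)
      (f := fun s y => localLagrangian ℓ φ (r.u s) (r.localN φ s) y) (g := r.localNu φ)
      (hΛ.comp (t, r.localNu φ t) (f := fun p : ℝ × F => (r.u p.1, r.localN φ p.1, p.2))
        ((hu.comp (t, r.localNu φ t) contDiffAt_fst).prodMk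
          ((hx.comp (t, r.localNu φ t) contDiffAt_fst).prodMk contDiffAt_snd))) hv (by simp)

omit hr in
include hφ hℓ in
theorem momentum_eq_local {t : ℝ} (ht : r.n t ∈ φ.source) :
    r.momentum ℓ G t = fderiv ℝ (fun w => localLagrangian ℓ φ w (r.localN φ t)
      (r.localNu φ t)) (r.u t) - r.localDNu ℓ φ t ∘L localAct G φ (r.localN φ t) := by
  have h := dU_add_diamond_eq_local (G := G) hφ hℓ ht (r.u t) (r.ν t)
    (dNuModel ℓ (r.u t) (r.n t) (r.ν t))
  exact h.trans (congrArg (fun T : F →L[ℝ] ℝ => fderiv ℝ (fun w => localLagrangian ℓ φ w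
    (r.localN φ t) (r.localNu φ t)) (r.u t) - T ∘L localAct G φ (r.localN φ t))
    (dNuModel_comp_chartDSymm hφ hℓ ht (r.u t) (r.ν t)))

-- Smoothness holds at all times, so the momentum can serve as the curve `M`, and the
-- differentiability clause of `EulerPoincare` is automatic for smooth curves.
include hℓ in
theorem contDiff_momentum : ContDiff ℝ ∞ (r.momentum ℓ G) := by
  refine contDiff_iff_contDiffAt.2 fun t => ?_
  have hφ : chartAt F (r.n t) ∈ IsManifold.maximalAtlas 𝓘(ℝ, F) ∞ N :=
    IsManifold.chart_mem_maximalAtlas _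
  have ht : r.n t ∈ (chartAt F (r.n t)).source := mem_chart_source F _
  have hev : r.momentum ℓ G =ᶠ[𝓝 t] fun s => fderiv ℝ (fun w => localLagrangian ℓ
      (chartAt F (r.n t)) w (r.localN (chartAt F (r.n t)) s)
      (r.localNu (chartAt F (r.n t)) s)) (r.u s) - r.localDNu ℓ (chartAt F (r.n t)) s ∘L
        localAct G (chartAt F (r.n t)) (r.localN (chartAt F (r.n t)) s) := by
    filter_upwards [(contMDiff_n hr).continuous.continuousAt.preimage_mem_nhds
      ((chartAt F (r.n t)).open_source.mem_nhds ht)] with s hs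
    exact momentum_eq_local hφ hℓ hs
  refine ContDiffAt.congr_of_eventuallyEq ?_ hev
  obtain ⟨h1, -, h3⟩ := contDiffAt_local_partials hφ hℓ hr ht
  refine h1.sub (h3.clm_comp ?_)
  exact (contDiffAt_localAct (E := E) (G := G) hφ (φ := chartAt F (r.n t))
    ((chartAt F (r.n t)).map_source ht)).comp t (contDiffAt_localN hφ hr ht)

end ReducedCurve

omit [IsManifold 𝓘(ℝ, F) ∞ N] [LieGroup 𝓘(ℝ, E) ∞ G] [ContMDiffSMul 𝓘(ℝ, E) 𝓘(ℝ, F) ∞ G N] in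
theorem fderiv_localInfAct {x : F} (hA : DifferentiableAt ℝ (localAct (E := E) G φ) x) (u : E)
    (w : F) : fderiv ℝ (localInfAct G φ u) x w = fderiv ℝ (localAct G φ) x w u := by
  have h : HasFDerivAt (fun y => localAct (E := E) G φ y u) _ x :=
    hA.hasFDerivAt.clm_apply (hasFDerivAt_const u x)
  have h2 : fderiv ℝ (localInfAct G φ u) x = _ := h.fderiv
  rw [h2]
  simp

/-- Makes the coordinate lemmas about families available for a single curve. -/
theorem PontryaginCurve.IsSmooth.const_family {γ : PontryaginCurve E F G N} (hγ : γ.IsSmooth) :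
    IsSmoothFamily (fun _ => γ) where
  u := hγ.reduced.u.comp contDiff_snd
  ν := hγ.reduced.ν.comp (contDiff_snd (𝕜 := ℝ) (E := ℝ) (F := ℝ)).contMDiff
  g := hγ.g.comp (contDiff_snd (𝕜 := ℝ) (E := ℝ) (F := ℝ)).contMDiff
  M := hγ.M.comp contDiff_snd
  σ := hγ.σ.comp (contDiff_snd (𝕜 := ℝ) (E := ℝ) (F := ℝ)).contMDiff

theorem IsSmoothFamily.isSmooth {c : ℝ → PontryaginCurve E F G N} (hc : IsSmoothFamily c) (s : ℝ) :
    (c s).IsSmooth where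
  reduced :=
    { u := hc.u.comp (contDiff_prodMk_right s)
      ν := hc.ν.comp (contDiff_prodMk_right s).contMDiff }
  g := hc.g.comp (contDiff_prodMk_right s).contMDiff
  M := hc.M.comp (contDiff_prodMk_right s)
  σ := hc.σ.comp (contDiff_prodMk_right s).contMDiff

end Equations

/-! ### The Euler–Poincaré equations imply stationarity. -/

section Sufficiency

variable {E : Type*} [NormedAddCommGroup E] [NormedSpace ℝ E]
  {F : Type*} [NormedAddCommGroup F] [NormedSpace ℝ F]
  {G : Type*} [TopologicalSpace G] [ChartedSpace E G] [Group G]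
  {N : Type*} [TopologicalSpace N] [ChartedSpace F N]
  [MulAction G N] [IsManifold 𝓘(ℝ, F) ∞ N] [LieGroup 𝓘(ℝ, E) ∞ G]
  [ContMDiffSMul 𝓘(ℝ, E) 𝓘(ℝ, F) ∞ G N]
  {φ : OpenPartialHomeomorph N F}
  {ℓ : E → TangentBundle 𝓘(ℝ, F) N → ℝ}
  {c : ℝ → PontryaginCurve E F G N}

theorem chartD_velocity_left (hc : IsSmoothFamily c)
    (hφ : φ ∈ IsManifold.maximalAtlas 𝓘(ℝ, F) ∞ N) {q : ℝ × ℝ} (hq : (c q.1).n q.2 ∈ φ.source) :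
    chartD φ ((c q.1).n q.2) (velocity (fun s => (c s).n q.2) q.1) =
      fderiv ℝ (famX c φ) q (1, 0) := by
  have h1 : ContMDiff 𝓘(ℝ, ℝ) 𝓘(ℝ, F) ∞ (fun s => (c s).n q.2) :=
    (contMDiff_fam_n hc).comp (f := fun s : ℝ => (s, q.2))
      (ContDiff.contMDiff (by fun_prop))
  have h2 := (hasFDerivAt_chart_comp hφ (h1.mdifferentiableAt (x := q.1) (by simp))
    hq).hasDerivAt
  exact h2.unique (hasDerivAt_line_left ((contDiffAt_famX hc hφ hq).differentiableAt (by simp)))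

theorem velocity_eq_zero_of_const {H : Type*} [NormedAddCommGroup H] [NormedSpace ℝ H]
    {X : Type*} [TopologicalSpace X] [ChartedSpace H X] {f : ℝ → X} {x : X} (hf : ∀ s, f s = x)
    (a : ℝ) : (velocity (F := H) f a : H) = 0 := by
  obtain rfl : f = fun _ => x := funext hf
  exact DFunLike.congr_fun (mfderiv_const (I := 𝓘(ℝ, ℝ)) (I' := 𝓘(ℝ, H)) (c := x) (x := a)) (1 : ℝ)

omit [IsManifold 𝓘(ℝ, F) ∞ N] in
theorem rightVelocity_eq_zero_of_const {f : ℝ → G} {x : G} (hf : ∀ s, f s = x)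
    (a : ℝ) : (rightVelocity (E := E) f a : E) = 0 := by
  rw [rightVelocity]
  exact (congrArg (mfderiv 𝓘(ℝ, E) 𝓘(ℝ, E) (fun h : G => h * (f a)⁻¹) (f a) : E →L[ℝ] E)
    (velocity_eq_zero_of_const hf a)).trans (map_zero _)

variable (c) in
/-- The boundary term of the first variation, `⟨M, δg g⁻¹⟩ + ⟨σ, δn⟩`. -/
def boundaryTerm (t : ℝ) : ℝ :=
  (c 0).M t (famEta c (0, t)) + ((c 0).σ t : F →L[ℝ] ℝ) (velocity (fun s => (c s).n t) 0)

theorem boundaryTerm_eq_local (hc : IsSmoothFamily c)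
    (hφ : φ ∈ IsManifold.maximalAtlas 𝓘(ℝ, F) ∞ N) {t : ℝ} (ht : (c 0).n t ∈ φ.source) :
    boundaryTerm c t = (c 0).M t (famEta c (0, t)) +
      famP c φ (0, t) (fderiv ℝ (famX c φ) (0, t) (1, 0)) := by
  rw [boundaryTerm, ← chartD_velocity_left hc hφ (q := (0, t)) ht]
  exact congrArg (fun w : F => (c 0).M t (famEta c (0, t)) + ((c 0).σ t : F →L[ℝ] ℝ) w)
    (chartDSymm_chartD hφ ht _).symm

theorem eventually_mem_source (hc : IsSmoothFamily c) {t : ℝ} (ht : (c 0).n t ∈ φ.source) :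
    ∀ᶠ s in 𝓝 t, (c 0).n s ∈ φ.source :=
  (Continuous.tendsto' (f := fun s : ℝ => ((0 : ℝ), s)) (by fun_prop) t (0, t) rfl).eventually
    ((isOpen_fam_source hc).mem_nhds ht)

/-- `M'` and `P'` are left free so that the values dictated by the Euler–Poincaré equations can be
inserted. -/
theorem hasDerivAt_boundaryTerm (hc : IsSmoothFamily c)
    (hφ : φ ∈ IsManifold.maximalAtlas 𝓘(ℝ, F) ∞ N) {t : ℝ} (ht : (c 0).n t ∈ φ.source)
    {M' : E →L[ℝ] ℝ} {P' : F →L[ℝ] ℝ} (hM : HasDerivAt (c 0).M M' t)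
    (hP : HasDerivAt (fun s => famP c φ (0, s)) P' t) :
    HasDerivAt (boundaryTerm c)
      (M' (famEta c (0, t)) + (c 0).M t (fderiv ℝ (famEta c) (0, t) (0, 1)) +
        (P' (fderiv ℝ (famX c φ) (0, t) (1, 0)) +
        famP c φ (0, t) (fderiv ℝ (fun r => fderiv ℝ (famX c φ) r (1, 0)) (0, t) (0, 1)))) t := by
  have h1 : HasDerivAt (fun s => famEta c (0, s)) (fderiv ℝ (famEta c) (0, t) (0, 1)) t :=
    hasDerivAt_line_right (q := (0, t))
      ((contDiff_famEta hc).contDiffAt.differentiableAt (by simp))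
  have hx := contDiffAt_famX hc hφ (q := (0, t)) ht
  have h2 : HasDerivAt (fun s => fderiv ℝ (famX c φ) (0, s) (1, 0))
      (fderiv ℝ (fun r => fderiv ℝ (famX c φ) r (1, 0)) (0, t) (0, 1)) t :=
    hasDerivAt_line_right (q := (0, t)) (f := fun r => fderiv ℝ (famX c φ) r (1, 0))
      (((hx.fderiv_right (m := ∞) (by simp)).clm_apply contDiffAt_const).differentiableAt
        (by simp))
  refine ((hM.clm_apply h1).add (hP.clm_apply h2)).congr_of_eventuallyEq ?_
  filter_upwards [eventually_mem_source hc ht] with s hs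
  exact boundaryTerm_eq_local hc hφ hs

theorem continuous_boundaryTerm (hc : IsSmoothFamily c) : Continuous (boundaryTerm c) := by
  refine continuous_iff_continuousAt.2 fun t => ?_
  have hφ : chartAt F ((c 0).n t) ∈ IsManifold.maximalAtlas 𝓘(ℝ, F) ∞ N :=
    IsManifold.chart_mem_maximalAtlas _
  have ht : (c 0).n t ∈ (chartAt F ((c 0).n t)).source := mem_chart_source F _
  have hP : DifferentiableAt ℝ (famP c (chartAt F ((c 0).n t))) (0, t) :=
    (contDiffAt_famP hc hφ (q := (0, t)) ht).differentiableAt (by simp)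
  exact (hasDerivAt_boundaryTerm hc hφ ht
    (((hc.isSmooth 0).M.differentiable (by simp)) t).hasDerivAt
    (hasDerivAt_line_right (q := (0, t)) hP)).continuousAt

variable
  (hℓ : ContMDiff (𝓘(ℝ, E).prod 𝓘(ℝ, F).tangent) 𝓘(ℝ, ℝ) ∞
      (fun p : E × TangentBundle 𝓘(ℝ, F) N => ℓ p.1 p.2))
include hℓ

/-- The relations cancel every term of the first variation except those in `η` and `δn`, and (EP)
completes these to a product rule. The time is interior because the relations are known only on `[0,
1]` and must be differentiated. -/
theorem hasDerivAt_boundaryTerm_of_eulerPoincare (hc : IsSmoothFamily c)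
    (hpos : ∀ t ∈ Icc (0 : ℝ) 1,
      (c 0).M t = dU ℓ ((c 0).u t) ((c 0).n t) ((c 0).ν t) + diamond G ((c 0).σ t) ∧
      (c 0).σ t = dNu ℓ ((c 0).u t) ((c 0).n t) ((c 0).ν t) ∧ rightVelocity (c 0).g t = (c 0).u t)
    (hEP : (c 0).toReducedCurve.EulerPoincare ℓ G) {t : ℝ} (ht : t ∈ Ioo (0 : ℝ) 1) :
    HasDerivAt (boundaryTerm c) (deriv (fun s => integrand ℓ (c s) t) 0) t := by
  set φ := chartAt F ((c 0).n t) with hφdef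
  have hφ : φ ∈ IsManifold.maximalAtlas 𝓘(ℝ, F) ∞ N := IsManifold.chart_mem_maximalAtlas _
  have hs : (c 0).n t ∈ φ.source := mem_chart_source F _
  set r := (c 0).toReducedCurve with hr
  have htI := Ioo_subset_Icc_self ht
  have hmom : ∀ s ∈ Icc (0 : ℝ) 1, (c 0).M s = r.momentum ℓ G s := fun s hs => by
    rw [(hpos s hs).1, ReducedCurve.momentum, (hpos s hs).2.1]
  have hM : HasDerivAt (c 0).M (deriv (r.momentum ℓ G) t) t := by
    refine (hEP.differentiableAt t htI).hasDerivAt.congr_of_eventuallyEq ?_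
    filter_upwards [isOpen_Ioo.mem_nhds ht] with s hs using hmom s (Ioo_subset_Icc_self hs)
  obtain ⟨hPd, hPe⟩ := hEP.template φ hφ t htI hs
  have hPeq : ∀ s ∈ Icc (0 : ℝ) 1, (c 0).n s ∈ φ.source → famP c φ (0, s) = r.localDNu ℓ φ s :=
    fun s hs hs' => (eq_dNuModel_iff_local hφ hℓ hs' _ _ _).1 (hpos s hs).2.1
  have hP : HasDerivAt (fun s => famP c φ (0, s)) (deriv (r.localDNu ℓ φ) t) t := by
    refine hPd.hasDerivAt.congr_of_eventuallyEq ?_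
    filter_upwards [isOpen_Ioo.mem_nhds ht, eventually_mem_source hc hs] with s hs hs'
      using hPeq s (Ioo_subset_Icc_self hs) hs'
  have hq : (c ((0 : ℝ), t).1).n ((0 : ℝ), t).2 ∈ φ.source := hs
  have hvar := (hasDerivAt_integrand_fam hc hφ hℓ hq
    (hasDerivAt_line_left (q := (0, t)) (hc.u.contDiffAt.differentiableAt (by simp)))
    (hasDerivAt_line_left (q := (0, t)) (hc.M.contDiffAt.differentiableAt (by simp)))
    (hasDerivAt_line_left (q := (0, t)) ((contDiffAt_famV hc hφ hq).differentiableAt (by simp)))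
    (hasDerivAt_line_left (q := (0, t))
      ((contDiffAt_famP hc hφ hq).differentiableAt (by simp)))).deriv
  refine (hasDerivAt_boundaryTerm hc hφ hs hM hP).congr_deriv ?_
  refine Eq.trans ?_ hvar.symm
  have e1 : famXi c (0, t) = r.u t := (rightVelocity_fam hc 0 t).symm.trans (hpos t htI).2.2
  have e2 : fderiv ℝ (famX c φ) (0, t) (0, 1) - famV c φ (0, t) -
      localAct (E := E) G φ (famX c φ (0, t)) (r.u t) = 0 := by
    have h := (velocity_eq_iff_local (G := G) hφ hs (velocity (c 0).n t) ((c 0).ν t) (r.u t)).1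
      (hEP.auxiliary t htI)
    have h' := (chartD_velocity hc hφ hq).symm.trans h
    rw [h']
    simp only [famV, famX]
    abel
  have e3 := hEP.coadjoint t htI (famEta c (0, t))
  have e4 : (c 0).M t = fderiv ℝ (fun w => localLagrangian ℓ φ w (famX c φ (0, t))
      (famV c φ (0, t))) (r.u t) - famP c φ (0, t) ∘L localAct G φ (famX c φ (0, t)) :=
    (hpos t htI).1.trans (dU_add_diamond_eq_local (G := G) hφ hℓ hs (r.u t) (r.ν t) ((c 0).σ t))
  have e5 : famP c φ (0, t) = fderiv ℝ (fun w => localLagrangian ℓ φ (r.u t) (famX c φ (0, t)) w)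
      (famV c φ (0, t)) := hPeq t htI hs
  have hA : DifferentiableAt ℝ (localAct (E := E) G φ) (famX c φ (0, t)) :=
    (contDiffAt_localAct hφ (φ.map_source hs)).differentiableAt (by simp)
  have e6 : deriv (r.localDNu ℓ φ) t (fderiv ℝ (famX c φ) (0, t) (1, 0)) =
      fderiv ℝ (fun y => localLagrangian ℓ φ (r.u t) y (famV c φ (0, t))) (famX c φ (0, t))
        (fderiv ℝ (famX c φ) (0, t) (1, 0)) - famP c φ (0, t) (fderiv ℝ (localAct G φ)
          (famX c φ (0, t)) (fderiv ℝ (famX c φ) (0, t) (1, 0)) (r.u t)) := by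
    have h1 : deriv (r.localDNu ℓ φ) t = r.localDN ℓ φ t -
      localStar G φ (r.u t) (r.localN φ t) (r.localDNu ℓ φ t) := by
      rw [eq_sub_iff_add_eq, ← sub_eq_zero, hPe]
    rw [h1, ← fderiv_localInfAct hA, hPeq t htI hs]
    rfl
  -- The sign: `ṁ(η) = -m([u, η]) = m([η, u])`, which is the bracket term of `δξ` at `ξ = u`.
  have e7 : deriv (r.momentum ℓ G) t (famEta c (0, t)) =
      (c 0).M t (lieE G (famEta c (0, t)) (r.u t)) := by
    rw [lieE_swap, map_neg, hmom t htI]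
    exact eq_neg_of_add_eq_zero_left e3
  have e8 := DFunLike.congr_fun e4
  simp only [sub_apply, ContinuousLinearMap.comp_apply] at e8
  have e9 := DFunLike.congr_fun e5
  rw [e6, e7]
  -- `e1` and `e2` are the constraints and remove `δM` and `δσ`; below, `e9` removes `δν` and `e8`
  -- removes `δu`.
  simp only [← hr, e1, e2, sub_self, map_zero]
  simp only [map_sub, map_add, ← e9]
  rw [e8 (fderiv ℝ (fun q : ℝ × ℝ => (c q.1).u q.2) (0, t) (1, 0))]
  ring

/-- A curve that satisfies the momentum relations, the reconstruction equation and the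
Euler–Poincaré equations is stationary. -/
theorem isStationary_of_eulerPoincare {γ : PontryaginCurve E F G N}
    (hpos : ∀ t ∈ Icc (0 : ℝ) 1,
      γ.M t = dU ℓ (γ.u t) (γ.n t) (γ.ν t) + diamond G (γ.σ t) ∧
      γ.σ t = dNu ℓ (γ.u t) (γ.n t) (γ.ν t) ∧ rightVelocity γ.g t = γ.u t)
    (hEP : γ.toReducedCurve.EulerPoincare ℓ G) : IsStationary ℓ γ := by
  rintro c ⟨hc, rfl, hg0, hg1, hn0, hn1⟩
  have hder := hasDerivAt_action_fam hc hℓ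
  have hcont : Continuous fun t => deriv (fun s => integrand ℓ (c s) t) 0 := by
    have hI := contDiff_integrand_fam hc hℓ
    have : (fun t => deriv (fun s => integrand ℓ (c s) t) 0) =
        fun t => fderiv ℝ (fun q : ℝ × ℝ => integrand ℓ (c q.1) q.2) (0, t) (1, 0) := by
      funext t
      exact (hasDerivAt_line_left (q := (0, t)) (hI.contDiffAt.differentiableAt (by simp))).deriv
    rw [this]
    exact ((hI.continuous_fderiv (by simp)).comp (by fun_prop)).clm_apply continuous_const
  -- This form of the fundamental theorem asks for the derivative only on the open interval, plus
  -- continuity on the closed one.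
  have hFTC := intervalIntegral.integral_eq_sub_of_hasDerivAt_of_le zero_le_one
    (continuous_boundaryTerm hc).continuousOn
    (fun t ht => hasDerivAt_boundaryTerm_of_eulerPoincare hℓ hc hpos hEP ht)
    (hcont.intervalIntegrable _ _)
  -- At a time where `g` and `n` are held fixed, both `η` and `δn` vanish.
  have hB : ∀ t, (∀ s, (c s).g t = (c 0).g t) → (∀ s, (c s).n t = (c 0).n t) →
      boundaryTerm c t = 0 := by
    intro t hg hn
    rw [boundaryTerm, ← rightVelocity_fam_left hc, rightVelocity_eq_zero_of_const hg, map_zero,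
      zero_add]
    exact (congrArg ((c 0).σ t : F →L[ℝ] ℝ) (velocity_eq_zero_of_const hn 0)).trans (map_zero _)
  rw [hB 1 hg1 hn1, hB 0 hg0 hn0, sub_zero] at hFTC
  exact hder.congr_deriv hFTC

end Sufficiency

/-! ### The fundamental lemma of the calculus of variations. -/

section FundamentalLemma

/-- Outside `K` the factor `χ` vanishes on a neighbourhood, so the behaviour of `f` there does not
matter. -/
theorem continuous_mul_of_tsupport_subset {χ f : ℝ → ℝ} {K : Set ℝ} (hK : IsOpen K)
    (hχ : Continuous χ) (hsupp : tsupport χ ⊆ K) (hf : ContinuousOn f K) :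
    Continuous fun t => χ t * f t := by
  refine continuous_iff_continuousAt.2 fun t => ?_
  by_cases ht : t ∈ K
  · exact hχ.continuousAt.mul (hf.continuousAt (hK.mem_nhds ht))
  · have h0 : (fun s => χ s * f s) =ᶠ[𝓝 t] fun _ => 0 := by
      filter_upwards [notMem_tsupport_iff_eventuallyEq.1 fun h => ht (hsupp h)] with s hs
      simp [hs]
    exact continuousAt_const.congr h0.symm

theorem integral_eq_intervalIntegral_of_tsupport_subset {f : ℝ → ℝ}
    (hf : ∀ t, t ∉ Ioo (0 : ℝ) 1 → f t = 0) : ∫ t, f t = ∫ t in (0 : ℝ)..1, f t := by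
  rw [intervalIntegral.integral_of_le zero_le_one]
  refine (setIntegral_eq_integral_of_forall_compl_eq_zero fun t ht => hf t fun h => ht ?_).symm
  exact Ioo_subset_Ioc_self h

/-- The fundamental lemma of the calculus of variations, in du Bois-Reymond form. -/
theorem eq_deriv_of_forall_integral_eq_zero {K : Set ℝ} (hK : IsOpen K) (hK1 : K ⊆ Ioo 0 1)
    {f h : ℝ → ℝ} (hf : ContinuousOn f K) (hh : ∀ t ∈ K, ContDiffAt ℝ ∞ h t)
    (hint : ∀ χ : ℝ → ℝ, ContDiff ℝ ∞ χ → HasCompactSupport χ → tsupport χ ⊆ K →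
      ∫ t in (0 : ℝ)..1, (χ t * f t + deriv χ t * h t) = 0) {t : ℝ} (ht : t ∈ K) :
    f t = deriv h t := by
  have hh0 : ContinuousOn h K := fun s hs => (hh s hs).continuousAt.continuousWithinAt
  have hh1 : ContinuousOn (deriv h) K := fun s hs => by
    have : ContDiffAt ℝ ∞ (fun s => fderiv ℝ h s 1) s :=
      ((hh s hs).fderiv_right (m := ∞) (by simp)).clm_apply contDiffAt_const
    exact this.continuousAt.continuousWithinAt
  have hc : ContinuousOn (fun t => f t - deriv h t) K := hf.sub hh1
  -- Test functions detect `f - h'` only almost everywhere; continuity on the open set `K` upgrades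
  -- this to every point.
  have hae := IsOpen.ae_eq_zero_of_integral_contDiff_smul_eq_zero (μ := volume) hK
    (hc.locallyIntegrableOn hK.measurableSet) ?_
  · have heq : EqOn (fun t => f t - deriv h t) (fun _ => 0) K := by
      refine Measure.eqOn_open_of_ae_eq (μ := volume) ?_ hK hc continuousOn_const
      exact (ae_restrict_iff' hK.measurableSet).2 hae
    exact sub_eq_zero.1 (heq ht)
  · intro χ hχ hχc hsupp
    have hχ' : tsupport (deriv χ) ⊆ K := (tsupport_deriv_subset (𝕜 := ℝ)).trans hsupp
    have hχd : Continuous (deriv χ) := hχ.continuous_deriv (by simp)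
    have c1 := continuous_mul_of_tsupport_subset hK hχ.continuous hsupp hf
    have c2 := continuous_mul_of_tsupport_subset hK hχd hχ' hh0
    have c3 := continuous_mul_of_tsupport_subset hK hχ.continuous hsupp hh1
    have hd : ∀ t, HasDerivAt (fun t => χ t * h t) (deriv χ t * h t + χ t * deriv h t) t := by
      intro t
      by_cases ht : t ∈ K
      · exact ((hχ.differentiable (by simp)) t).hasDerivAt.mul
          ((hh t ht).differentiableAt (by simp)).hasDerivAt
      · have h0 := notMem_tsupport_iff_eventuallyEq.1 fun h => ht (hsupp h)
        have h1 : (fun s => χ s * h s) =ᶠ[𝓝 t] fun _ => 0 := by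
          filter_upwards [h0] with s hs
          simp [hs]
        have h2 : deriv χ t = 0 := by rw [h0.deriv_eq]; exact deriv_const t 0
        have h3 : χ t = 0 := h0.eq_of_nhds
        simpa [h2, h3] using (hasDerivAt_const t (0 : ℝ)).congr_of_eventuallyEq h1
    -- Integration by parts; `χ` vanishes at `0` and `1` because its support lies in `K ⊆ (0, 1)`.
    have hFTC : ∫ t in (0 : ℝ)..1, (deriv χ t * h t + χ t * deriv h t) = 0 := by
      rw [intervalIntegral.integral_eq_sub_of_hasDerivAt (fun t _ => hd t)
        ((c2.add c3).intervalIntegrable _ _)]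
      have h0 : χ 0 = 0 := image_eq_zero_of_notMem_tsupport fun h => (hK1 (hsupp h)).1.false
      have h1 : χ 1 = 0 := image_eq_zero_of_notMem_tsupport fun h => (hK1 (hsupp h)).2.false
      simp [h0, h1]
    have hz : ∀ t, t ∉ Ioo (0 : ℝ) 1 → χ t • (f t - deriv h t) = 0 := fun t ht => by
      have h0 : χ t = 0 := image_eq_zero_of_notMem_tsupport fun h => ht (hK1 (hsupp h))
      rw [h0, zero_smul]
    rw [integral_eq_intervalIntegral_of_tsupport_subset hz]
    have h5 : ∫ t in (0 : ℝ)..1, ((χ t * f t + deriv χ t * h t)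
        - (deriv χ t * h t + χ t * deriv h t)) = 0 := by
      rw [intervalIntegral.integral_sub (μ := volume) (a := 0) (b := 1)
        (f := fun t => χ t * f t + deriv χ t * h t)
        (g := fun t => deriv χ t * h t + χ t * deriv h t)
        ((c1.add c2).intervalIntegrable 0 1) ((c2.add c3).intervalIntegrable 0 1),
        hint χ hχ hχc hsupp, hFTC, sub_zero]
    refine Eq.trans ?_ h5
    refine congrArg (fun k : ℝ → ℝ => ∫ t in (0 : ℝ)..1, k t) (funext fun t => ?_)
    simp only [smul_eq_mul]
    ring

end FundamentalLemma

/-! ### The first variation in a direction that is constant in a chart. -/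

section FirstVariation

variable {E : Type*} [NormedAddCommGroup E] [NormedSpace ℝ E]
  {F : Type*} [NormedAddCommGroup F] [NormedSpace ℝ F]
  {G : Type*} [TopologicalSpace G] [ChartedSpace E G] [Group G]
  {N : Type*} [TopologicalSpace N] [ChartedSpace F N]
  [MulAction G N]

/-- The cotangent coordinates of a curve. -/
def PontryaginCurve.localP (γ : PontryaginCurve E F G N) (φ : OpenPartialHomeomorph N F) (t : ℝ) :
    F →L[ℝ] ℝ :=
  (γ.σ t : F →L[ℝ] ℝ) ∘L chartDSymm φ (φ (γ.n t))

/-- The velocity of the base curve in coordinates. -/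
def PontryaginCurve.localVelocity (γ : PontryaginCurve E F G N) (φ : OpenPartialHomeomorph N F)
    (t : ℝ) : F :=
  chartD φ (γ.n t) (velocity γ.n t)

/-- The right velocity of the group component, with values in the model space. -/
def PontryaginCurve.xi (γ : PontryaginCurve E F G N) (t : ℝ) : E := rightVelocity γ.g t

/-- A direction of variation in a chart. -/
structure Direction (E F : Type*) [NormedAddCommGroup E] [NormedSpace ℝ E]
    [NormedAddCommGroup F] [NormedSpace ℝ F] where
  u : E
  M : E →L[ℝ] ℝ
  g : E
  n : F
  ν : F
  σ : F →L[ℝ] ℝ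

/-- The part of the first variation that does not involve the derivative of the test function. -/
def variationForce (ℓ : E → TangentBundle 𝓘(ℝ, F) N → ℝ) (γ : PontryaginCurve E F G N)
    (φ : OpenPartialHomeomorph N F) (d : Direction E F) (t : ℝ) : ℝ :=
  fderiv ℝ (fun w => localLagrangian ℓ φ w (γ.localN φ t) (γ.localNu φ t)) (γ.u t) d.u
    + γ.localDN ℓ φ t d.n + γ.localDNu ℓ φ t d.ν
    + d.M (γ.xi t - γ.u t) + γ.M t (lieE G d.g (γ.xi t) - d.u)
    + d.σ (γ.localVelocity φ t - γ.localNu φ t - localAct G φ (γ.localN φ t) (γ.u t))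
    - γ.localP φ t (d.ν + fderiv ℝ (localAct G φ) (γ.localN φ t) d.n (γ.u t)
        + localAct G φ (γ.localN φ t) d.u)

/-- The momentum of a direction of variation. -/
def variationMomentum (γ : PontryaginCurve E F G N)
    (φ : OpenPartialHomeomorph N F) (d : Direction E F) (t : ℝ) : ℝ :=
  γ.M t d.g + γ.localP φ t d.n

variable [IsManifold 𝓘(ℝ, F) ∞ N] [LieGroup 𝓘(ℝ, E) ∞ G]
  [ContMDiffSMul 𝓘(ℝ, E) 𝓘(ℝ, F) ∞ G N]
  {φ : OpenPartialHomeomorph N F}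
  (hφ : φ ∈ IsManifold.maximalAtlas 𝓘(ℝ, F) ∞ N)
  {ℓ : E → TangentBundle 𝓘(ℝ, F) N → ℝ}
  (hℓ : ContMDiff (𝓘(ℝ, E).prod 𝓘(ℝ, F).tangent) 𝓘(ℝ, ℝ) ∞
      (fun p : E × TangentBundle 𝓘(ℝ, F) N => ℓ p.1 p.2))

-- Only `g` and `n` enter the action through their velocities, so `χ'` multiplies only their
-- components. For the same reason `hg` and `hn` are required near `t`, whereas the other components
-- are prescribed at `t` alone.
include hφ hℓ in
theorem hasDerivAt_integrand_direction {c : ℝ → PontryaginCurve E F G N} (hc : IsSmoothFamily c)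
    {χ : ℝ → ℝ} {t : ℝ} (hχ : DifferentiableAt ℝ χ t) {d : Direction E F}
    (ht : (c 0).n t ∈ φ.source)
    (hu : HasDerivAt (fun s => (c s).u t) (χ t • d.u) 0)
    (hM : HasDerivAt (fun s => (c s).M t) (χ t • d.M) 0)
    (hg : ∀ᶠ s in 𝓝 t, famEta c (0, s) = χ s • d.g)
    (hn : ∀ᶠ s in 𝓝 t, fderiv ℝ (famX c φ) (0, s) (1, 0) = χ s • d.n)
    (hν : HasDerivAt (fun s => famV c φ (s, t)) (χ t • d.ν) 0)
    (hσ : HasDerivAt (fun s => famP c φ (s, t)) (χ t • d.σ) 0) :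
    HasDerivAt (fun s => integrand ℓ (c s) t)
      (χ t * variationForce ℓ (c 0) φ d t + deriv χ t * variationMomentum (c 0) φ d t) 0 := by
  have key := hasDerivAt_integrand_fam hc hφ hℓ (q := (0, t)) ht hu hM hν hσ
  have e1 : fderiv ℝ (famEta c) (0, t) (0, 1) = deriv χ t • d.g := by
    have h1 := hasDerivAt_line_right (q := ((0 : ℝ), t)) (f := famEta c)
      ((contDiff_famEta hc).contDiffAt.differentiableAt (by simp))
    exact h1.unique ((hχ.hasDerivAt.smul_const d.g).congr_of_eventuallyEq hg)
  have hx := contDiffAt_famX hc hφ (q := (0, t)) ht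
  have e2 : fderiv ℝ (fun r => fderiv ℝ (famX c φ) r (1, 0)) (0, t) (0, 1) = deriv χ t • d.n := by
    have h1 := hasDerivAt_line_right (q := (0, t)) (f := fun r => fderiv ℝ (famX c φ) r (1, 0))
      (((hx.fderiv_right (m := ∞) (by simp)).clm_apply contDiffAt_const).differentiableAt
        (by simp))
    exact h1.unique ((hχ.hasDerivAt.smul_const d.n).congr_of_eventuallyEq hn)
  have e3 : famXi c (0, t) = (c 0).xi t := (rightVelocity_fam hc 0 t).symm
  have e4 : fderiv ℝ (famX c φ) (0, t) (0, 1) = (c 0).localVelocity φ t :=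
    (chartD_velocity hc hφ (q := (0, t)) ht).symm
  have e5 : famX c φ (0, t) = (c 0).localN φ t := rfl
  have e6 : famV c φ (0, t) = (c 0).localNu φ t := rfl
  have e7 : famP c φ (0, t) = (c 0).localP φ t := rfl
  have e8 : fderiv ℝ (fun y => localLagrangian ℓ φ ((c 0).u t) y ((c 0).localNu φ t))
      ((c 0).localN φ t) = (c 0).localDN ℓ φ t := rfl
  have e9 : fderiv ℝ (fun w => localLagrangian ℓ φ ((c 0).u t) ((c 0).localN φ t) w)
      ((c 0).localNu φ t) = (c 0).localDNu ℓ φ t := rfl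
  refine key.congr_deriv ?_
  rw [e1, e2, e3, e4, e5, e6, e7, hg.self_of_nhds, hn.self_of_nhds, lieE_smul_left]
  simp only [e8, e9, variationForce, variationMomentum, map_add, map_sub, map_smul, smul_eq_mul,
    smul_apply]
  ring

end FirstVariation

/-! ### Construction of localised variations. -/

section Variation

/-- A bounded smooth function with unit derivative at the origin. -/
def sinScale (δ s : ℝ) : ℝ := δ * Real.sin (s / δ)

/-- Families are indexed by all real `ε`, so a displacement in a chart must stay in the chart for
every `ε`, not just small ones. -/
theorem abs_sinScale_le {δ : ℝ} (hδ : 0 < δ) (s : ℝ) : |sinScale δ s| ≤ δ := by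
  rw [sinScale, abs_mul, abs_of_pos hδ]
  exact mul_le_of_le_one_right hδ.le (Real.abs_sin_le_one _)

theorem sinScale_zero (δ : ℝ) : sinScale δ 0 = 0 := by simp [sinScale]

theorem contDiff_sinScale (δ : ℝ) : ContDiff ℝ ∞ (sinScale δ) :=
  contDiff_const.mul (Real.contDiff_sin.comp (contDiff_id.div_const δ))

theorem hasDerivAt_sinScale {δ : ℝ} (hδ : 0 < δ) : HasDerivAt (sinScale δ) 1 0 := by
  have h := (((hasDerivAt_id (0 : ℝ)).div_const δ).sin).const_mul δ
  refine h.congr_deriv ?_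
  simp
  field_simp

variable {E : Type*} [NormedAddCommGroup E] [NormedSpace ℝ E]
  {F : Type*} [NormedAddCommGroup F] [NormedSpace ℝ F]
  {G : Type*} [TopologicalSpace G] [ChartedSpace E G] [Group G]
  {N : Type*} [TopologicalSpace N] [ChartedSpace F N]

theorem hasDerivAt_const_add_mul_smul {Z : Type*} [NormedAddCommGroup Z] [NormedSpace ℝ Z]
    (a b : Z) (r : ℝ) : HasDerivAt (fun s : ℝ => a + (s * r) • b) (r • b) 0 := by
  simpa using (((hasDerivAt_id (0 : ℝ)).mul_const r).smul_const b).const_add a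

theorem hasDerivAt_const_add_sinScale_smul {Z : Type*} [NormedAddCommGroup Z] [NormedSpace ℝ Z]
    {δ : ℝ} (hδ : 0 < δ) (a b : Z) (r : ℝ) :
    HasDerivAt (fun s : ℝ => a + sinScale δ (s * r) • b) (r • b) 0 := by
  have h0 : HasDerivAt (sinScale δ) 1 (0 * r) := by rw [zero_mul]; exact hasDerivAt_sinScale hδ
  have h := HasDerivAt.comp (h := fun s : ℝ => s * r) (0 : ℝ) h0
    ((hasDerivAt_id (0 : ℝ)).mul_const r)
  simpa using (h.smul_const b).const_add a

/-- There is a uniform scale on which translates of a compact subset of an open set stay inside. -/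
theorem exists_pos_forall_add_smul_mem {Z : Type*} [NormedAddCommGroup Z] [NormedSpace ℝ Z]
    {K U : Set Z} (hK : IsCompact K) (hU : IsOpen U) (hKU : K ⊆ U) (e : Z) :
    ∃ δ > 0, ∀ x ∈ K, ∀ r : ℝ, |r| ≤ δ → x + r • e ∈ U := by
  obtain ⟨η, hη, hsub⟩ := hK.exists_cthickening_subset_open hU hKU
  -- The `+ 1` covers `e = 0`.
  refine ⟨η / (‖e‖ + 1), by positivity, fun x hx r hr => hsub ?_⟩
  refine Metric.mem_cthickening_of_dist_le _ x η K hx ?_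
  rw [dist_eq_norm, add_sub_cancel_left, norm_smul, Real.norm_eq_abs]
  have h1 : 0 < ‖e‖ + 1 := by positivity
  calc |r| * ‖e‖ ≤ η / (‖e‖ + 1) * (‖e‖ + 1) := by gcongr; linarith
    _ = η := div_mul_cancel₀ _ h1.ne'

/-- A curve in the group through the identity. -/
def groupVariation (G : Type*) [TopologicalSpace G] [ChartedSpace E G] [Group G] (δ : ℝ) (e : E)
    (s : ℝ) : G :=
  (chartAt E (1 : G)).symm (localOne E G + sinScale δ s • e)

theorem groupVariation_zero (δ : ℝ) (e : E) : groupVariation G δ e 0 = 1 := by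
  rw [groupVariation, sinScale_zero, zero_smul, add_zero, symm_localOne]

section
variable [LieGroup 𝓘(ℝ, E) ∞ G] {δ : ℝ} (hδ : 0 < δ) {e : E}
  (he : ∀ r : ℝ, |r| ≤ δ → localOne E G + r • e ∈ (chartAt E (1 : G)).target)
include hδ he

theorem contMDiff_groupVariation : ContMDiff 𝓘(ℝ, ℝ) 𝓘(ℝ, E) ∞ (groupVariation G δ e) := fun s =>
  contMDiffAt_chart_symm_comp mem_maximalAtlas_one
    (contDiffAt_const.add ((contDiff_sinScale δ).contDiffAt.smul contDiffAt_const))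
    (he _ (abs_sinScale_le hδ s))

/-- Right division by the base point cancels `h`, so multiplying a curve in `G` on the left by
`groupVariation` prescribes `δg g⁻¹` exactly. -/
theorem rightVelocity_groupVariation (a : ℝ) (h : G) :
    rightVelocity (fun s => groupVariation G δ e (s * a) * h) 0 = a • e := by
  have h1 : ContMDiff 𝓘(ℝ, ℝ) 𝓘(ℝ, E) ∞ (fun s => groupVariation G δ e (s * a) * h) :=
    ((contMDiff_groupVariation hδ he).comp (f := fun s : ℝ => s * a)
      (ContDiff.contMDiff (by fun_prop))).mul contMDiff_const
  rw [rightVelocity_eq_deriv (h1.mdifferentiableAt (by simp))]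
  have h2 : (fun s => chartAt E (1 : G) (groupVariation G δ e (s * a) * h *
      (groupVariation G δ e (0 * a) * h)⁻¹)) =
      fun s => localOne E G + sinScale δ (s * a) • e := by
    funext s
    rw [zero_mul, groupVariation_zero, one_mul, mul_inv_cancel_right]
    exact (chartAt E (1 : G)).right_inv (he _ (abs_sinScale_le hδ _))
  rw [h2]
  exact (hasDerivAt_const_add_sinScale_smul hδ _ _ _).deriv
end

/-- Fibre components are compared in the model space, which avoids transport along the equality of
base points. -/
theorem PontryaginCurve.ext_of_eq {γ γ' : PontryaginCurve E F G N} (hu : γ.u = γ'.u)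
    (hn : ∀ t, γ.n t = γ'.n t) (hν : ∀ t, (γ.ν t : F) = γ'.ν t) (hg : γ.g = γ'.g)
    (hM : γ.M = γ'.M) (hσ : ∀ t, (γ.σ t : F →L[ℝ] ℝ) = γ'.σ t) : γ = γ' := by
  obtain ⟨⟨u, n, ν⟩, g, M, σ⟩ := γ
  obtain ⟨⟨u', n', ν'⟩, g', M', σ'⟩ := γ'
  obtain rfl : n = n' := funext hn
  obtain rfl : ν = ν' := funext hν
  obtain rfl : σ = σ' := funext hσ
  dsimp only at hu hg hM
  subst hu hg hM
  rfl

variable (γ : PontryaginCurve E F G N) (φ : OpenPartialHomeomorph N F) (χ : ℝ → ℝ) (δ : ℝ)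
  (d : Direction E F)

/-- The base coordinates of a variation in a chart. -/
def variationX (q : ℝ × ℝ) : F := φ (γ.n q.2) + sinScale δ (q.1 * χ q.2) • d.n

open Classical in
/-- The variation of a curve in the direction `d` in a chart, localised by `χ`. -/
def chartVariation (ε : ℝ) : PontryaginCurve E F G N where
  -- `u`, `M` and the fibre coordinates of `ν` and `σ` range over whole vector spaces and move
  -- linearly; only `n` and `g` need the bounded scale.
  u t := γ.u t + (ε * χ t) • d.u
  n t := if γ.n t ∈ φ.source then φ.symm (variationX γ φ χ δ d (ε, t)) else γ.n t
  ν t := (if γ.n t ∈ φ.source then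
    chartDSymm φ (variationX γ φ χ δ d (ε, t)) (γ.localNu φ t + (ε * χ t) • d.ν) else γ.ν t : F)
  g t := groupVariation G δ d.g (ε * χ t) * γ.g t
  M t := γ.M t + (ε * χ t) • d.M
  σ t := (if γ.n t ∈ φ.source then (γ.localP φ t + (ε * χ t) • d.σ) ∘L
    chartD φ (φ.symm (variationX γ φ χ δ d (ε, t))) else γ.σ t : F →L[ℝ] ℝ)

variable {γ φ χ δ d}

theorem chartVariation_n_of_mem {t : ℝ} (ht : γ.n t ∈ φ.source) (ε : ℝ) :
    (chartVariation γ φ χ δ d ε).n t = φ.symm (variationX γ φ χ δ d (ε, t)) := if_pos ht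

theorem chartVariation_ν_of_mem {t : ℝ} (ht : γ.n t ∈ φ.source) (ε : ℝ) :
    ((chartVariation γ φ χ δ d ε).ν t : F) = chartDSymm φ (variationX γ φ χ δ d (ε, t))
      (γ.localNu φ t + (ε * χ t) • d.ν) := if_pos ht

theorem chartVariation_σ_of_mem {t : ℝ} (ht : γ.n t ∈ φ.source) (ε : ℝ) :
    ((chartVariation γ φ χ δ d ε).σ t : F →L[ℝ] ℝ) = (γ.localP φ t + (ε * χ t) • d.σ) ∘L
      chartD φ (φ.symm (variationX γ φ χ δ d (ε, t))) := if_pos ht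

theorem variationX_of_mul_eq_zero {ε t : ℝ} (h : ε * χ t = 0) :
    variationX γ φ χ δ d (ε, t) = φ (γ.n t) := by
  simp [variationX, h, sinScale_zero]

/-- Both branches of the definition give back the original curve here. This, with its analogues for
`ν` and `σ`, lets the piecewise family pass through `γ` at `ε = 0` and glue smoothly outside the
support of `χ`. -/
theorem chartVariation_n_of_mul_eq_zero {ε t : ℝ} (h : ε * χ t = 0) :
    (chartVariation γ φ χ δ d ε).n t = γ.n t := by
  by_cases ht : γ.n t ∈ φ.source
  · rw [chartVariation_n_of_mem ht, variationX_of_mul_eq_zero h, φ.left_inv ht]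
  · exact if_neg ht

variable [IsManifold 𝓘(ℝ, F) ∞ N] (hφ : φ ∈ IsManifold.maximalAtlas 𝓘(ℝ, F) ∞ N)

include hφ

theorem chartVariation_ν_of_mul_eq_zero {ε t : ℝ} (h : ε * χ t = 0) :
    ((chartVariation γ φ χ δ d ε).ν t : F) = γ.ν t := by
  by_cases ht : γ.n t ∈ φ.source
  · refine (chartVariation_ν_of_mem ht ε).trans ?_
    rw [variationX_of_mul_eq_zero h, h, zero_smul, add_zero]
    exact chartDSymm_chartD hφ ht _
  · exact if_neg ht

theorem chartVariation_σ_of_mul_eq_zero {ε t : ℝ} (h : ε * χ t = 0) :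
    ((chartVariation γ φ χ δ d ε).σ t : F →L[ℝ] ℝ) = γ.σ t := by
  by_cases ht : γ.n t ∈ φ.source
  · refine (chartVariation_σ_of_mem ht ε).trans ?_
    rw [variationX_of_mul_eq_zero h, h, zero_smul, add_zero, φ.left_inv ht]
    exact comp_chartDSymm_comp_chartD hφ ht _
  · exact if_neg ht

theorem chartVariation_zero : chartVariation γ φ χ δ d 0 = γ := by
  refine PontryaginCurve.ext_of_eq ?_ (fun t => chartVariation_n_of_mul_eq_zero (zero_mul _))
    (fun t => chartVariation_ν_of_mul_eq_zero hφ (zero_mul _)) ?_ ?_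
    (fun t => chartVariation_σ_of_mul_eq_zero hφ (zero_mul _))
  · funext t
    simp [chartVariation]
  · funext t
    simp [chartVariation, groupVariation_zero]
  · funext t
    simp [chartVariation]

variable [LieGroup 𝓘(ℝ, E) ∞ G] [MulAction G N] [ContMDiffSMul 𝓘(ℝ, E) 𝓘(ℝ, F) ∞ G N]
  (hδ : 0 < δ)
  (hg : ∀ r : ℝ, |r| ≤ δ → localOne E G + r • d.g ∈ (chartAt E (1 : G)).target)
  (hγ : γ.IsSmooth) (hχ : ContDiff ℝ ∞ χ) (hsupp : ∀ t ∈ tsupport χ, γ.n t ∈ φ.source)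
  (hX : ∀ ε t, γ.n t ∈ φ.source → variationX γ φ χ δ d (ε, t) ∈ φ.target)

omit [LieGroup 𝓘(ℝ, E) ∞ G] [ContMDiffSMul 𝓘(ℝ, E) 𝓘(ℝ, F) ∞ G N] [MulAction G N] in
include hγ hχ in
theorem contDiffAt_variationX {q : ℝ × ℝ} (hq : γ.n q.2 ∈ φ.source) :
    ContDiffAt ℝ ∞ (variationX γ φ χ δ d) q := by
  have h1 : ContDiffAt ℝ ∞ (fun q : ℝ × ℝ => γ.localN φ q.2) q :=
    (ReducedCurve.contDiffAt_localN hφ hγ.reduced hq).comp q contDiffAt_snd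
  have h2 : ContDiff ℝ ∞ (fun q : ℝ × ℝ => sinScale δ (q.1 * χ q.2)) :=
    (contDiff_sinScale δ).comp (contDiff_fst.mul (hχ.comp contDiff_snd))
  exact h1.add (h2.contDiffAt.smul contDiffAt_const)

omit [LieGroup 𝓘(ℝ, E) ∞ G] [ContMDiffSMul 𝓘(ℝ, E) 𝓘(ℝ, F) ∞ G N] [MulAction G N] hφ in
include hγ in
theorem eventually_mem_source_snd {q : ℝ × ℝ} (hq : γ.n q.2 ∈ φ.source) :
    ∀ᶠ p : ℝ × ℝ in 𝓝 q, γ.n p.2 ∈ φ.source :=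
  ((ReducedCurve.contMDiff_n hγ.reduced).continuous.comp continuous_snd).continuousAt.eventually
    (φ.open_source.mem_nhds hq)

omit hφ in
theorem eventually_eq_zero_snd {q : ℝ × ℝ} (hq : q.2 ∉ tsupport χ) :
    ∀ᶠ p : ℝ × ℝ in 𝓝 q, χ p.2 = 0 :=
  continuous_snd.continuousAt.eventually (notMem_tsupport_iff_eventuallyEq.1 hq)

-- At times with `n` in the chart domain, an open condition, the chart formulas apply. At any other
-- time `χ` vanishes nearby, and `n`, `ν`, `σ` agree there with the constant family.
include hδ hg hγ hχ hsupp hX in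
theorem isSmoothFamily_chartVariation : IsSmoothFamily (chartVariation γ φ χ δ d) where
  u := (hγ.reduced.u.comp contDiff_snd).add
    ((contDiff_fst.mul (hχ.comp contDiff_snd)).smul contDiff_const)
  M := (hγ.M.comp contDiff_snd).add
    ((contDiff_fst.mul (hχ.comp contDiff_snd)).smul contDiff_const)
  g := ((contMDiff_groupVariation hδ hg).comp (f := fun p : ℝ × ℝ => p.1 * χ p.2)
    (contDiff_fst.mul (hχ.comp contDiff_snd)).contMDiff).mul
      (hγ.g.comp (contDiff_snd (𝕜 := ℝ) (E := ℝ) (F := ℝ)).contMDiff)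
  ν := fun q => by
    by_cases hq : γ.n q.2 ∈ φ.source
    · have hv : ContDiffAt ℝ ∞
          (fun p : ℝ × ℝ => γ.localNu φ p.2 + (p.1 * χ p.2) • d.ν) q :=
        ((ReducedCurve.contDiffAt_localNu hφ hγ.reduced hq).comp q contDiffAt_snd).add
          ((contDiff_fst.mul (hχ.comp contDiff_snd)).smul contDiff_const).contDiffAt
      refine (contMDiffAt_tangent_of_coord hφ
        (contDiffAt_variationX hφ hγ hχ (δ := δ) (d := d) hq).contMDiffAt hv.contMDiffAt
        (hX q.1 q.2 hq)).congr_of_eventuallyEq ?_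
      filter_upwards [eventually_mem_source_snd hγ hq] with p hp
      exact tangent_mk_congr (chartVariation_n_of_mem hp p.1) (chartVariation_ν_of_mem hp p.1)
    · refine ((hγ.const_family).ν q).congr_of_eventuallyEq ?_
      filter_upwards [eventually_eq_zero_snd fun h => hq (hsupp _ h)] with p hp
      have h0 : p.1 * χ p.2 = 0 := by rw [hp, mul_zero]
      exact tangent_mk_congr (chartVariation_n_of_mul_eq_zero h0)
        (chartVariation_ν_of_mul_eq_zero hφ h0)
  σ := fun q => by
    by_cases hq : γ.n q.2 ∈ φ.source
    · have hv : ContDiffAt ℝ ∞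
          (fun p : ℝ × ℝ => γ.localP φ p.2 + (p.1 * χ p.2) • d.σ) q :=
        (contDiffAt_famP hγ.const_family hφ (q := q) hq).add
          ((contDiff_fst.mul (hχ.comp contDiff_snd)).smul contDiff_const).contDiffAt
      refine (contMDiffAt_cotangent_of_coord hφ
        (contDiffAt_variationX hφ hγ hχ (δ := δ) (d := d) hq) hv
        (hX q.1 q.2 hq)).congr_of_eventuallyEq ?_
      filter_upwards [eventually_mem_source_snd hγ hq] with p hp
      exact cotangent_mk_congr (chartVariation_n_of_mem hp p.1) (chartVariation_σ_of_mem hp p.1)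
    · refine ((hγ.const_family).σ q).congr_of_eventuallyEq ?_
      filter_upwards [eventually_eq_zero_snd fun h => hq (hsupp _ h)] with p hp
      have h0 : p.1 * χ p.2 = 0 := by rw [hp, mul_zero]
      exact cotangent_mk_congr (chartVariation_n_of_mul_eq_zero h0)
        (chartVariation_σ_of_mul_eq_zero hφ h0)

include hδ hg hγ hχ hsupp hX in
theorem isVariation_chartVariation (h0 : χ 0 = 0) (h1 : χ 1 = 0) :
    IsVariation γ (chartVariation γ φ χ δ d) where
  smooth := isSmoothFamily_chartVariation hφ hδ hg hγ hχ hsupp hX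
  base := chartVariation_zero hφ
  g_zero ε := by simp [chartVariation, h0, groupVariation_zero]
  g_one ε := by simp [chartVariation, h1, groupVariation_zero]
  n_zero ε := chartVariation_n_of_mul_eq_zero (by rw [h0, mul_zero])
  n_one ε := chartVariation_n_of_mul_eq_zero (by rw [h1, mul_zero])

variable {ℓ : E → TangentBundle 𝓘(ℝ, F) N → ℝ}
  (hℓ : ContMDiff (𝓘(ℝ, E).prod 𝓘(ℝ, F).tangent) 𝓘(ℝ, ℝ) ∞
      (fun p : E × TangentBundle 𝓘(ℝ, F) N => ℓ p.1 p.2))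

include hδ hg hγ hχ hsupp hX hℓ in
theorem hasDerivAt_integrand_chartVariation (t : ℝ) :
    HasDerivAt (fun s => integrand ℓ (chartVariation γ φ χ δ d s) t)
      (χ t * variationForce ℓ γ φ d t + deriv χ t * variationMomentum γ φ d t) 0 := by
  have hc := isSmoothFamily_chartVariation hφ hδ hg hγ hχ hsupp hX
  have hbase : chartVariation γ φ χ δ d 0 = γ := chartVariation_zero hφ
  have hη : ∀ s, famEta (chartVariation γ φ χ δ d) (0, s) = χ s • d.g := fun s =>
    (rightVelocity_fam_left hc 0 s).symm.trans (rightVelocity_groupVariation hδ hg (χ s) (γ.g s))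
  have hu := hasDerivAt_const_add_mul_smul (γ.u t) d.u (χ t)
  have hM := hasDerivAt_const_add_mul_smul (γ.M t) d.M (χ t)
  by_cases ht : γ.n t ∈ φ.source
  · have hmem : ∀ s, (chartVariation γ φ χ δ d s).n t ∈ φ.source := fun s => by
      rw [chartVariation_n_of_mem ht]
      exact φ.map_target (hX s t ht)
    have key := hasDerivAt_integrand_direction hφ hℓ hc (t := t) (d := d)
      (hχ.differentiable (by simp) t) (hmem 0) hu hM (Filter.Eventually.of_forall hη) ?_ ?_ ?_
    · rwa [hbase] at key
    · have hev : ∀ᶠ s in 𝓝 t, γ.n s ∈ φ.source :=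
        (ReducedCurve.contMDiff_n hγ.reduced).continuous.continuousAt.eventually
          (φ.open_source.mem_nhds ht)
      filter_upwards [hev] with s hs
      have h1 := hasDerivAt_line_left (q := ((0 : ℝ), s)) ((contDiffAt_famX hc hφ (q := (0, s))
        (by rw [hbase]; exact hs)).differentiableAt (by simp))
      refine h1.unique ?_
      have h2 : (fun a => famX (chartVariation γ φ χ δ d) φ (a, s)) =
          fun a => φ (γ.n s) + sinScale δ (a * χ s) • d.n := by
        funext a
        rw [famX, chartVariation_n_of_mem hs]
        exact φ.right_inv (hX a s hs)
      rw [h2]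
      exact hasDerivAt_const_add_sinScale_smul hδ _ _ _
    · have h2 : (fun s => famV (chartVariation γ φ χ δ d) φ (s, t)) =
          fun s => γ.localNu φ t + (s * χ t) • d.ν := by
        funext s
        rw [famV, chartVariation_n_of_mem ht]
        exact (congrArg _ (chartVariation_ν_of_mem ht s)).trans
          (chartD_chartDSymm hφ (hX s t ht) _)
      rw [h2]
      exact hasDerivAt_const_add_mul_smul _ _ _
    · have h2 : (fun s => famP (chartVariation γ φ χ δ d) φ (s, t)) =
          fun s => γ.localP φ t + (s * χ t) • d.σ := by
        funext s
        have h3 : famP (chartVariation γ φ χ δ d) φ (s, t) =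
            ((γ.localP φ t + (s * χ t) • d.σ) ∘L
              chartD φ (φ.symm (variationX γ φ χ δ d (s, t)))) ∘L
              chartDSymm φ (φ (φ.symm (variationX γ φ χ δ d (s, t)))) := by
          rw [famP, chartVariation_n_of_mem ht]
          exact congrArg (fun T : F →L[ℝ] ℝ => T ∘L _) (chartVariation_σ_of_mem ht s)
        rw [h3]
        exact comp_chartD_comp_chartDSymm_self hφ (φ.map_target (hX s t ht)) _
      rw [h2]
      exact hasDerivAt_const_add_mul_smul _ _ _
  · have hts : t ∉ tsupport χ := fun h => ht (hsupp t h)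
    have hev : ∀ᶠ s in 𝓝 t, χ s = 0 := notMem_tsupport_iff_eventuallyEq.1 hts
    have h0 : χ t = 0 := hev.self_of_nhds
    have h1 : deriv χ t = 0 := by
      rw [Filter.EventuallyEq.deriv_eq (f := fun _ => (0 : ℝ)) hev]
      exact deriv_const t 0
    -- Here `γ.n t` is outside the domain of `φ`, so another chart is used, with the `n`, `ν`, `σ`
    -- components of the direction set to zero. As `χ` and `χ'` vanish at `t`, both formulas give
    -- zero.
    set ψ := chartAt F (γ.n t) with hψ
    have hψm : ψ ∈ IsManifold.maximalAtlas 𝓘(ℝ, F) ∞ N := IsManifold.chart_mem_maximalAtlas _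
    have hz : ∀ s, s * χ t = 0 := fun s => by rw [h0, mul_zero]
    have key := hasDerivAt_integrand_direction hψm hℓ hc (t := t)
      (d := ⟨d.u, d.M, d.g, 0, 0, 0⟩)
      (hχ.differentiable (by simp) t) (by rw [hbase]; exact mem_chart_source F _) hu hM
      (Filter.Eventually.of_forall hη) ?_ ?_ ?_
    · simpa only [h0, h1, zero_mul] using key
    · have hev' : ∀ᶠ s in 𝓝 t, γ.n s ∈ ψ.source :=
        (ReducedCurve.contMDiff_n hγ.reduced).continuous.continuousAt.eventually
          (ψ.open_source.mem_nhds (mem_chart_source F _))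
      filter_upwards [hev, hev'] with s hs hs'
      have h1 := hasDerivAt_line_left (q := ((0 : ℝ), s)) ((contDiffAt_famX hc hψm (q := (0, s))
        (by rw [hbase]; exact hs')).differentiableAt (by simp))
      refine h1.unique ?_
      have h2 : (fun a => famX (chartVariation γ φ χ δ d) ψ (a, s)) = fun _ => ψ (γ.n s) := by
        funext a
        rw [famX, chartVariation_n_of_mul_eq_zero (by rw [hs, mul_zero])]
      rw [h2, smul_zero]
      exact hasDerivAt_const _ _
    · have h2 : (fun s => famV (chartVariation γ φ χ δ d) ψ (s, t)) =
          fun s => γ.localNu ψ t := by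
        funext s
        rw [famV, chartVariation_n_of_mul_eq_zero (hz s)]
        exact congrArg _ (chartVariation_ν_of_mul_eq_zero hφ (hz s))
      rw [h2, smul_zero]
      exact hasDerivAt_const _ _
    · have h2 : (fun s => famP (chartVariation γ φ χ δ d) ψ (s, t)) =
          fun s => γ.localP ψ t := by
        funext s
        rw [famP, chartVariation_n_of_mul_eq_zero (hz s)]
        exact congrArg (fun T : F →L[ℝ] ℝ => T ∘L _) (chartVariation_σ_of_mul_eq_zero hφ (hz s))
      rw [h2, smul_zero]
      exact hasDerivAt_const _ _

end Variation

/-! ### Stationarity implies the Euler–Poincaré equations. -/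

section Necessity

theorem mem_closure_Ioo_zero_one {t : ℝ} (ht : t ∈ Icc (0 : ℝ) 1) : t ∈ closure (Ioo (0 : ℝ) 1) := by
  rwa [closure_Ioo zero_ne_one]

/-- An identity between continuous functions extends from `(0, 1)` to `[0, 1]`. -/
theorem eq_of_eventually_eq_Ioo {Z : Type*} [TopologicalSpace Z] [T2Space Z] {f g : ℝ → Z} {t : ℝ}
    (ht : t ∈ Icc (0 : ℝ) 1) (hf : ContinuousAt f t) (hg : ContinuousAt g t)
    (h : ∀ᶠ s in 𝓝 t, s ∈ Ioo (0 : ℝ) 1 → f s = g s) : f t = g t := by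
  have : (𝓝[Ioo (0 : ℝ) 1] t).NeBot := mem_closure_iff_nhdsWithin_neBot.1
    (mem_closure_Ioo_zero_one ht)
  have h' : f =ᶠ[𝓝[Ioo (0 : ℝ) 1] t] g := eventually_nhdsWithin_iff.2 h
  exact tendsto_nhds_unique (hf.mono_left nhdsWithin_le_nhds)
    ((hg.mono_left nhdsWithin_le_nhds).congr' h'.symm)

/-- `[0, 1]` has unique derivatives also at its endpoints, so one-sided agreement of two
differentiable functions suffices. -/
theorem deriv_eq_of_eventually_eq_Icc {Z : Type*} [NormedAddCommGroup Z] [NormedSpace ℝ Z]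
    {f g : ℝ → Z} {t : ℝ} (ht : t ∈ Icc (0 : ℝ) 1) (hf : DifferentiableAt ℝ f t)
    (hg : DifferentiableAt ℝ g t) (h : ∀ᶠ s in 𝓝 t, s ∈ Icc (0 : ℝ) 1 → f s = g s) :
    deriv f t = deriv g t := by
  have h' : f =ᶠ[𝓝[Icc (0 : ℝ) 1] t] g := eventually_nhdsWithin_iff.2 h
  exact (uniqueDiffOn_Icc zero_lt_one t ht).eq_deriv _ hf.hasDerivAt.hasDerivWithinAt
    (hg.hasDerivAt.hasDerivWithinAt.congr_of_eventuallyEq h' (h.self_of_nhds ht))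

theorem contDiffAt_deriv {f : ℝ → ℝ} {t : ℝ} (hf : ContDiffAt ℝ ∞ f t) :
    ContDiffAt ℝ ∞ (deriv f) t :=
  (hf.fderiv_right (m := ∞) (by simp)).clm_apply contDiffAt_const

variable {E : Type*} [NormedAddCommGroup E] [NormedSpace ℝ E]
  {F : Type*} [NormedAddCommGroup F] [NormedSpace ℝ F]
  {G : Type*} [TopologicalSpace G] [ChartedSpace E G] [Group G]
  {N : Type*} [TopologicalSpace N] [ChartedSpace F N]
  [MulAction G N] [IsManifold 𝓘(ℝ, F) ∞ N] [LieGroup 𝓘(ℝ, E) ∞ G]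
  [ContMDiffSMul 𝓘(ℝ, E) 𝓘(ℝ, F) ∞ G N]
  {φ : OpenPartialHomeomorph N F} (hφ : φ ∈ IsManifold.maximalAtlas 𝓘(ℝ, F) ∞ N)
  {ℓ : E → TangentBundle 𝓘(ℝ, F) N → ℝ}
  (hℓ : ContMDiff (𝓘(ℝ, E).prod 𝓘(ℝ, F).tangent) 𝓘(ℝ, ℝ) ∞
      (fun p : E × TangentBundle 𝓘(ℝ, F) N => ℓ p.1 p.2))
  {γ : PontryaginCurve E F G N} (hγ : γ.IsSmooth)

namespace PontryaginCurve

include hγ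

theorem contDiff_xi : ContDiff ℝ ∞ γ.xi := by
  have h : γ.xi = fun t => famXi (fun _ => γ) (0, t) :=
    funext fun t => rightVelocity_fam hγ.const_family 0 t
  rw [h]
  exact (contDiff_famXi hγ.const_family).comp (contDiff_prodMk_right 0)

theorem eventually_mem_source {t : ℝ} (ht : γ.n t ∈ φ.source) : ∀ᶠ s in 𝓝 t, γ.n s ∈ φ.source :=
  (ReducedCurve.contMDiff_n hγ.reduced).continuous.continuousAt.eventually
    (φ.open_source.mem_nhds ht)

include hφ

theorem contDiffAt_localP {t : ℝ} (ht : γ.n t ∈ φ.source) : ContDiffAt ℝ ∞ (γ.localP φ) t :=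
  (contDiffAt_famP hγ.const_family hφ (q := (0, t)) ht).comp t
    (contDiff_prodMk_right (0 : ℝ)).contDiffAt

theorem contDiffAt_localVelocity {t : ℝ} (ht : γ.n t ∈ φ.source) :
    ContDiffAt ℝ ∞ (γ.localVelocity φ) t := by
  have h : ContDiffAt ℝ ∞ (fun s => fderiv ℝ (famX (fun _ => γ) φ) ((0 : ℝ), s) (0, 1)) t :=
    (((contDiffAt_famX hγ.const_family hφ (q := (0, t)) ht).fderiv_right (m := ∞)
      (by simp)).comp t (contDiff_prodMk_right (0 : ℝ)).contDiffAt).clm_apply contDiffAt_const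
  refine h.congr_of_eventuallyEq ?_
  filter_upwards [eventually_mem_source hγ ht] with s hs
  exact chartD_velocity hγ.const_family hφ (q := (0, s)) hs

end PontryaginCurve

include hφ hγ

theorem contDiffAt_variationMomentum (d : Direction E F) {t : ℝ} (ht : γ.n t ∈ φ.source) :
    ContDiffAt ℝ ∞ (variationMomentum γ φ d) t :=
  (hγ.M.contDiffAt.clm_apply contDiffAt_const).add
    ((PontryaginCurve.contDiffAt_localP hφ hγ ht).clm_apply contDiffAt_const)

include hℓ

theorem contDiffAt_variationForce (d : Direction E F) {t : ℝ} (ht : γ.n t ∈ φ.source) :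
    ContDiffAt ℝ ∞ (variationForce ℓ γ φ d) t := by
  obtain ⟨h1, h2, h3⟩ := ReducedCurve.contDiffAt_local_partials hφ hℓ hγ.reduced ht
  have hx := ReducedCurve.contDiffAt_localN hφ hγ.reduced ht
  have hν := ReducedCurve.contDiffAt_localNu hφ hγ.reduced ht
  have hu := hγ.reduced.u.contDiffAt (x := t)
  have hM := hγ.M.contDiffAt (x := t)
  have hξ := (PontryaginCurve.contDiff_xi hγ).contDiffAt (x := t)
  have hp := PontryaginCurve.contDiffAt_localP hφ hγ ht
  have hv := PontryaginCurve.contDiffAt_localVelocity hφ hγ ht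
  have hA0 := contDiffAt_localAct (E := E) (G := G) hφ (x := γ.localN φ t) (φ.map_source ht)
  have hA : ContDiffAt ℝ ∞ (fun s => localAct (E := E) G φ (γ.localN φ s)) t := hA0.comp t hx
  have hDA : ContDiffAt ℝ ∞ (fun s => fderiv ℝ (localAct (E := E) G φ) (γ.localN φ s)) t :=
    (hA0.fderiv_right (m := ∞) (by simp)).comp t hx
  have hl : ContDiffAt ℝ ∞ (fun s => lieE G d.g (γ.xi s)) t :=
    contDiff_lieE.contDiffAt.comp t (contDiffAt_const.prodMk hξ)
  exact ((((((h1.clm_apply contDiffAt_const).add (h2.clm_apply contDiffAt_const)).add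
    (h3.clm_apply contDiffAt_const)).add (contDiffAt_const.clm_apply (hξ.sub hu))).add
    (hM.clm_apply (hl.sub contDiffAt_const))).add
    (contDiffAt_const.clm_apply ((hv.sub hν).sub (hA.clm_apply hu)))).sub
    (hp.clm_apply ((contDiffAt_const.add ((hDA.clm_apply contDiffAt_const).clm_apply hu)).add
      (hA.clm_apply contDiffAt_const)))

variable (hst : IsStationary ℓ γ)

include hst

/-- The fundamental lemma on the open set of interior times at which `n` lies in the chart: each
test function there defines an admissible variation. -/
theorem variationForce_eq_deriv_of_mem_Ioo (d : Direction E F) {t : ℝ} (ht : t ∈ Ioo (0 : ℝ) 1)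
    (hs : γ.n t ∈ φ.source) : variationForce ℓ γ φ d t = deriv (variationMomentum γ φ d) t := by
  have hn : Continuous γ.n := (ReducedCurve.contMDiff_n hγ.reduced).continuous
  have hK : IsOpen (γ.n ⁻¹' φ.source ∩ Ioo 0 1) := (φ.open_source.preimage hn).inter isOpen_Ioo
  refine eq_deriv_of_forall_integral_eq_zero hK inter_subset_right
    (fun s hs => (contDiffAt_variationForce hφ hℓ hγ d hs.1).continuousAt.continuousWithinAt)
    (fun s hs => contDiffAt_variationMomentum hφ hγ d hs.1) (fun χ hχ hχc hsub => ?_) ⟨hs, ht⟩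
  have hsupp : ∀ s ∈ tsupport χ, γ.n s ∈ φ.source := fun s hs => (hsub hs).1
  have hx : ContinuousOn (γ.localN φ) (tsupport χ) := fun s hs =>
    (ReducedCurve.contDiffAt_localN hφ hγ.reduced (hsupp s hs)).continuousAt.continuousWithinAt
  -- `δ₁` keeps the displaced base curve in the chart target, by compactness of the support of `χ`;
  -- `δ₂` does the same for the group chart at the identity.
  obtain ⟨δ₁, hδ₁, h₁⟩ := exists_pos_forall_add_smul_mem (hχc.isCompact.image_of_continuousOn hx)
    φ.open_target (image_subset_iff.2 fun s hs => φ.map_source (hsupp s hs)) d.n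
  obtain ⟨δ₂, hδ₂, h₂⟩ := exists_pos_forall_add_smul_mem (K := {localOne E G}) isCompact_singleton
    (chartAt E (1 : G)).open_target (singleton_subset_iff.2 localOne_mem) d.g
  have hδ : 0 < min δ₁ δ₂ := lt_min hδ₁ hδ₂
  have hX : ∀ ε s, γ.n s ∈ φ.source → variationX γ φ χ (min δ₁ δ₂) d (ε, s) ∈ φ.target := by
    intro ε s hs
    by_cases hs' : s ∈ tsupport χ
    · exact h₁ _ (mem_image_of_mem _ hs') _ ((abs_sinScale_le hδ _).trans (min_le_left _ _))
    · rw [variationX_of_mul_eq_zero (by rw [image_eq_zero_of_notMem_tsupport hs', mul_zero])]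
      exact φ.map_source hs
  have hg : ∀ r : ℝ, |r| ≤ min δ₁ δ₂ → localOne E G + r • d.g ∈ (chartAt E (1 : G)).target :=
    fun r hr => h₂ _ (mem_singleton _) r (hr.trans (min_le_right _ _))
  have hvar := isVariation_chartVariation hφ hδ hg hγ hχ hsupp hX
    (image_eq_zero_of_notMem_tsupport fun h => (hsub h).2.1.false)
    (image_eq_zero_of_notMem_tsupport fun h => (hsub h).2.2.false)
  have h3 := (hst _ hvar).unique (hasDerivAt_action_fam hvar.smooth hℓ)
  refine Eq.trans ?_ h3.symm
  exact congrArg (fun k : ℝ → ℝ => ∫ t in (0 : ℝ)..1, k t) (funext fun s =>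
    (hasDerivAt_integrand_chartVariation hφ hδ hg hγ hχ hsupp hX hℓ s).deriv.symm)

/-- The Euler–Lagrange equations in a chart. -/
theorem variationForce_eq_deriv (d : Direction E F) {t : ℝ} (ht : t ∈ Icc (0 : ℝ) 1)
    (hs : γ.n t ∈ φ.source) : variationForce ℓ γ φ d t = deriv (variationMomentum γ φ d) t := by
  refine eq_of_eventually_eq_Ioo ht (contDiffAt_variationForce hφ hℓ hγ d hs).continuousAt
    (contDiffAt_deriv (contDiffAt_variationMomentum hφ hγ d hs)).continuousAt ?_
  filter_upwards [PontryaginCurve.eventually_mem_source hγ hs] with s hs hs'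
  exact variationForce_eq_deriv_of_mem_Ioo hφ hℓ hγ hst d hs' hs

/-- Vary `M` alone; continuous functionals separate the points of `E`. -/
theorem xi_eq_of_isStationary {t : ℝ} (ht : t ∈ Icc (0 : ℝ) 1) (hs : γ.n t ∈ φ.source) :
    γ.xi t = γ.u t := by
  refine sub_eq_zero.1 (SeparatingDual.eq_zero_of_forall_dual_eq_zero (R := ℝ) fun m => ?_)
  have h := variationForce_eq_deriv hφ hℓ hγ hst ⟨0, m, 0, 0, 0, 0⟩ ht hs
  have h0 : variationMomentum γ φ ⟨0, m, 0, 0, 0, 0⟩ = fun _ => 0 := by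
    funext s
    simp [variationMomentum]
  rw [h0, deriv_const] at h
  simpa [variationForce, lieE_zero_left] using h

/-- Vary `u` alone. -/
theorem M_eq_local_of_isStationary {t : ℝ} (ht : t ∈ Icc (0 : ℝ) 1) (hs : γ.n t ∈ φ.source) :
    γ.M t = fderiv ℝ (fun w => localLagrangian ℓ φ w (γ.localN φ t) (γ.localNu φ t)) (γ.u t) -
      γ.localP φ t ∘L localAct G φ (γ.localN φ t) := by
  ext e
  have h := variationForce_eq_deriv hφ hℓ hγ hst ⟨e, 0, 0, 0, 0, 0⟩ ht hs
  have h0 : variationMomentum γ φ ⟨e, 0, 0, 0, 0, 0⟩ = fun _ => 0 := by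
    funext s
    simp [variationMomentum]
  rw [h0, deriv_const] at h
  simp only [variationForce, lieE_zero_left, map_zero, map_sub, zero_sub, map_neg, zero_apply,
    zero_add, add_zero] at h
  rw [sub_apply, ContinuousLinearMap.comp_apply]
  linarith

/-- Vary `ν` alone. -/
theorem localP_eq_of_isStationary {t : ℝ} (ht : t ∈ Icc (0 : ℝ) 1) (hs : γ.n t ∈ φ.source) :
    γ.localP φ t = γ.localDNu ℓ φ t := by
  ext w
  have h := variationForce_eq_deriv hφ hℓ hγ hst ⟨0, 0, 0, 0, w, 0⟩ ht hs
  have h0 : variationMomentum γ φ ⟨0, 0, 0, 0, w, 0⟩ = fun _ => 0 := by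
    funext s
    simp [variationMomentum]
  rw [h0, deriv_const] at h
  simp only [variationForce, lieE_zero_left, map_zero, sub_self, zero_apply,
    zero_add, add_zero] at h
  linarith

/-- Vary `σ` alone; continuous functionals separate the points of `F`. -/
theorem localVelocity_eq_of_isStationary {t : ℝ} (ht : t ∈ Icc (0 : ℝ) 1)
    (hs : γ.n t ∈ φ.source) :
    γ.localVelocity φ t = γ.localNu φ t + localAct G φ (γ.localN φ t) (γ.u t) := by
  refine sub_eq_zero.1 (SeparatingDual.eq_zero_of_forall_dual_eq_zero (R := ℝ) fun p => ?_)
  have h := variationForce_eq_deriv hφ hℓ hγ hst ⟨0, 0, 0, 0, 0, p⟩ ht hs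
  have h0 : variationMomentum γ φ ⟨0, 0, 0, 0, 0, p⟩ = fun _ => 0 := by
    funext s
    simp [variationMomentum]
  rw [h0, deriv_const] at h
  simp only [variationForce, lieE_zero_left, map_zero, sub_self, zero_apply,
    zero_add, add_zero, sub_zero] at h
  rw [← sub_sub]
  exact h

/-- Vary `n` alone, with the fibre coordinates of `ν` and `σ` held fixed in the chart. -/
theorem deriv_localP_of_isStationary {t : ℝ} (ht : t ∈ Icc (0 : ℝ) 1) (hs : γ.n t ∈ φ.source)
    (w : F) :
    deriv (γ.localP φ) t w = γ.localDN ℓ φ t w -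
      γ.localP φ t (fderiv ℝ (localAct G φ) (γ.localN φ t) w (γ.u t)) := by
  have h := variationForce_eq_deriv hφ hℓ hγ hst ⟨0, 0, 0, w, 0, 0⟩ ht hs
  have h0 : variationMomentum γ φ ⟨0, 0, 0, w, 0, 0⟩ = fun s => γ.localP φ s w := by
    funext s
    simp [variationMomentum]
  have h1 := ((PontryaginCurve.contDiffAt_localP hφ hγ hs).differentiableAt
    (by simp)).hasDerivAt.clm_apply (hasDerivAt_const t w)
  rw [h0, h1.deriv] at h
  simp only [variationForce, lieE_zero_left, map_zero, sub_self, zero_apply,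
    zero_add, add_zero] at h
  exact h.symm

/-- Vary `g` alone. -/
theorem deriv_M_of_isStationary {t : ℝ} (ht : t ∈ Icc (0 : ℝ) 1) (hs : γ.n t ∈ φ.source)
    (b : E) : deriv γ.M t b = γ.M t (lieE G b (γ.xi t)) := by
  have h := variationForce_eq_deriv hφ hℓ hγ hst ⟨0, 0, b, 0, 0, 0⟩ ht hs
  have h0 : variationMomentum γ φ ⟨0, 0, b, 0, 0, 0⟩ = fun s => γ.M s b := by
    funext s
    simp [variationMomentum]
  have h1 := (hγ.M.differentiable (by simp) t).hasDerivAt.clm_apply (hasDerivAt_const t b)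
  rw [h0, h1.deriv] at h
  simp only [variationForce, map_zero, sub_zero, zero_apply, zero_add, add_zero] at h
  exact h.symm

omit hφ

theorem relations_of_isStationary {t : ℝ} (ht : t ∈ Icc (0 : ℝ) 1) :
    γ.M t = dU ℓ (γ.u t) (γ.n t) (γ.ν t) + diamond G (γ.σ t) ∧
      γ.σ t = dNu ℓ (γ.u t) (γ.n t) (γ.ν t) ∧ rightVelocity γ.g t = γ.u t := by
  have hφ : chartAt F (γ.n t) ∈ IsManifold.maximalAtlas 𝓘(ℝ, F) ∞ N :=
    IsManifold.chart_mem_maximalAtlas _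
  have hs : γ.n t ∈ (chartAt F (γ.n t)).source := mem_chart_source F _
  refine ⟨?_, ?_, xi_eq_of_isStationary hφ hℓ hγ hst ht hs⟩
  · exact (M_eq_local_of_isStationary hφ hℓ hγ hst ht hs).trans
      (dU_add_diamond_eq_local (G := G) hφ hℓ hs (γ.u t) (γ.ν t) (γ.σ t)).symm
  · exact (eq_dNuModel_iff_local hφ hℓ hs _ _ _).2
      (localP_eq_of_isStationary hφ hℓ hγ hst ht hs)

theorem M_eq_momentum_of_isStationary {t : ℝ} (ht : t ∈ Icc (0 : ℝ) 1) :
    γ.M t = γ.momentum ℓ G t := by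
  obtain ⟨h1, h2, -⟩ := relations_of_isStationary hℓ hγ hst ht
  rw [h1, h2, ReducedCurve.momentum]

theorem eulerPoincare_of_isStationary : γ.toReducedCurve.EulerPoincare ℓ G := by
  have hd : Differentiable ℝ (γ.momentum ℓ G) :=
    (ReducedCurve.contDiff_momentum hℓ hγ.reduced).differentiable (by simp)
  refine ⟨fun t _ => hd t, fun t ht v => ?_, fun φ hφ t ht hs => ?_, fun t ht => ?_⟩
  · have hφ : chartAt F (γ.n t) ∈ IsManifold.maximalAtlas 𝓘(ℝ, F) ∞ N :=
      IsManifold.chart_mem_maximalAtlas _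
    have hs : γ.n t ∈ (chartAt F (γ.n t)).source := mem_chart_source F _
    -- `M` is the momentum only on `[0, 1]`, yet two-sided derivatives are compared, including at
    -- the endpoints.
    have h1 : deriv γ.M t = deriv (γ.momentum ℓ G) t :=
      deriv_eq_of_eventually_eq_Icc ht (hγ.M.differentiable (by simp) t) (hd t)
        (Filter.Eventually.of_forall fun s hs => M_eq_momentum_of_isStationary hℓ hγ hst hs)
    have h2 := deriv_M_of_isStationary hφ hℓ hγ hst ht hs v
    rw [xi_eq_of_isStationary hφ hℓ hγ hst ht hs, lieE_swap, map_neg] at h2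
    rw [← h1, ← M_eq_momentum_of_isStationary hℓ hγ hst ht]
    exact add_eq_zero_iff_eq_neg.2 h2
  · obtain ⟨-, -, h3⟩ := ReducedCurve.contDiffAt_local_partials hφ hℓ hγ.reduced hs
    have hd3 : DifferentiableAt ℝ (γ.localDNu ℓ φ) t := h3.differentiableAt (by simp)
    refine ⟨hd3, ?_⟩
    have h1 : deriv (γ.localP φ) t = deriv (γ.localDNu ℓ φ) t := by
      refine deriv_eq_of_eventually_eq_Icc ht
        ((PontryaginCurve.contDiffAt_localP hφ hγ hs).differentiableAt (by simp)) hd3 ?_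
      filter_upwards [PontryaginCurve.eventually_mem_source hγ hs] with s hs hs'
      exact localP_eq_of_isStationary hφ hℓ hγ hst hs' hs
    have hA : DifferentiableAt ℝ (localAct (E := E) G φ) (γ.localN φ t) :=
      (contDiffAt_localAct hφ (φ.map_source hs)).differentiableAt (by simp)
    ext w
    have h2 := deriv_localP_of_isStationary hφ hℓ hγ hst ht hs w
    rw [h1, localP_eq_of_isStationary hφ hℓ hγ hst ht hs, ← fderiv_localInfAct hA] at h2
    rw [sub_apply, add_apply, h2, localStar, ContinuousLinearMap.comp_apply,
      zero_apply]
    ring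
  · have hφ : chartAt F (γ.n t) ∈ IsManifold.maximalAtlas 𝓘(ℝ, F) ∞ N :=
      IsManifold.chart_mem_maximalAtlas _
    have hs : γ.n t ∈ (chartAt F (γ.n t)).source := mem_chart_source F _
    exact (velocity_eq_iff_local (G := G) hφ hs (velocity γ.n t) (γ.ν t) (γ.u t)).2
      (localVelocity_eq_of_isStationary hφ hℓ hγ hst ht hs)

end Necessity

/-! ### Local existence, uniqueness and smoothness for ordinary differential equations. -/

section LocalODE

variable {X : Type*} [NormedAddCommGroup X] [NormedSpace ℝ X]

theorem eventuallyEq_of_hasDerivAt {f : ℝ × X → X} {x y : ℝ → X} {t₀ : ℝ}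
    (hf : ContDiffAt ℝ 1 f (t₀, x t₀)) (hx : ∀ᶠ t in 𝓝 t₀, HasDerivAt x (f (t, x t)) t)
    (hy : ∀ᶠ t in 𝓝 t₀, HasDerivAt y (f (t, y t)) t) (h : x t₀ = y t₀) : x =ᶠ[𝓝 t₀] y := by
  obtain ⟨K, W, hW, hK⟩ := hf.exists_lipschitzOnWith
  have hmem : ∀ z : ℝ → X, (∀ᶠ t in 𝓝 t₀, HasDerivAt z (f (t, z t)) t) → z t₀ = x t₀ →
      ∀ᶠ t in 𝓝 t₀, HasDerivAt z (f (t, z t)) t ∧ z t ∈ {w | (t, w) ∈ W} := by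
    intro z hz hz0
    have hc : ContinuousAt (fun t => (t, z t)) t₀ :=
      continuousAt_id.prodMk hz.self_of_nhds.continuousAt
    exact hz.and (hc.eventually (p := fun q => q ∈ W) (show W ∈ 𝓝 (t₀, z t₀) by rwa [hz0]))
  refine ODE_solution_unique_of_eventually (v := fun t w => f (t, w)) (s := fun t => {w | (t, w) ∈ W})
    (K := K) (Filter.Eventually.of_forall fun t => ?_) (hmem x hx rfl) (hmem y hy h.symm) h
  intro a ha b hb
  refine (hK ha hb).trans_eq ?_
  -- On a fixed time slice the product distance is the distance in `X`, so the joint Lipschitz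
  -- constant serves every slice.
  rw [Prod.edist_eq]
  simp

/-- Solutions of an ordinary differential equation with smooth right-hand side are smooth. -/
theorem contDiffOn_of_hasDerivAt {f : ℝ × X → X} {V : Set (ℝ × X)} (hf : ContDiffOn ℝ ∞ f V)
    {x : ℝ → X} {s : Set ℝ} (hs : IsOpen s) (hx : ∀ t ∈ s, HasDerivAt x (f (t, x t)) t)
    (hV : ∀ t ∈ s, (t, x t) ∈ V) : ContDiffOn ℝ ∞ x s := by
  refine contDiffOn_infty.2 fun k => ?_
  induction k with
  | zero => exact contDiffOn_zero.2 fun t ht => (hx t ht).continuousAt.continuousWithinAt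
  | succ k ih =>
    refine (contDiffOn_succ_iff_deriv_of_isOpen (n := k) hs).2
      ⟨fun t ht => (hx t ht).differentiableAt.differentiableWithinAt, fun h => ?_, ?_⟩
    · exact absurd h (by simp)
    · have h1 : ContDiffOn ℝ k (fun t => f (t, x t)) s :=
        (hf.of_le (by exact_mod_cast le_top)).comp (contDiffOn_id.prodMk ih) hV
      exact h1.congr fun t ht => (hx t ht).deriv

/-- Time is adjoined as a coordinate with derivative `1`, which reduces the claim to the autonomous
Picard–Lindelöf theorem. -/
theorem exists_hasDerivAt_of_contDiffOn [CompleteSpace X] {f : ℝ × X → X} {V : Set (ℝ × X)}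
    (hVo : IsOpen V) (hf : ContDiffOn ℝ ∞ f V) {t₀ : ℝ} {x₀ : X} (h0 : (t₀, x₀) ∈ V) :
    ∃ x : ℝ → X, ∃ ε > 0, x t₀ = x₀ ∧ ∀ t ∈ Ioo (t₀ - ε) (t₀ + ε),
      ContDiffAt ℝ ∞ x t ∧ HasDerivAt x (f (t, x t)) t ∧ (t, x t) ∈ V := by
  have hF : ContDiffAt ℝ 1 (fun p : ℝ × X => ((1 : ℝ), f p)) (t₀, x₀) :=
    contDiffAt_const.prodMk ((hf.contDiffAt (hVo.mem_nhds h0)).of_le (by simp))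
  obtain ⟨α, hα0, ε, hε, hα⟩ :=
    hF.exists_forall_mem_closedBall_exists_eq_forall_mem_Ioo_hasDerivAt₀ t₀
  have hfst : ∀ t ∈ Ioo (t₀ - ε) (t₀ + ε), (α t).1 = t := by
    have hd : ∀ t ∈ Ioo (t₀ - ε) (t₀ + ε), HasDerivAt (fun t => (α t).1 - t) 0 t := fun t ht => by
      have h1 : HasDerivAt (fun t => (α t).1) 1 t :=
        (ContinuousLinearMap.fst ℝ ℝ X).hasFDerivAt.comp_hasDerivAt t (hα t ht)
      exact (h1.sub (hasDerivAt_id t)).congr_deriv (sub_self 1)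
    intro t ht
    have h1 := isOpen_Ioo.is_const_of_deriv_eq_zero (isPreconnected_Ioo (a := t₀ - ε) (b := t₀ + ε))
      (f := fun t => (α t).1 - t)
      (fun t ht => (hd t ht).differentiableAt.differentiableWithinAt)
      (fun t ht => (hd t ht).deriv) ht (y := t₀) ⟨by linarith, by linarith⟩
    simpa [hα0, sub_eq_zero] using h1
  have hder : ∀ t ∈ Ioo (t₀ - ε) (t₀ + ε),
      HasDerivAt (fun t => (α t).2) (f (t, (α t).2)) t := fun t ht => by
    have h1 : HasDerivAt (fun t => (α t).2) (f (α t)) t :=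
      (ContinuousLinearMap.snd ℝ ℝ X).hasFDerivAt.comp_hasDerivAt t (hα t ht)
    have h2 : α t = (t, (α t).2) := Prod.ext (hfst t ht) rfl
    rw [← h2]
    exact h1
  have ht₀ : t₀ ∈ Ioo (t₀ - ε) (t₀ + ε) := ⟨by linarith, by linarith⟩
  have hc : ContinuousAt (fun t => (t, (α t).2)) t₀ :=
    continuousAt_id.prodMk (hder t₀ ht₀).continuousAt
  have hV : ∀ᶠ t in 𝓝 t₀, (t, (α t).2) ∈ V :=
    hc.eventually (hVo.mem_nhds (by simpa [hα0] using h0))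
  -- The interval is shrunk so that the solution stays in `V`, where `f` is smooth.
  obtain ⟨η, hη, hball⟩ := Metric.eventually_nhds_iff_ball.1 (hV.and (isOpen_Ioo.mem_nhds ht₀))
  rw [Real.ball_eq_Ioo] at hball
  have hsm : ContDiffOn ℝ ∞ (fun t => (α t).2) (Ioo (t₀ - η) (t₀ + η)) :=
    contDiffOn_of_hasDerivAt hf isOpen_Ioo (fun t ht => hder t (hball t ht).2)
      fun t ht => (hball t ht).1
  exact ⟨fun t => (α t).2, η, hη, by simp [hα0], fun t ht =>
    ⟨hsm.contDiffAt (isOpen_Ioo.mem_nhds ht), hder t (hball t ht).2, (hball t ht).1⟩⟩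

end LocalODE

/-! ### The reconstruction equation on the group. -/

section Reconstruction

variable {E : Type*} [NormedAddCommGroup E] [NormedSpace ℝ E]
  {G : Type*} [TopologicalSpace G] [ChartedSpace E G] [Group G] [LieGroup 𝓘(ℝ, E) ∞ G]

/-- The constant factor cancels in `g(s) h (g(t) h)⁻¹`. This invariance lets solutions be moved to
any initial value, and makes the chart at the identity sufficient. -/
theorem rightVelocity_mul_const {g : ℝ → G} {t : ℝ} (hg : MDifferentiableAt 𝓘(ℝ, ℝ) 𝓘(ℝ, E) g t)
    (h : G) : rightVelocity (E := E) (fun s => g s * h) t = rightVelocity g t := by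
  have hm : MDifferentiableAt 𝓘(ℝ, ℝ) 𝓘(ℝ, E) (fun s => g s * h) t :=
    ((contMDiff_mul_right (I := 𝓘(ℝ, E)) (n := ∞) (a := h)).mdifferentiableAt (by simp)).comp t hg
  rw [rightVelocity_eq_deriv hm, rightVelocity_eq_deriv hg]
  simp

theorem rightVelocity_congr {g h : ℝ → G} {t : ℝ} (hg : MDifferentiableAt 𝓘(ℝ, ℝ) 𝓘(ℝ, E) g t)
    (hgh : h =ᶠ[𝓝 t] g) : rightVelocity (E := E) h t = rightVelocity g t := by
  rw [rightVelocity_eq_deriv (hg.congr_of_eventuallyEq hgh), rightVelocity_eq_deriv hg]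
  refine Filter.EventuallyEq.deriv_eq ?_
  filter_upwards [hgh] with s hs
  rw [hs, hgh.self_of_nhds]

/-- The right velocity in terms of the coordinates at the identity of a right translate. -/
theorem rightVelocity_eq_localMC {g : ℝ → G} {t : ℝ}
    (hg : MDifferentiableAt 𝓘(ℝ, ℝ) 𝓘(ℝ, E) g t) (h : G)
    (hs : g t * h ∈ (chartAt E (1 : G)).source) {y' : E}
    (hy : HasDerivAt (fun s => chartAt E (1 : G) (g s * h)) y' t) :
    rightVelocity g t = localMC G (chartAt E (1 : G) (g t * h)) y' := by
  set κ := chartAt E (1 : G) with hκ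
  have hm : MDifferentiableAt 𝓘(ℝ, ℝ) 𝓘(ℝ, E) (fun s => g s * h) t :=
    ((contMDiff_mul_right (I := 𝓘(ℝ, E)) (n := ∞) (a := h)).mdifferentiableAt (by simp)).comp t hg
  have hz := κ.map_source hs
  have hD : DifferentiableAt ℝ (fun x => localDiv G x (κ (g t * h))) (κ (g t * h)) :=
    ((contDiffAt_localDiv (G := G) hz hz (by rw [mul_inv_cancel]; exact mem_chart_source E 1)).comp
      (κ (g t * h)) (f := fun x => (x, κ (g t * h))) (by fun_prop)).differentiableAt (by simp)
  rw [rightVelocity_eq_deriv hg]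
  refine HasDerivAt.deriv ?_
  refine (hD.hasFDerivAt.comp_hasDerivAt (f := fun s => κ (g s * h)) t hy).congr_of_eventuallyEq ?_
  filter_upwards [hm.continuousAt.eventually (κ.open_source.mem_nhds hs)] with s hs'
  simp only [Function.comp_apply, localDiv, ← hκ]
  rw [κ.left_inv hs', κ.left_inv hs]
  group

/-- The domain in which the Maurer–Cartan form is invertible. -/
def invertibleDomain (E G : Type*) [NormedAddCommGroup E] [NormedSpace ℝ E] [TopologicalSpace G]
    [ChartedSpace E G] [Group G] : Set E :=
  (chartAt E (1 : G)).target ∩ localMC G ⁻¹' range ((↑) : (E ≃L[ℝ] E) → E →L[ℝ] E)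

theorem localOne_mem_invertibleDomain : localOne E G ∈ invertibleDomain E G :=
  ⟨localOne_mem, ContinuousLinearEquiv.refl ℝ E, localMC_props.1.symm⟩

variable [CompleteSpace E]

theorem isOpen_invertibleDomain : IsOpen (invertibleDomain E G) :=
  ContinuousOn.isOpen_inter_preimage
    (fun _ hz => (contDiffAt_localMC_of_mem hz).continuousAt.continuousWithinAt)
    (chartAt E (1 : G)).open_target ContinuousLinearEquiv.isOpen

theorem contDiffOn_inverse_localMC :
    ContDiffOn ℝ ∞ (fun z => (localMC (E := E) G z).inverse) (invertibleDomain E G) := by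
  rintro z ⟨hz, e, he⟩
  have h := contDiffAt_map_inverse (𝕜 := ℝ) (n := ∞) e
  rw [he] at h
  exact (h.comp z (contDiffAt_localMC_of_mem hz)).contDiffWithinAt

/-- In coordinates at the identity `ġ g⁻¹ = u` reads `localMC(y) ẏ = u`; this is the field obtained
by solving for `ẏ`. -/
theorem contDiffOn_reconstructionField {u : ℝ → E} (hu : ContDiff ℝ ∞ u) :
    ContDiffOn ℝ ∞ (fun p : ℝ × E => (localMC G p.2).inverse (u p.1))
      (univ ×ˢ invertibleDomain E G) :=
  (contDiffOn_inverse_localMC.comp contDiffOn_snd fun _ hp => hp.2).clm_apply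
    (hu.comp contDiff_fst).contDiffOn

/-- The curve `g` is smooth and solves `ġ g⁻¹ = u` on `s`. -/
def IsReconstructionOn (u : ℝ → E) (g : ℝ → G) (s : Set ℝ) : Prop :=
  ∀ t ∈ s, ContMDiffAt 𝓘(ℝ, ℝ) 𝓘(ℝ, E) ∞ g t ∧ rightVelocity g t = u t

omit [CompleteSpace E] in
theorem IsReconstructionOn.congr {u : ℝ → E} {g h : ℝ → G} {s : Set ℝ} {t : ℝ}
    (hg : IsReconstructionOn u g s) (ht : t ∈ s) (hgh : h =ᶠ[𝓝 t] g) :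
    ContMDiffAt 𝓘(ℝ, ℝ) 𝓘(ℝ, E) ∞ h t ∧ rightVelocity h t = u t :=
  ⟨(hg t ht).1.congr_of_eventuallyEq hgh,
    (rightVelocity_congr ((hg t ht).1.mdifferentiableAt (by simp)) hgh).trans (hg t ht).2⟩

omit [CompleteSpace E] in
theorem IsReconstructionOn.mul_const {u : ℝ → E} {g : ℝ → G} {s : Set ℝ}
    (hg : IsReconstructionOn u g s) (h : G) : IsReconstructionOn u (fun t => g t * h) s :=
  fun t ht => ⟨(hg t ht).1.mul contMDiffAt_const,
    (rightVelocity_mul_const ((hg t ht).1.mdifferentiableAt (by simp)) h).trans (hg t ht).2⟩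

theorem IsReconstructionOn.eventually_hasDerivAt {u : ℝ → E} {g : ℝ → G} {s : Set ℝ}
    (hs : IsOpen s) (hg : IsReconstructionOn u g s) {t₀ : ℝ} (ht : t₀ ∈ s) :
    ∀ᶠ t in 𝓝 t₀, HasDerivAt (fun t => chartAt E (1 : G) (g t * (g t₀)⁻¹))
      ((localMC G (chartAt E (1 : G) (g t * (g t₀)⁻¹))).inverse (u t)) t := by
  have hsm : ∀ t ∈ s, ContMDiffAt 𝓘(ℝ, ℝ) 𝓘(ℝ, E) ∞ (fun t => g t * (g t₀)⁻¹) t :=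
    fun t ht => (hg t ht).1.mul contMDiffAt_const
  have h1 : g t₀ * (g t₀)⁻¹ ∈ (chartAt E (1 : G)).source := by
    rw [mul_inv_cancel]; exact mem_chart_source E 1
  have hc : ContinuousAt (fun t => chartAt E (1 : G) (g t * (g t₀)⁻¹)) t₀ :=
    (contDiffAt_chart_comp le_rfl mem_maximalAtlas_one (hsm t₀ ht) h1).continuousAt
  have h2 : chartAt E (1 : G) (g t₀ * (g t₀)⁻¹) ∈ invertibleDomain E G := by
    rw [mul_inv_cancel]; exact localOne_mem_invertibleDomain
  filter_upwards [hs.mem_nhds ht, (hsm t₀ ht).continuousAt.eventually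
    ((chartAt E (1 : G)).open_source.mem_nhds h1),
    hc.eventually (isOpen_invertibleDomain.mem_nhds h2)] with t hts hsrc hinv
  have hd := ((contDiffAt_chart_comp le_rfl mem_maximalAtlas_one (hsm t hts) hsrc).differentiableAt
    (by simp)).hasDerivAt
  have h3 := rightVelocity_eq_localMC ((hg t hts).1.mdifferentiableAt (by simp)) _ hsrc hd
  refine hd.congr_deriv ?_
  obtain ⟨-, e, he⟩ := hinv
  rw [← (hg t hts).2, h3, ← he, ContinuousLinearMap.inverse_equiv]
  simp

/-- Translating both curves by `(g t₀)⁻¹` brings them to the identity, where their coordinates solve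
the same Lipschitz equation. -/
theorem IsReconstructionOn.eventuallyEq {u : ℝ → E} (hu : ContDiff ℝ ∞ u) {g h : ℝ → G}
    {s : Set ℝ} (hs : IsOpen s) (hg : IsReconstructionOn u g s) (hh : IsReconstructionOn u h s)
    {t₀ : ℝ} (ht : t₀ ∈ s) (h0 : g t₀ = h t₀) : g =ᶠ[𝓝 t₀] h := by
  have h1 : g t₀ * (g t₀)⁻¹ ∈ (chartAt E (1 : G)).source := by
    rw [mul_inv_cancel]; exact mem_chart_source E 1
  have hev : ∀ k : ℝ → G, IsReconstructionOn u k s → k t₀ = g t₀ →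
      ∀ᶠ t in 𝓝 t₀, k t * (g t₀)⁻¹ ∈ (chartAt E (1 : G)).source := fun k hk hk0 =>
    ((hk t₀ ht).1.mul contMDiffAt_const).continuousAt.eventually
      ((chartAt E (1 : G)).open_source.mem_nhds (show k t₀ * (g t₀)⁻¹ ∈ _ by rwa [hk0]))
  have h2 : chartAt E (1 : G) (g t₀ * (g t₀)⁻¹) ∈ invertibleDomain E G := by
    rw [mul_inv_cancel]; exact localOne_mem_invertibleDomain
  have h3 := hh.eventually_hasDerivAt hs ht
  rw [← h0] at h3
  have key := eventuallyEq_of_hasDerivAt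
    (f := fun p : ℝ × E => (localMC G p.2).inverse (u p.1))
    (((contDiffOn_reconstructionField hu).contDiffAt
      ((isOpen_univ.prod isOpen_invertibleDomain).mem_nhds ⟨mem_univ _, h2⟩)).of_le (by simp))
    (hg.eventually_hasDerivAt hs ht) h3 (by rw [h0])
  filter_upwards [key, hev g hg rfl, hev h hh h0.symm] with t hk hgt hht
  exact mul_right_cancel ((chartAt E (1 : G)).injOn hgt hht hk)

theorem exists_isReconstructionOn {u : ℝ → E} (hu : ContDiff ℝ ∞ u) (t₀ : ℝ) :
    ∃ g : ℝ → G, ∃ ε > 0, g t₀ = 1 ∧ IsReconstructionOn u g (Ioo (t₀ - ε) (t₀ + ε)) := by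
  obtain ⟨x, ε, hε, hx0, hx⟩ := exists_hasDerivAt_of_contDiffOn
    (isOpen_univ.prod isOpen_invertibleDomain) (contDiffOn_reconstructionField (G := G) hu)
    (t₀ := t₀) ⟨mem_univ _, localOne_mem_invertibleDomain⟩
  refine ⟨fun t => (chartAt E (1 : G)).symm (x t), ε, hε, ?_, fun t ht => ?_⟩
  · exact (congrArg _ hx0).trans symm_localOne
  · obtain ⟨h1, h2, -, hxt, e, he⟩ := hx t ht
    have hsm := contMDiffAt_chart_symm_comp mem_maximalAtlas_one h1 hxt
    refine ⟨hsm, ?_⟩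
    have hd : HasDerivAt (fun s => chartAt E (1 : G) ((chartAt E (1 : G)).symm (x s) * 1))
        ((localMC G (x t)).inverse (u t)) t := by
      refine h2.congr_of_eventuallyEq ?_
      filter_upwards [h1.continuousAt.eventually
        ((chartAt E (1 : G)).open_target.mem_nhds hxt)] with s hs
      rw [mul_one, (chartAt E (1 : G)).right_inv hs]
    rw [rightVelocity_eq_localMC (hsm.mdifferentiableAt (by simp)) 1
      (by rw [mul_one]; exact (chartAt E (1 : G)).map_target hxt) hd, mul_one,
      (chartAt E (1 : G)).right_inv hxt, ← he, ContinuousLinearMap.inverse_equiv]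
    simp

/-- A right translate of `h` agrees with `g` at `t₀`, hence near `t₀` by local uniqueness, so
switching from one to the other at `t₀` is smooth. -/
theorem IsReconstructionOn.exists_glue {u : ℝ → E} (hu : ContDiff ℝ ∞ u) {g h : ℝ → G}
    {a b c d t₀ : ℝ} (hg : IsReconstructionOn u g (Ioo a b)) (hh : IsReconstructionOn u h (Ioo c d))
    (hab : t₀ ∈ Ioo a b) (hcd : t₀ ∈ Ioo c d) :
    ∃ k : ℝ → G, IsReconstructionOn u k (Ioo a d) ∧ ∀ t ≤ t₀, k t = g t := by
  classical
  set h' : ℝ → G := fun t => h t * ((h t₀)⁻¹ * g t₀) with hh'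
  have hr : IsReconstructionOn u h' (Ioo c d) := hh.mul_const _
  have heq : g =ᶠ[𝓝 t₀] h' := by
    refine IsReconstructionOn.eventuallyEq hu (isOpen_Ioo.inter isOpen_Ioo)
      (fun t ht => hg t ht.1) (fun t ht => hr t ht.2) ⟨hab, hcd⟩ ?_
    simp only [hh', mul_inv_cancel_left]
  refine ⟨fun t => if t ≤ t₀ then g t else h' t, fun t ht => ?_, fun t ht => if_pos ht⟩
  rcases lt_trichotomy t t₀ with hlt | rfl | hgt
  · refine hg.congr ⟨ht.1, hlt.trans hab.2⟩ ?_
    filter_upwards [Iio_mem_nhds hlt] with s hs using if_pos (le_of_lt hs)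
  · refine hg.congr hab ?_
    filter_upwards [heq] with s hs
    by_cases hst : s ≤ t
    · exact if_pos hst
    · exact (if_neg hst).trans hs.symm
  · refine hr.congr ⟨hcd.1.trans hgt, ht.2⟩ ?_
    filter_upwards [Ioi_mem_nhds hgt] with s hs using if_neg (not_le.2 hs)

/-- Continuous induction on `[0, 1]`: the set of times passed by some solution contains `0`, is open
to the right by definition, and is closed by gluing on a local solution at a limit time. -/
theorem exists_isReconstructionOn_Icc {u : ℝ → E} (hu : ContDiff ℝ ∞ u) :
    ∃ η > 0, ∃ b > 1, ∃ g : ℝ → G, g 0 = 1 ∧ IsReconstructionOn u g (Ioo (-η) b) := by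
  obtain ⟨g₀, η, hη, hg₀, hr₀⟩ := exists_isReconstructionOn (G := G) hu 0
  rw [zero_sub, zero_add] at hr₀
  refine ⟨η, hη, ?_⟩
  set S : Set ℝ := {t | ∃ b > t, ∃ g : ℝ → G, g 0 = 1 ∧ IsReconstructionOn u g (Ioo (-η) b)} with hS
  have hclosed : IsClosed (S ∩ Icc 0 1) := by
    refine isClosed_of_closure_subset fun t ht => ?_
    have htI : t ∈ Icc (0 : ℝ) 1 := closure_minimal inter_subset_right isClosed_Icc ht
    refine ⟨?_, htI⟩
    obtain ⟨h, ε, hε, -, hh⟩ := exists_isReconstructionOn (G := G) hu t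
    obtain ⟨s, hsI, ⟨b, hb, g, hg0, hg⟩, hs01⟩ := mem_closure_iff_nhds.1 ht _
      (Ioo_mem_nhds (show t - ε < t by linarith) (show t < t + ε by linarith))
    -- The switching time lies beyond `s ≥ 0`, so the value at `0` is kept, and inside both
    -- intervals of existence.
    obtain ⟨t₀, h1, h2⟩ := exists_between (lt_min hb hsI.2)
    obtain ⟨k, hk, hkg⟩ := hg.exists_glue hu hh (t₀ := t₀)
      ⟨by linarith [hs01.1], h2.trans_le (min_le_left _ _)⟩
      ⟨hsI.1.trans h1, h2.trans_le (min_le_right _ _)⟩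
    exact ⟨t + ε, by linarith, k, by rw [hkg 0 (hs01.1.trans h1.le), hg0], hk⟩
  have hsub : Icc (0 : ℝ) 1 ⊆ S := by
    refine hclosed.Icc_subset_of_forall_mem_nhdsWithin ⟨η, hη, g₀, hg₀, hr₀⟩ ?_
    rintro t ⟨⟨b, hb, g, hg⟩, -⟩
    filter_upwards [mem_nhdsWithin_of_mem_nhds (Iio_mem_nhds hb)] with s hs
    exact ⟨b, hs, g, hg⟩
  exact hsub (right_mem_Icc.2 zero_le_one)

/-- The reconstruction equation `ġ g⁻¹ = u` has a smooth solution on `[0, 1]`. -/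
theorem exists_reconstruction {u : ℝ → E} (hu : ContDiff ℝ ∞ u) :
    ∃ g : ℝ → G, ContMDiff 𝓘(ℝ, ℝ) 𝓘(ℝ, E) ∞ g ∧ g 0 = 1 ∧
      ∀ t ∈ Icc (0 : ℝ) 1, rightVelocity g t = u t := by
  obtain ⟨η, hη, b, hb, g, hg0, hg⟩ := exists_isReconstructionOn_Icc (G := G) hu
  obtain ⟨r, hr0, hr⟩ : ∃ r, 0 < r ∧ r < min η (b - 1) :=
    exists_between (lt_min hη (by linarith))
  have hr1 := hr.trans_le (min_le_left _ _)
  have hr2 := hr.trans_le (min_le_right _ _)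
  -- `θ` is a smooth map of the line into `[-r, 1 + r] ⊆ (-η, b)` that is the identity near `[0,
  -- 1]`. Composing with it makes the solution smooth on all of `ℝ` without changing it on `[0, 1]`.
  let f : ContDiffBump (1 / 2 : ℝ) := ⟨1 / 2 + r / 2, 1 / 2 + r, by linarith, by linarith⟩
  set θ : ℝ → ℝ := fun t => 1 / 2 + f t * (t - 1 / 2) with hθ
  have hθs : ContDiff ℝ ∞ θ := by
    exact contDiff_const.add (f.contDiff.mul (contDiff_id.sub contDiff_const))
  have hθm : ∀ t, θ t ∈ Ioo (-η) b := by
    intro t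
    have h1 : |f t * (t - 1 / 2)| ≤ 1 / 2 + r := by
      by_cases ht : dist t (1 / 2) < 1 / 2 + r
      · rw [abs_mul, abs_of_nonneg f.nonneg]
        rw [Real.dist_eq] at ht
        exact (mul_le_of_le_one_left (abs_nonneg _) f.le_one).trans ht.le
      · rw [f.zero_of_le_dist (not_lt.1 ht), zero_mul, abs_zero]
        linarith
    have h2 := abs_le.1 h1
    exact ⟨by simp only [hθ]; linarith, by simp only [hθ]; linarith⟩
  have hid : ∀ t ∈ Icc (0 : ℝ) 1, θ =ᶠ[𝓝 t] id := by
    intro t ht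
    have : t ∈ Metric.ball (1 / 2 : ℝ) (1 / 2 + r / 2) := by
      rw [Real.ball_eq_Ioo]
      exact ⟨by linarith [ht.1], by linarith [ht.2]⟩
    filter_upwards [Metric.isOpen_ball.mem_nhds this] with s hs
    simp only [hθ, f.one_of_mem_closedBall (Metric.ball_subset_closedBall hs), id]
    ring
  refine ⟨fun t => g (θ t), fun t => ?_, ?_, fun t ht => ?_⟩
  · exact (hg (θ t) (hθm t)).1.comp t hθs.contMDiff.contMDiffAt
  · have h0 : θ 0 = 0 := (hid 0 (left_mem_Icc.2 zero_le_one)).eq_of_nhds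
    simp only [h0, hg0]
  · refine (hg.congr (h := fun t => g (θ t)) ⟨by linarith [ht.1], by linarith [ht.2]⟩ ?_).2
    filter_upwards [hid t ht] with s hs
    rw [hs, id]

end Reconstruction

/-! ### Lifting a solution of (EP) to a stationary curve. -/

section Existence

variable {E : Type*} [NormedAddCommGroup E] [NormedSpace ℝ E]
  {F : Type*} [NormedAddCommGroup F] [NormedSpace ℝ F]
  {G : Type*} [TopologicalSpace G] [ChartedSpace E G] [Group G]
  {N : Type*} [TopologicalSpace N] [ChartedSpace F N]
  [MulAction G N] [IsManifold 𝓘(ℝ, F) ∞ N] [LieGroup 𝓘(ℝ, E) ∞ G]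
  [ContMDiffSMul 𝓘(ℝ, E) 𝓘(ℝ, F) ∞ G N]
  {ℓ : E → TangentBundle 𝓘(ℝ, F) N → ℝ}
  (hℓ : ContMDiff (𝓘(ℝ, E).prod 𝓘(ℝ, F).tangent) 𝓘(ℝ, ℝ) ∞
      (fun p : E × TangentBundle 𝓘(ℝ, F) N => ℓ p.1 p.2))
  {r : ReducedCurve E F N} (hr : r.IsSmooth)

include hℓ hr

/-- The fibre derivative of the Lagrangian along a smooth curve is a smooth curve in `T*N`. -/
theorem contMDiff_dNu :
    ContMDiff 𝓘(ℝ, ℝ) (𝓘(ℝ, F).prod 𝓘(ℝ, F →L[ℝ] ℝ)) ∞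
      (fun t => Bundle.TotalSpace.mk' (F →L[ℝ] ℝ)
        (E := fun x : N => TangentSpace 𝓘(ℝ, F) x →L[ℝ] ℝ) (r.n t)
        (dNu ℓ (r.u t) (r.n t) (r.ν t))) := fun t => by
  set φ := chartAt F (r.n t) with hφdef
  have hφ : φ ∈ IsManifold.maximalAtlas 𝓘(ℝ, F) ∞ N := IsManifold.chart_mem_maximalAtlas _
  have ht : r.n t ∈ φ.source := mem_chart_source F _
  obtain ⟨-, -, h3⟩ := ReducedCurve.contDiffAt_local_partials hφ hℓ hr ht
  refine (contMDiffAt_cotangent_of_coord hφ (ReducedCurve.contDiffAt_localN hφ hr ht) h3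
    (φ.map_source ht)).congr_of_eventuallyEq ?_
  filter_upwards [(ReducedCurve.contMDiff_n hr).continuous.continuousAt.eventually
    (φ.open_source.mem_nhds ht)] with s hs
  refine cotangent_mk_congr (φ.left_inv hs).symm ?_
  refine (dNu_eq_local hℓ hφ (r.u s) hs (r.ν s)).trans ?_
  exact congrArg (fun y => r.localDNu ℓ φ s ∘L chartD φ y) (φ.left_inv hs).symm

variable [CompleteSpace E]

/-- `M` and `σ` are defined by the momentum relations at all times, so those hold by definition, and
`g` comes from reconstruction; sufficiency then applies. -/
theorem exists_isStationary_of_eulerPoincare (hEP : r.EulerPoincare ℓ G) :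
    ∃ γ : PontryaginCurve E F G N,
      γ.toReducedCurve = r ∧ γ.IsSmooth ∧ γ.g 0 = 1 ∧ IsStationary ℓ γ := by
  obtain ⟨g, hg, hg0, hgu⟩ := exists_reconstruction (G := G) hr.u
  refine ⟨{ r with
    g := g
    M := r.momentum ℓ G
    σ := fun t => dNu ℓ (r.u t) (r.n t) (r.ν t) }, rfl,
    ⟨hr, hg, ReducedCurve.contDiff_momentum hℓ hr, contMDiff_dNu hℓ hr⟩, hg0,
    isStationary_of_eulerPoincare hℓ (fun t ht => ⟨rfl, rfl, hgu t ht⟩) hEP⟩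

end Existence

end Metamorphosis

end

/-! ### The Hamilton–Pontryagin principle. -/

theorem mainTheorem3
    {E : Type*} [NormedAddCommGroup E] [NormedSpace ℝ E] [CompleteSpace E]
    {F : Type*} [NormedAddCommGroup F] [NormedSpace ℝ F] [CompleteSpace F]
    {G : Type*} [TopologicalSpace G] [ChartedSpace E G] [Group G] [LieGroup 𝓘(ℝ, E) ∞ G]
    {N : Type*} [TopologicalSpace N] [ChartedSpace F N] [IsManifold 𝓘(ℝ, F) ∞ N]
    [MulAction G N] [ContMDiffSMul 𝓘(ℝ, E) 𝓘(ℝ, F) ∞ G N]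
    (ℓ : E → TangentBundle 𝓘(ℝ, F) N → ℝ)
    (hℓ : ContMDiff (𝓘(ℝ, E).prod 𝓘(ℝ, F).tangent) 𝓘(ℝ, ℝ) ∞
      (fun p : E × TangentBundle 𝓘(ℝ, F) N => ℓ p.1 p.2)) :
    (∀ γ : Metamorphosis.PontryaginCurve E F G N, γ.IsSmooth →
      (Metamorphosis.IsStationary ℓ γ ↔
        (∀ t ∈ Icc (0 : ℝ) 1,
          γ.M t = Metamorphosis.dU ℓ (γ.u t) (γ.n t) (γ.ν t) + Metamorphosis.diamond G (γ.σ t) ∧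
          γ.σ t = Metamorphosis.dNu ℓ (γ.u t) (γ.n t) (γ.ν t) ∧
          Metamorphosis.rightVelocity γ.g t = γ.u t) ∧
        γ.toReducedCurve.EulerPoincare ℓ G)) ∧
    (∀ r : Metamorphosis.ReducedCurve E F N, r.IsSmooth →
      (r.EulerPoincare ℓ G ↔
        ∃ γ : Metamorphosis.PontryaginCurve E F G N,
          γ.toReducedCurve = r ∧ γ.IsSmooth ∧ γ.g 0 = 1 ∧ Metamorphosis.IsStationary ℓ γ)) := by
  refine ⟨fun γ hγ => ⟨fun hst => ⟨fun t ht =>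
    Metamorphosis.relations_of_isStationary hℓ hγ hst ht,
    Metamorphosis.eulerPoincare_of_isStationary hℓ hγ hst⟩, fun h =>
    Metamorphosis.isStationary_of_eulerPoincare hℓ h.1 h.2⟩, fun r hr =>
    ⟨Metamorphosis.exists_isStationary_of_eulerPoincare hℓ hr, ?_⟩⟩
  rintro ⟨γ, rfl, hγ, -, hst⟩
  exact Metamorphosis.eulerPoincare_of_isStationary hℓ hγ hst
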